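/- Let $T>0$, $0<\alpha\le 1$, and let $f:[-T,T]\to\mathbb R$ be Lipschitz continuous and not identically zero. Consider the one-parameter regression model $y(t)=\theta f(t)+\varepsilon(t)$, $t\in[-T,T]$, whose error has a correlation function $\rho_\alpha$ in one of the following families: - Cauchy: $\rho_\alpha(t)=(1+|t|^\beta)^{-\alpha/\beta}$ with $\beta>0$; - Mittag-Leffler: $\rho_\alpha(t)=\Gamma(\beta)\sum_{k\ge0}\frac{(-|t|^\alpha)^k}{\Gamma(\nu k+\beta)}$ with $0<\nu\le1$ and $\nu<\beta$; - SVF: $\rho_\alpha(t)=L(|t|)/|t|^\alpha$ for all sufficiently large $|t|$, where $L$ is measurable and slowly varying at infinity, and $\rho_\alpha(t)=O(|t|^{-\alpha})$ as $|t|\to\infty$. Let $d_\alpha(N)=N^{1-\alpha}$ if $\alpha<1$ and $d_\alpha(N)=\ln N$ if $\alpha=1$, multiplied by $L(N)$ in the SVF family, and let $$Q_\alpha(t)=\lim_{N\to\infty}\frac1{d_\alpha(N)}\sum_{j=1}^N\rho_\alpha(jt),\qquad t>0,\qquad Q_\alpha(0)=\infty ;$$ in the SVF family with $\alpha=1$ it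 is assumed that this limit exists and is finite for every $t>0$ (in all other cases this is part of the assertion). Let $c=\Gamma(\beta)/\Gamma(\beta-\nu)$ in the Mittag-Leffler family, $c=Q_1(1)$ in the SVF family with $\alpha=1$, and $c=1$ otherwise. A design is a probability measure $\xi$ on $[-T,T]$. If $a:(0,1)\to[-T,T]$ is the inverse of its distribution function, the asymptotic variance of the least-squares estimate of $\theta$ under $\xi$ is, up to a constant factor, $$\Psi_\alpha(\xi)=\frac{\int_0^1 f^2(a(u))\,Q_\alpha(a'(u))\,du}{\left(\int_0^1 f^2(a(u))\,du\right)^2},$$ with $\Psi_\alpha(\xi)=\infty$ if the denominator vanishes and $0\cdot\infty=0$. A design is asymptotically optimal if it minimizes $\Psi_\alpha$ over all designs. Then an asymptotically optimal design exists that is absolutely continuous with respect to Lebesgue measure and has, for some $\mu,\tau\in\mathbb R$, the density $$p^*(t)=\left(\frac{1-\alpha}{c(1+\alpha)}\Bigl(\mu-\frac{\tau}{f^2(t)}\Bigr)\right)_+^{1/\alpha}\quad(\alpha<1),\qquad p^*(t)=\left(\frac1{2c}\Bigl(\mu-\frac{\tau}{f^2(t)}\Bigr)\right)_+\quad(\alpha=1)$$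 on $[-T,T]$, with $p^*(t)=0$ if $f(t)=0$, where $$\mu=2\,\frac{\int f^2(t)\,Q_\alpha(1/p^*(t))\,p^*(t)\,dt}{\int f^2(t)\,p^*(t)\,dt},\qquad \tau=\int f^2(t)\,Q_\alpha(1/p^*(t))\,p^*(t)\,dt+\int f^2(t)\,Q_\alpha'(1/p^*(t))\,dt$$ (integrals over $[-T,T]$; the terms with $Q_\alpha$ and $Q_\alpha'$ are read as $0$ where $p^*=0$). The function $p^*$ also minimizes $$\Psi_\alpha(p)=\frac{\int f^2(t)\,Q_\alpha\!\left(\int p(u)\,du/p(t)\right)p(t)\,dt}{\left(\int f^2(t)p(t)\,dt\right)^2}\int p(t)\,dt$$ over all non-negative integrable functions $p$ on $[-T,T]$ with $\int f^2p>0$. If $\alpha<1$, then every asymptotically optimal design is absolutely continuous with a density of this form, for some $\mu,\tau$ that satisfy these two equations. -/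

import Mathlib

open MeasureTheory Filter Topology Asymptotics Set Bornology
open scoped ENNReal NNReal

namespace LongRangeDesign

noncomputable section

/-! ### The three families of correlation functions -/

/-- The (normalized, two-parameter) Mittag-Leffler function
`E_{ν,β}(z) = Γ(β) ∑_{k ≥ 0} z ^ k / Γ(ν k + β)`. -/
def mittagLefflerE (ν β z : ℝ) : ℝ :=
  Real.Gamma β * ∑' k : ℕ, z ^ k / Real.Gamma (ν * k + β)

/-- `L` is slowly varying at infinity (measurable and positive for large arguments). -/
def IsSlowlyVarying (L : ℝ → ℝ) : Prop :=
  Measurable L ∧ (∀ᶠ t in atTop, 0 < L t) ∧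
    ∀ r : ℝ, 0 < r → Tendsto (fun t => L (r * t) / L t) atTop (𝓝 1)

/-- The three families, with their parameters other than the exponent `α`. -/
inductive CorrFamily : Type
  | cauchy (β : ℝ)
  | mittagLeffler (ν β : ℝ)
  | svf (L : ℝ → ℝ)

/-- `ρ` is the member with exponent `α` of the given family.

In the Mittag-Leffler family the parameters satisfy `0 < ν ≤ 1`, `ν < β`. -/
def CorrFamily.Describes (F : CorrFamily) (α : ℝ) (ρ : ℝ → ℝ) : Prop :=
  match F with
  | .cauchy β => 0 < β ∧ ∀ t, ρ t = 1 / (1 + |t| ^ β) ^ (α / β)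
  | .mittagLeffler ν β =>
      0 < ν ∧ ν ≤ 1 ∧ ν < β ∧ ∀ t, ρ t = mittagLefflerE ν β (-|t| ^ α)
  | .svf L =>
      IsSlowlyVarying L ∧ (∀ᶠ t in cobounded ℝ, ρ t = L |t| / |t| ^ α) ∧
        ρ =O[cobounded ℝ] fun t => 1 / |t| ^ α

/-- The normalizing sequence `d_α(N)`. -/
def CorrFamily.normalizer (F : CorrFamily) (α : ℝ) (N : ℕ) : ℝ :=
  match F with
  | .cauchy _ => if α < 1 then (N : ℝ) ^ (1 - α) else Real.log N
  | .mittagLeffler _ _ => if α < 1 then (N : ℝ) ^ (1 - α) else Real.log N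
  | .svf L => if α < 1 then L N * (N : ℝ) ^ (1 - α) else L N * Real.log N

/-- The normalized sums `d(N)⁻¹ ∑_{j=1}^N ρ(j t)`. -/
def normalizedSum (ρ : ℝ → ℝ) (d : ℕ → ℝ) (t : ℝ) (N : ℕ) : ℝ :=
  (∑ j ∈ Finset.Icc 1 N, ρ (j * t)) / d N

/-- The function `Q(t) = lim_{N → ∞} d(N)⁻¹ ∑_{j=1}^N ρ(j t)`, used for `t > 0` only. -/
def limitQ (ρ : ℝ → ℝ) (d : ℕ → ℝ) (t : ℝ) : ℝ :=
  limUnder atTop (normalizedSum ρ d t)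

/-- The function `Q_α` of a correlation function `ρ` with exponent `α` in the family `F`. -/
def CorrFamily.Q (F : CorrFamily) (α : ℝ) (ρ : ℝ → ℝ) : ℝ → ℝ :=
  limitQ ρ (F.normalizer α)

/-- The constant `c` of the family. -/
def CorrFamily.const (F : CorrFamily) (α : ℝ) (ρ : ℝ → ℝ) : ℝ :=
  match F with
  | .cauchy _ => 1
  | .mittagLeffler ν β => Real.Gamma β / Real.Gamma (β - ν)
  | .svf L => if α < 1 then 1 else (CorrFamily.svf L).Q α ρ 1

/-! ### Designs and the asymptotic variance of the least-squares estimate -/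

/-- An (asymptotic) design: a probability measure on the interval `[-T, T]`. -/
def IsDesign (T : ℝ) (ξ : Measure ℝ) : Prop :=
  IsProbabilityMeasure ξ ∧ ξ (Icc (-T) T) = 1

/-- The function `a : (0, 1) → [-T, T]` that generates the design, i.e. the inverse of the
distribution function of `ξ`. -/
def quantile (ξ : Measure ℝ) (u : ℝ) : ℝ :=
  sInf {x : ℝ | u ≤ ξ.real (Iic x)}

/-- `Q` on `[0, ∞)` with values in `[0, ∞]`, where `Q(0) = ∞`. -/
def extendQ (Q : ℝ → ℝ) (s : ℝ) : ℝ≥0∞ :=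
  if 0 < s then ENNReal.ofReal (Q s) else ⊤

/-- `W(a) = ∫₀¹ f²(a(u)) du`. -/
def designW (f : ℝ → ℝ) (a : ℝ → ℝ) : ℝ≥0∞ :=
  ∫⁻ u in Ioo (0 : ℝ) 1, ENNReal.ofReal (f (a u) ^ 2)

/-- `R(a) = ∫₀¹ f²(a(u)) Q(a'(u)) du`. -/
def designR (f Q : ℝ → ℝ) (a : ℝ → ℝ) : ℝ≥0∞ :=
  ∫⁻ u in Ioo (0 : ℝ) 1, ENNReal.ofReal (f (a u) ^ 2) * extendQ Q (deriv a u)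

open Classical in
/-- The asymptotic variance (up to a constant factor) of the least-squares estimate of `θ` in the
model `y(t) = θ f(t) + ε(t)` under the design `ξ`: the number `W⁻¹(a) R(a) W⁻¹(a)` for the
generating function `a` of `ξ`. It is `∞` if `W(a) = 0`, when `θ` cannot be estimated. -/
def asympVariance (f Q : ℝ → ℝ) (ξ : Measure ℝ) : ℝ≥0∞ :=
  if designW f (quantile ξ) = 0 then ⊤
  else designR f Q (quantile ξ) / designW f (quantile ξ) ^ 2

/-- `ξ` is an asymptotically optimal design on `[-T, T]`. -/
def IsOptimalDesign (f Q : ℝ → ℝ) (T : ℝ) (ξ : Measure ℝ) : Prop :=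
  IsDesign T ξ ∧ ∀ η : Measure ℝ, IsDesign T η → asympVariance f Q ξ ≤ asympVariance f Q η

/-- A non-negative integrable function on `[-T, T]` for which `∫ f² p > 0`. -/
def IsAdmissible (f : ℝ → ℝ) (T : ℝ) (p : ℝ → ℝ) : Prop :=
  (∀ t ∈ Icc (-T) T, 0 ≤ p t) ∧ IntegrableOn p (Icc (-T) T) ∧
    0 < ∫ t in Icc (-T) T, f t ^ 2 * p t

/-- The criterion
`Ψ(p) = (∫ f² Q(∫p / p) p) (∫ p) / (∫ f² p)²` for (unnormalized) densities `p` on `[-T, T]`. The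
first integrand is zero where `p = 0`. -/
def densityCriterion (f Q : ℝ → ℝ) (T : ℝ) (p : ℝ → ℝ) : ℝ≥0∞ :=
  (∫⁻ t in Icc (-T) T,
      ENNReal.ofReal (f t ^ 2 * Q ((∫ s in Icc (-T) T, p s) / p t) * p t)) *
    ENNReal.ofReal (∫ s in Icc (-T) T, p s) /
    ENNReal.ofReal (∫ t in Icc (-T) T, f t ^ 2 * p t) ^ 2

/-! ### The explicit density -/

open Classical in
/-- On `[-T, T]`, the function `((1 - α) / (c (1 + α)) * (μ - τ / f²(t)))₊ ^ (1 / α)` for `α < 1`,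
and `((μ - τ / f²(t)) / (2 c))₊` for `α = 1`; it is `1 / H⁻(μ - τ / f²(t))`, where
`H(t) = Q(t) - t Q'(t)` has the inverse `H⁻`. The value is `0` where `f` vanishes. -/
def optDensity (f : ℝ → ℝ) (α c T μ τ : ℝ) : ℝ → ℝ :=
  (Icc (-T) T).indicator fun t =>
    if f t = 0 then 0
    else (max 0 ((if α < 1 then (1 - α) / (c * (1 + α)) else 1 / (2 * c)) *
      (μ - τ / f t ^ 2))) ^ (1 / α)

/-- The measure with density `p` with respect to Lebesgue measure. -/
def designOf (p : ℝ → ℝ) : Measure ℝ :=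
  volume.withDensity fun t => ENNReal.ofReal (p t)

/-- The points of `[-T, T]` at which `p` is positive. Outside, `Q(1/p) p` and `Q'(1/p)` are read
as `0`. -/
def posSet (T : ℝ) (p : ℝ → ℝ) : Set ℝ := {t ∈ Icc (-T) T | 0 < p t}

/-- The two equations for `μ` and `τ`:
`μ = 2 (∫ f² Q(1/p) p) / ∫ f² p` and `τ = ∫ f² Q(1/p) p + ∫ f² Q'(1/p)`. -/
def MultiplierEquations (f Q : ℝ → ℝ) (T : ℝ) (p : ℝ → ℝ) (μ τ : ℝ) : Prop :=
  IntegrableOn (fun t => f t ^ 2 * Q (1 / p t) * p t) (posSet T p) ∧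
  IntegrableOn (fun t => f t ^ 2 * deriv Q (1 / p t)) (posSet T p) ∧
  μ = 2 * (∫ t in posSet T p, f t ^ 2 * Q (1 / p t) * p t) / ∫ t in Icc (-T) T, f t ^ 2 * p t ∧
  τ = (∫ t in posSet T p, f t ^ 2 * Q (1 / p t) * p t) +
      ∫ t in posSet T p, f t ^ 2 * deriv Q (1 / p t)

end

end LongRangeDesign

/-! In every family the correlation function is regularly varying with exponent -α, so Q is a pure
power: Q(t) = K t^(-α) on t > 0 with K = c/(1-α), or K = c when α = 1. This is
`CorrFamily.exists_tendsto`. It rests on Potter's bounds and Karamata's theorem for slowly varying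
L, on a Laplace integral for the Mittag-Leffler function, and, for the SVF family at α = 1, on a
growth argument showing that the assumed limit is positive.

What remains is a variational problem that depends only on α, K and g = f². Let a be the quantile
function of a design, W = ∫ g(a) and r = ∫ g(a) a'^(-α); the variance is K r / W². Stationarity
under fixed mass suggests a density proportional to q_σ = (1 - σ/g)₊^(1/α) (`levelDensity`) with σ =
(1-α)W/2. Since σ depends on the unknown W, the problem is solved for fixed W and then over W.

For fixed W, the tangent inequality of the convex function x^(1+α) at q_σ(a(u)) is applied at x =
s/a'(u) and integrated over {a' > 0}. The monotone change of variables t = a(u) turns the last term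
into an integral of g q_σ^(1+α) over the image, at most A(σ) = ∫ g q_σ^(1+α) (`levelEnergy`). The
resulting bound, `IsDesign.lower_bound`, allows quantile functions with jumps and with singular
parts. Together with `div_sq_lower_bound` it says r/W² ≥ κ / (W^(1-α) A(σ)^α) with κ =
((1+α)/2)^(1+α).

Over W, the quantity W^(1-α) A(σ)^α is maximized. The function A has a supporting line of slope
-(1+α)/α ∫ q_σ, and stationarity becomes ∫ g q_σ = W ∫ q_σ: the normalized q_σ has exactly the mean
W that defines its level, and therefore attains the bound (`exists_optimal_level`,
`densityCriterion_levelDensity`). The criterion for densities is the variance of the normalized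
density, because a' = 1/p(a), so the same bound covers it.

If α < 1, then σ > 0 and equality forces a' > 0 almost everywhere and s/a' = q_σ(a), so an optimal
design has the density q_σ/s. For α = 1 the level σ is zero and this rigidity is lost. -/

namespace LongRangeDesign

/-! ### Slowly varying functions -/

/-- The uniform convergence theorem for slowly varying functions, in additive form. -/
theorem uniform_convergence_of_tendsto_sub (h : ℝ → ℝ) (hm : Measurable h)
    (hh : ∀ u, Tendsto (fun x => h (x + u) - h x) atTop (𝓝 0)) {ε : ℝ} (hε : 0 < ε) :
    ∀ᶠ x in atTop, ∀ u ∈ Icc (0 : ℝ) 1, |h (x + u) - h x| ≤ ε := by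
  -- The values at x and x + u are compared through a third point x + w, averaged over w in [1, 2].
  -- Then w and w - u both lie in [0, 3], so two such integrals control the increment; the
  -- truncation at 1 makes dominated convergence available.
  set D : ℝ → ℝ := fun x => ∫ u in Icc (0 : ℝ) 3, min 1 |h (x + u) - h x| with hD
  have hmeas : ∀ x y : ℝ, Measurable fun u => min 1 |h (x + u) - h y| := fun x y => by fun_prop
  have hbd : ∀ x y u : ℝ, ‖min 1 |h (x + u) - h y|‖ ≤ 1 := fun x y u => by
    rw [Real.norm_of_nonneg (by positivity)]; exact min_le_left _ _
  have hint : ∀ (x y a b : ℝ), IntegrableOn (fun u => min 1 |h (x + u) - h y|) (Icc a b) :=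
    fun x y a b => Integrable.of_bound (hmeas x y).aestronglyMeasurable 1
      (Eventually.of_forall (hbd x y))
  have hD0 : Tendsto D atTop (𝓝 0) := by
    have : Tendsto D atTop (𝓝 (∫ u in Icc (0 : ℝ) 3, (0 : ℝ))) := by
      refine tendsto_integral_filter_of_dominated_convergence (fun _ => 1)
        (Eventually.of_forall fun x => (hmeas x x).aestronglyMeasurable)
        (Eventually.of_forall fun x => Eventually.of_forall (hbd x x)) (by simp)
        (Eventually.of_forall fun u => ?_)
      have := (tendsto_const_nhds (x := (1 : ℝ))).min (hh u).abs
      simpa using this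
    simpa using this
  -- The cap 1/2 excludes the truncation: min 1 y < η then means y < η.
  set η := min ε (1 / 2) with hη
  have hη0 : 0 < η := by positivity
  have hev := (hD0.eventually (gt_mem_nhds (half_pos hη0)))
  obtain ⟨X, hX⟩ := eventually_atTop.1 hev
  filter_upwards [eventually_ge_atTop X] with x hx u hu
  have h1 := hX x hx
  have h2 := hX (x + u) (by linarith [hu.1])
  have key : min 1 |h (x + u) - h x| ≤ D x + D (x + u) := by
    have e1 : ∫ w in Icc (1 : ℝ) 2, min 1 |h (x + u) - h x| = min 1 |h (x + u) - h x| := by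
      simp; norm_num
    have e2 : ∫ w in Icc (1 : ℝ) 2, min 1 |h (x + w) - h x| ≤ D x :=
      setIntegral_mono_set (hint x x 0 3) (Eventually.of_forall fun _ => by positivity)
        (Eventually.of_forall (Icc_subset_Icc (by norm_num) (by norm_num)))
    have e3 : ∫ w in Icc (1 : ℝ) 2, min 1 |h (x + w) - h (x + u)| ≤ D (x + u) := by
      have : ∫ w in Icc (1 : ℝ) 2, min 1 |h (x + w) - h (x + u)|
          = ∫ w in Icc (1 - u) (2 - u), min 1 |h (x + u + w) - h (x + u)| := by
        have hmp := (measurePreserving_add_left volume u).setIntegral_preimage_emb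
          (MeasurableEquiv.addLeft u).measurableEmbedding
          (fun w => min 1 |h (x + w) - h (x + u)|) (Icc 1 2)
        rw [← hmp]
        simp [add_assoc]
      rw [this]
      exact setIntegral_mono_set (hint _ _ 0 3) (Eventually.of_forall fun _ => by positivity)
        (Eventually.of_forall (Icc_subset_Icc (by linarith [hu.2]) (by linarith [hu.1])))
    calc min 1 |h (x + u) - h x| = ∫ w in Icc (1 : ℝ) 2, min 1 |h (x + u) - h x| := e1.symm
      _ ≤ ∫ w in Icc (1 : ℝ) 2, (min 1 |h (x + w) - h x| + min 1 |h (x + w) - h (x + u)|) := by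
          refine setIntegral_mono_on (by simp) ((hint _ _ _ _).add (hint _ _ _ _))
            measurableSet_Icc fun w _ => ?_
          have := abs_sub_abs_le_abs_sub (h (x + w) - h x) (h (x + w) - h (x + u))
          have h3 : |h (x + u) - h x| ≤ |h (x + w) - h x| + |h (x + w) - h (x + u)| := by
            have := abs_sub (h (x + w) - h x) (h (x + w) - h (x + u))
            simpa using this
          rcases le_total 1 |h (x + w) - h x| with ha | ha <;>
          rcases le_total 1 |h (x + w) - h (x + u)| with hb | hb <;>
          simp only [min_eq_left ha, min_eq_left hb, min_eq_right ha, min_eq_right hb]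
          · linarith [min_le_left 1 |h (x + u) - h x|]
          · linarith [min_le_left 1 |h (x + u) - h x|, abs_nonneg (h (x + w) - h (x + u))]
          · linarith [min_le_left 1 |h (x + u) - h x|, abs_nonneg (h (x + w) - h x)]
          · exact (min_le_right _ _).trans h3
      _ = _ := integral_add (hint _ _ _ _) (hint _ _ _ _)
      _ ≤ _ := add_le_add e2 e3
  have h4 : min 1 |h (x + u) - h x| < η := by linarith
  rcases min_lt_iff.1 h4 with h5 | h5
  · linarith [min_le_right ε (1 / 2)]
  · exact h5.le.trans (min_le_left _ _)

/-- The increments of `log L(e^x)` grow at most linearly, with arbitrarily small slope. -/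
theorem abs_sub_le_of_uniform (h : ℝ → ℝ) (hm : Measurable h)
    (hh : ∀ u, Tendsto (fun x => h (x + u) - h x) atTop (𝓝 0)) {δ : ℝ} (hδ : 0 < δ) :
    ∃ X : ℝ, ∀ x, X ≤ x → ∀ u, 0 ≤ u → |h (x + u) - h x| ≤ δ * (u + 1) := by
  obtain ⟨X, hX⟩ := eventually_atTop.1 (uniform_convergence_of_tendsto_sub h hm hh hδ)
  refine ⟨X, fun x hx => ?_⟩
  have key : ∀ n : ℕ, |h (x + n) - h x| ≤ δ * n := by
    intro n
    induction n with
    | zero => simp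
    | succ n ih =>
      have := hX (x + n) (by linarith [Nat.cast_nonneg (α := ℝ) n]) 1 (by simp)
      have h3 := abs_add_le (h (x + n + 1) - h (x + n)) (h (x + n) - h x)
      push_cast
      rw [← add_assoc]
      rw [sub_add_sub_cancel] at h3
      linarith
  intro u hu
  have h1 := key ⌊u⌋₊
  have hfl := Nat.floor_le hu
  have h2 := hX (x + ⌊u⌋₊) (by linarith [Nat.cast_nonneg (α := ℝ) ⌊u⌋₊]) (u - ⌊u⌋₊)
    ⟨by linarith, by linarith [Nat.lt_floor_add_one u]⟩
  have h3 := abs_add_le (h (x + u) - h (x + ⌊u⌋₊)) (h (x + ⌊u⌋₊) - h x)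
  rw [sub_add_sub_cancel] at h3
  rw [show x + ⌊u⌋₊ + (u - ⌊u⌋₊) = x + u by ring] at h2
  nlinarith

/-- Potter's bounds. -/
theorem IsSlowlyVarying.potter {L : ℝ → ℝ} (hL : IsSlowlyVarying L) {δ : ℝ} (hδ : 0 < δ) :
    ∃ X : ℝ, 1 ≤ X ∧ ∀ x y, X ≤ x → x ≤ y → 0 < L x ∧ 0 < L y ∧
      L x ≤ Real.exp δ * (y / x) ^ δ * L y ∧ L y ≤ Real.exp δ * (y / x) ^ δ * L x := by
  obtain ⟨hLm, hLp, hLr⟩ := hL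
  -- In logarithmic variables slow variation is additive. Exponentiating the bound δ (log (y/x) + 1)
  -- gives the factor exp δ (y/x)^δ.
  obtain ⟨X, hX⟩ := abs_sub_le_of_uniform (fun x => Real.log (L (Real.exp x))) (by fun_prop)
    (fun u => by
      have h1 := ((hLr (Real.exp u) (Real.exp_pos u)).comp Real.tendsto_exp_atTop).log one_ne_zero
      rw [Real.log_one] at h1
      refine h1.congr' ?_
      filter_upwards [Real.tendsto_exp_atTop.eventually hLp,
        (Real.tendsto_exp_atTop.comp (tendsto_atTop_add_const_right _ u tendsto_id)).eventually hLp]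
        with x h2 h3
      simp only [Function.comp, id] at h2 h3 ⊢
      rw [← Real.exp_add, add_comm u x, Real.log_div h3.ne' h2.ne']) hδ
  obtain ⟨Y, hY⟩ := eventually_atTop.1 hLp
  refine ⟨max 1 (max Y (Real.exp X)), le_max_left _ _, fun x y hx hxy => ?_⟩
  have hx1 : 1 ≤ x := (le_max_left _ _).trans hx
  have hxY : Y ≤ x := (le_max_left _ _).trans ((le_max_right _ _).trans hx)
  have hxX : Real.exp X ≤ x := (le_max_right _ _).trans ((le_max_right _ _).trans hx)
  have hx0 : 0 < x := by linarith
  have hy0 : 0 < y := by linarith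
  have hLx := hY x hxY
  have hLy := hY y (hxY.trans hxy)
  have hlog : Real.log x ≤ Real.log y := Real.log_le_log hx0 hxy
  have key := hX (Real.log x) ((Real.le_log_iff_exp_le hx0).2 hxX) (Real.log y - Real.log x)
    (by linarith)
  simp only [add_sub_cancel, Real.exp_log hx0, Real.exp_log hy0] at key
  have e : Real.exp δ * (y / x) ^ δ = Real.exp (δ * (Real.log y - Real.log x + 1)) := by
    rw [Real.rpow_def_of_pos (div_pos hy0 hx0), ← Real.exp_add, Real.log_div hy0.ne' hx0.ne']
    ring_nf
  rw [abs_le] at key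
  refine ⟨hLx, hLy, ?_, ?_⟩
  · rw [e, ← Real.log_le_log_iff hLx (by positivity), Real.log_mul (Real.exp_ne_zero _) hLy.ne',
      Real.log_exp]
    linarith
  · rw [e, ← Real.log_le_log_iff hLy (by positivity), Real.log_mul (Real.exp_ne_zero _) hLx.ne',
      Real.log_exp]
    linarith

/-! ### Sums -/

/-- A Stolz–Cesàro argument: r - q b = o(b), and since the sums of b diverge, the partial sums
inherit the little-o. It reduces every later limit to one reference sequence b. -/
theorem tendsto_sum_div_of_ratio {b r d : ℕ → ℝ} {κ q : ℝ} (hb : ∀ j, 0 ≤ b j)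
    (hb' : ∀ᶠ j in atTop, b j ≠ 0)
    (hsum : Tendsto (fun N => ∑ j ∈ Finset.Icc 1 N, b j) atTop atTop)
    (hd : Tendsto (fun N => (∑ j ∈ Finset.Icc 1 N, b j) / d N) atTop (𝓝 κ))
    (hr : Tendsto (fun j => r j / b j) atTop (𝓝 q)) :
    Tendsto (fun N => (∑ j ∈ Finset.Icc 1 N, r j) / d N) atTop (𝓝 (q * κ)) := by
  have hshift : ∀ (v : ℕ → ℝ) (N : ℕ), ∑ j ∈ Finset.range N, v (j + 1)
      = ∑ j ∈ Finset.Icc 1 N, v j := fun v N => by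
    rw [Finset.range_eq_Ico, Finset.sum_Ico_add' v 0 N 1]; congr 1
  have hlo : (fun j => r (j + 1) - q * b (j + 1)) =o[atTop] fun j => b (j + 1) := by
    have h0 : (fun j => r j - q * b j) =o[atTop] b := by
      rw [isLittleO_iff_tendsto' (hb'.mono fun j hj h => absurd h hj)]
      have := hr.sub_const q
      rw [sub_self] at this
      refine this.congr' (hb'.mono fun j hj => ?_)
      field_simp
    exact h0.comp_tendsto (tendsto_add_atTop_nat 1)
  have hs := hlo.sum_range (fun j => hb (j + 1)) (by simpa only [hshift b] using hsum)
  simp only [hshift b, hshift (fun j => r j - q * b j)] at hs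
  have h1 : Tendsto (fun N => (∑ j ∈ Finset.Icc 1 N, (r j - q * b j)) /
      ∑ j ∈ Finset.Icc 1 N, b j) atTop (𝓝 0) := hs.tendsto_div_nhds_zero
  have h2 := (h1.add_const q).mul hd
  rw [zero_add] at h2
  refine h2.congr' ?_
  filter_upwards [hsum.eventually_gt_atTop 0] with N hN
  rw [Finset.sum_sub_distrib, ← Finset.mul_sum]
  field_simp
  ring

theorem tendsto_sum_rpow_div {γ : ℝ} (h0 : 0 < γ) (h1 : γ < 1) :
    Tendsto (fun N : ℕ => (∑ j ∈ Finset.Icc 1 N, (j : ℝ) ^ (-γ)) / (N : ℝ) ^ (1 - γ))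
      atTop (𝓝 (1 / (1 - γ))) := by
  have hγ : 0 < 1 - γ := by linarith
  have hb : ∀ N : ℕ, 1 ≤ N → ((N : ℝ) ^ (1 - γ) - 1) / (1 - γ) ≤ ∑ j ∈ Finset.Icc 1 N, (j : ℝ) ^ (-γ)
      ∧ ∑ j ∈ Finset.Icc 1 N, (j : ℝ) ^ (-γ) ≤ 1 + ((N : ℝ) ^ (1 - γ) - 1) / (1 - γ) := by
    intro N hN
    have hanti : AntitoneOn (fun x : ℝ => x ^ (-γ)) (Icc ((1 : ℕ) : ℝ) N) := fun x hx y hy hxy =>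
      Real.rpow_le_rpow_of_nonpos (lt_of_lt_of_le (by norm_num) hx.1) hxy (by linarith)
    have hint : ∫ x in ((1 : ℕ) : ℝ)..N, x ^ (-γ) = ((N : ℝ) ^ (1 - γ) - 1) / (1 - γ) := by
      rw [integral_rpow (Or.inl (by linarith))]
      simp [add_comm, sub_eq_add_neg]
    have u1 := hanti.integral_le_sum_Ico hN
    have u2 := hanti.sum_le_integral_Ico hN
    rw [hint] at u1 u2
    have e1 : Finset.Icc 1 N = insert N (Finset.Ico 1 N) := by
      ext; simp; omega
    have e2 : ∑ j ∈ Finset.Icc 1 N, (j : ℝ) ^ (-γ)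
        = 1 + ∑ i ∈ Finset.Ico 1 N, ((i + 1 : ℕ) : ℝ) ^ (-γ) := by
      rw [Finset.sum_Ico_add' (fun j : ℕ => (j : ℝ) ^ (-γ)) 1 N 1]
      have : Finset.Icc 1 N = insert 1 (Finset.Ico (1 + 1) (N + 1)) := by
        ext; simp; omega
      rw [this, Finset.sum_insert (by simp)]; simp
    constructor
    · rw [e1, Finset.sum_insert (by simp)]
      linarith [Real.rpow_nonneg (Nat.cast_nonneg (α := ℝ) N) (-γ)]
    · rw [e2]; linarith
  have hinf : Tendsto (fun N : ℕ => (N : ℝ) ^ (1 - γ)) atTop atTop :=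
    (tendsto_rpow_atTop hγ).comp tendsto_natCast_atTop_atTop
  have hz : Tendsto (fun N : ℕ => ((N : ℝ) ^ (1 - γ))⁻¹) atTop (𝓝 0) :=
    hinf.inv_tendsto_atTop
  refine tendsto_of_tendsto_of_tendsto_of_le_of_le'
    (g := fun N : ℕ => (1 - ((N : ℝ) ^ (1 - γ))⁻¹) / (1 - γ))
    (h := fun N : ℕ => ((N : ℝ) ^ (1 - γ))⁻¹ + (1 - ((N : ℝ) ^ (1 - γ))⁻¹) / (1 - γ)) ?_ ?_ ?_ ?_
  · simpa using (hz.const_sub 1).div_const (1 - γ)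
  · simpa using hz.add ((hz.const_sub 1).div_const (1 - γ))
  · filter_upwards [hinf.eventually_gt_atTop 0, eventually_ge_atTop 1] with N hN h1
    rw [le_div_iff₀ hN]
    refine le_trans (le_of_eq ?_) (hb N h1).1
    field_simp
  · filter_upwards [hinf.eventually_gt_atTop 0, eventually_ge_atTop 1] with N hN h1
    rw [div_le_iff₀ hN]
    refine (hb N h1).2.trans (le_of_eq ?_)
    field_simp

theorem tendsto_sum_inv_div_log :
    Tendsto (fun N : ℕ => (∑ j ∈ Finset.Icc 1 N, (j : ℝ) ^ (-(1 : ℝ))) / Real.log N)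
      atTop (𝓝 1) := by
  have hinf : Tendsto (fun N : ℕ => Real.log N) atTop atTop :=
    Real.tendsto_log_atTop.comp tendsto_natCast_atTop_atTop
  have hz : Tendsto (fun N : ℕ => (Real.log N)⁻¹) atTop (𝓝 0) := hinf.inv_tendsto_atTop
  have e : ∀ N : ℕ, ∑ j ∈ Finset.Icc 1 N, (j : ℝ) ^ (-(1 : ℝ)) = harmonic N := fun N => by
    rw [harmonic_eq_sum_Icc]; push_cast
    exact Finset.sum_congr rfl fun j _ => Real.rpow_neg_one _
  simp only [e]
  refine tendsto_of_tendsto_of_tendsto_of_le_of_le' (g := fun N : ℕ => 1)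
    (h := fun N : ℕ => (Real.log N)⁻¹ + 1) tendsto_const_nhds (by simpa using hz.add_const 1) ?_ ?_
  · filter_upwards [hinf.eventually_gt_atTop 0, eventually_ge_atTop 1] with N hN h1
    rw [le_div_iff₀ hN, one_mul]
    refine le_trans ?_ (log_add_one_le_harmonic N)
    exact Real.log_le_log (by exact_mod_cast h1) (by push_cast; linarith)
  · filter_upwards [hinf.eventually_gt_atTop 0, eventually_ge_atTop 1] with N hN h1
    rw [div_le_iff₀ hN]
    refine (harmonic_le_one_add_log N).trans (le_of_eq ?_)
    field_simp


/-! ### Sums of regularly varying sequences -/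

/-- Potter's bound with exponent γ/2 gives L(N) ≥ const · N^(-γ/2), which costs only half of the
power. -/
theorem IsSlowlyVarying.tendsto_mul_rpow_atTop {L : ℝ → ℝ} (hL : IsSlowlyVarying L) {γ : ℝ}
    (hγ : 0 < γ) : Tendsto (fun N : ℕ => L N * (N : ℝ) ^ γ) atTop atTop := by
  obtain ⟨X, hX1, hX⟩ := hL.potter (half_pos hγ)
  have hX0 : 0 < X := by linarith
  have hinf : Tendsto (fun N : ℕ => (L X * X ^ (γ / 2) / Real.exp (γ / 2)) * (N : ℝ) ^ (γ / 2))
      atTop atTop :=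
    ((tendsto_rpow_atTop (half_pos hγ)).comp tendsto_natCast_atTop_atTop).const_mul_atTop
      (div_pos (mul_pos (hX X X le_rfl le_rfl).1 (by positivity)) (by positivity))
  refine tendsto_atTop_mono' _ ?_ hinf
  filter_upwards [tendsto_natCast_atTop_atTop.eventually_ge_atTop X] with N hN
  have hN0 : (0 : ℝ) < N := by linarith
  have h := (hX X N le_rfl hN).2.2.1
  rw [Real.div_rpow hN0.le hX0.le] at h
  have e : (N : ℝ) ^ γ = (N : ℝ) ^ (γ / 2) * (N : ℝ) ^ (γ / 2) := by
    rw [← Real.rpow_add hN0]; ring_nf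
  rw [e, ← mul_assoc]
  refine mul_le_mul_of_nonneg_right ?_ (by positivity)
  rw [div_le_iff₀ (by positivity)]
  calc L X * X ^ (γ / 2) ≤ (Real.exp (γ / 2) * ((N : ℝ) ^ (γ / 2) / X ^ (γ / 2)) * L N) * X ^ (γ / 2) :=
        mul_le_mul_of_nonneg_right h (by positivity)
    _ = _ := by field_simp

/-- Karamata's theorem for sums. -/
theorem IsSlowlyVarying.tendsto_sum_div {L : ℝ → ℝ} (hL : IsSlowlyVarying L) {α : ℝ}
    (h0 : 0 < α) (h1 : α < 1) :
    Tendsto (fun N : ℕ => (∑ j ∈ Finset.Icc 1 N, |L j| * (j : ℝ) ^ (-α)) /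
      (L N * (N : ℝ) ^ (1 - α))) atTop (𝓝 (1 / (1 - α))) := by
  have hα : 0 < 1 - α := by linarith
  have hd := hL.tendsto_mul_rpow_atTop hα
  -- Potter's bounds replace L(j) by L(N) at the price of exp δ (N/j)^δ. What is left are sums of
  -- pure powers with exponents α + δ (above) and α - δ (below); their limits approach 1/(1-α) as δ
  -- → 0. So δ is fixed first, then N → ∞.
  have hexp : Tendsto (fun δ : ℝ => Real.exp δ / (1 - (α + δ))) (𝓝[>] 0) (𝓝 (1 / (1 - α))) := by
    have : ContinuousAt (fun δ : ℝ => Real.exp δ / (1 - (α + δ))) 0 := by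
      refine ContinuousAt.div (by fun_prop) (by fun_prop) (by simpa using hα.ne')
    simpa [ContinuousAt] using this.tendsto.mono_left nhdsWithin_le_nhds
  have hexp' : Tendsto (fun δ : ℝ => (Real.exp δ)⁻¹ * (1 / (1 - (α - δ)))) (𝓝[>] 0)
      (𝓝 (1 / (1 - α))) := by
    have : ContinuousAt (fun δ : ℝ => (Real.exp δ)⁻¹ * (1 / (1 - (α - δ)))) 0 := by
      refine ContinuousAt.mul (by fun_prop (disch := exact Real.exp_ne_zero _))
        (ContinuousAt.div (by fun_prop) (by fun_prop) (by simpa using hα.ne'))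
    simpa [ContinuousAt] using this.tendsto.mono_left nhdsWithin_le_nhds
  have hsmall : ∀ᶠ δ : ℝ in 𝓝[>] 0, 0 < δ ∧ α + δ < 1 ∧ 0 < α - δ := by
    have e1 : ∀ᶠ δ : ℝ in 𝓝[>] 0, δ < 1 - α := nhdsWithin_le_nhds (gt_mem_nhds hα)
    have e2 : ∀ᶠ δ : ℝ in 𝓝[>] 0, δ < α := nhdsWithin_le_nhds (gt_mem_nhds h0)
    filter_upwards [e1, e2, self_mem_nhdsWithin] with δ a b c
    exact ⟨c, by linarith, by linarith⟩
  -- The terms before Potter's threshold, where nothing is known about L, form a fixed sum that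
  -- vanishes after normalization.
  have hsplit : ∀ (v : ℕ → ℝ) (M N : ℕ), 1 ≤ M → M ≤ N → ∑ j ∈ Finset.Icc 1 N, v j
      = ∑ j ∈ Finset.Ico 1 M, v j + ∑ j ∈ Finset.Icc M N, v j := fun v M N hM hMN => by
    have := Finset.sum_Ico_consecutive v hM (hMN.trans (Nat.le_succ N))
    have e : ∀ m, Finset.Ico m (N + 1) = Finset.Icc m N := fun m => by ext; simp
    rw [← e, ← e]; exact this.symm
  refine tendsto_order.2 ⟨fun b hb => ?_, fun b hb => ?_⟩
  · obtain ⟨δ, ⟨hδ, h2, h3⟩, hδb⟩ := (hsmall.and (hexp'.eventually (lt_mem_nhds hb))).exists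
    obtain ⟨X, hX1, hX⟩ := hL.potter hδ
    set M := ⌈X⌉₊ with hM
    have hXM : X ≤ M := Nat.le_ceil X
    have hM1 : 1 ≤ M := by exact_mod_cast hX1.trans hXM
    set C := ∑ j ∈ Finset.Ico 1 M, (j : ℝ) ^ (-(α - δ)) with hC
    have hlim : Tendsto (fun N : ℕ => (Real.exp δ)⁻¹ *
        ((∑ j ∈ Finset.Icc 1 N, (j : ℝ) ^ (-(α - δ))) / (N : ℝ) ^ (1 - (α - δ))
          - C / (N : ℝ) ^ (1 - (α - δ)))) atTop (𝓝 ((Real.exp δ)⁻¹ * (1 / (1 - (α - δ))))) := by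
      have hC0 : Tendsto (fun N : ℕ => C / (N : ℝ) ^ (1 - (α - δ))) atTop (𝓝 0) :=
        ((tendsto_rpow_atTop (by linarith)).comp tendsto_natCast_atTop_atTop).const_div_atTop C
      simpa using ((tendsto_sum_rpow_div h3 (by linarith)).sub hC0).const_mul (Real.exp δ)⁻¹
    filter_upwards [hlim.eventually (lt_mem_nhds hδb), eventually_ge_atTop M,
      hd.eventually_gt_atTop 0] with N hN hMN hdN
    refine hN.trans_le ?_
    have hN0 : (0 : ℝ) < N := by exact_mod_cast (by omega : 0 < N)
    rw [hsplit (fun j => (j : ℝ) ^ (-(α - δ))) M N hM1 hMN,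
      hsplit (fun j => |L j| * (j : ℝ) ^ (-α)) M N hM1 hMN, ← hC, ← sub_div,
      add_sub_cancel_left, le_div_iff₀ hdN]
    refine le_trans ?_ (le_add_of_nonneg_left (Finset.sum_nonneg fun _ _ => by positivity))
    rw [mul_div_assoc', div_mul_eq_mul_div, div_le_iff₀ (by positivity), Finset.mul_sum,
      Finset.sum_mul, Finset.sum_mul]
    refine Finset.sum_le_sum fun j hj => ?_
    obtain ⟨hj1, hj2⟩ := Finset.mem_Icc.1 hj
    have hj0 : (0 : ℝ) < j := by exact_mod_cast (by omega : 0 < j)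
    obtain ⟨p1, p2, p3, p4⟩ := hX j N (hXM.trans (by exact_mod_cast hj1)) (by exact_mod_cast hj2)
    rw [abs_of_pos p1]
    have e1 : (j : ℝ) ^ (-(α - δ)) = (j : ℝ) ^ (-α) * (j : ℝ) ^ δ := by
      rw [← Real.rpow_add hj0]; ring_nf
    have e2 : (N : ℝ) ^ (1 - (α - δ)) = (N : ℝ) ^ (1 - α) * (N : ℝ) ^ δ := by
      rw [← Real.rpow_add hN0]; ring_nf
    rw [Real.div_rpow hN0.le hj0.le] at p4
    rw [e1, e2]
    calc (Real.exp δ)⁻¹ * ((j : ℝ) ^ (-α) * (j : ℝ) ^ δ) * (L N * (N : ℝ) ^ (1 - α))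
        = L N * ((Real.exp δ)⁻¹ * ((j : ℝ) ^ (-α) * (j : ℝ) ^ δ) * (N : ℝ) ^ (1 - α)) := by ring
      _ ≤ (Real.exp δ * ((N : ℝ) ^ δ / (j : ℝ) ^ δ) * L j) *
          ((Real.exp δ)⁻¹ * ((j : ℝ) ^ (-α) * (j : ℝ) ^ δ) * (N : ℝ) ^ (1 - α)) :=
          mul_le_mul_of_nonneg_right p4 (by positivity)
      _ = _ := by
        have := Real.exp_pos δ
        field_simp
  · obtain ⟨δ, ⟨hδ, h2, h3⟩, hδb⟩ := (hsmall.and (hexp.eventually (gt_mem_nhds hb))).exists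
    obtain ⟨X, hX1, hX⟩ := hL.potter hδ
    set M := ⌈X⌉₊ with hM
    have hXM : X ≤ M := Nat.le_ceil X
    have hM1 : 1 ≤ M := by exact_mod_cast hX1.trans hXM
    set C := ∑ j ∈ Finset.Ico 1 M, |L j| * (j : ℝ) ^ (-α) with hC
    have hlim : Tendsto (fun N : ℕ => C / (L N * (N : ℝ) ^ (1 - α)) + Real.exp δ *
        ((∑ j ∈ Finset.Icc 1 N, (j : ℝ) ^ (-(α + δ))) / (N : ℝ) ^ (1 - (α + δ))))
          atTop (𝓝 (Real.exp δ / (1 - (α + δ)))) := by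
      have hC0 := hd.const_div_atTop C
      simpa [div_eq_mul_inv] using hC0.add
        ((tendsto_sum_rpow_div (by linarith) h2).const_mul (Real.exp δ))
    filter_upwards [hlim.eventually (gt_mem_nhds hδb), eventually_ge_atTop M,
      hd.eventually_gt_atTop 0] with N hN hMN hdN
    refine lt_of_le_of_lt ?_ hN
    have hN0 : (0 : ℝ) < N := by exact_mod_cast (by omega : 0 < N)
    rw [hsplit _ M N hM1 hMN, ← hC, add_div]
    gcongr
    rw [div_le_iff₀ hdN, mul_div_assoc', div_mul_eq_mul_div, le_div_iff₀ (by positivity),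
      Finset.mul_sum, Finset.sum_mul, Finset.sum_mul]
    refine le_trans (Finset.sum_le_sum fun j hj => ?_)
      (Finset.sum_le_sum_of_subset_of_nonneg (Finset.Icc_subset_Icc_left hM1) fun j _ _ =>
        by positivity)
    obtain ⟨hj1, hj2⟩ := Finset.mem_Icc.1 hj
    have hj0 : (0 : ℝ) < j := by exact_mod_cast (by omega : 0 < j)
    obtain ⟨p1, p2, p3, p4⟩ := hX j N (hXM.trans (by exact_mod_cast hj1)) (by exact_mod_cast hj2)
    rw [abs_of_pos p1]
    have e1 : (j : ℝ) ^ (-α) = (j : ℝ) ^ (-(α + δ)) * (j : ℝ) ^ δ := by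
      rw [← Real.rpow_add hj0]; ring_nf
    have e2 : (N : ℝ) ^ (1 - α) = (N : ℝ) ^ (1 - (α + δ)) * (N : ℝ) ^ δ := by
      rw [← Real.rpow_add hN0]; ring_nf
    rw [Real.div_rpow hN0.le hj0.le] at p3
    rw [e1, e2]
    calc L j * ((j : ℝ) ^ (-(α + δ)) * (j : ℝ) ^ δ) * (N : ℝ) ^ (1 - (α + δ))
        = L j * ((j : ℝ) ^ (-(α + δ)) * (j : ℝ) ^ δ * (N : ℝ) ^ (1 - (α + δ))) := by ring
      _ ≤ (Real.exp δ * ((N : ℝ) ^ δ / (j : ℝ) ^ δ) * L N) *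
          ((j : ℝ) ^ (-(α + δ)) * (j : ℝ) ^ δ * (N : ℝ) ^ (1 - (α + δ))) :=
          mul_le_mul_of_nonneg_right p3 (by positivity)
      _ = _ := by field_simp

/-- If `ρ` is asymptotic to a multiple of `t ↦ t ^ (-α)`, `α < 1`, the normalized sums converge. -/
theorem tendsto_normalizedSum_of_rpow {ρ : ℝ → ℝ} {α c : ℝ} (h0 : 0 < α) (h1 : α ≤ 1)
    (hρ : Tendsto (fun x => x ^ α * ρ x) atTop (𝓝 c)) {t : ℝ} (ht : 0 < t) :
    Tendsto (normalizedSum ρ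
        (fun N : ℕ => if α < 1 then (N : ℝ) ^ (1 - α) else Real.log N) t) atTop
      (𝓝 ((if α < 1 then c / (1 - α) else c) * t ^ (-α))) := by
  have hr : Tendsto (fun j : ℕ => ρ (j * t) / (j : ℝ) ^ (-α)) atTop (𝓝 (c * t ^ (-α))) := by
    have h := (hρ.comp (tendsto_natCast_atTop_atTop.atTop_mul_const ht)).mul_const (t ^ (-α))
    refine h.congr' ?_
    filter_upwards [eventually_gt_atTop 0] with j hj
    have hj0 : (0 : ℝ) < j := by exact_mod_cast hj
    simp only [Function.comp]
    rw [Real.mul_rpow hj0.le ht.le, Real.rpow_neg ht.le, Real.rpow_neg hj0.le]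
    field_simp
  have hne : ∀ᶠ j : ℕ in atTop, (j : ℝ) ^ (-α) ≠ 0 := by
    filter_upwards [eventually_gt_atTop 0] with j hj
    have hj0 : (0 : ℝ) < j := by exact_mod_cast hj
    positivity
  by_cases hα : α < 1
  · simp only [hα, if_true]
    have hs := tendsto_sum_rpow_div h0 hα
    have hinf : Tendsto (fun N : ℕ => (N : ℝ) ^ (1 - α)) atTop atTop :=
      (tendsto_rpow_atTop (by linarith)).comp tendsto_natCast_atTop_atTop
    have hsum : Tendsto (fun N : ℕ => ∑ j ∈ Finset.Icc 1 N, (j : ℝ) ^ (-α)) atTop atTop := by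
      refine (hs.pos_mul_atTop (one_div_pos.2 (by linarith)) hinf).congr' ?_
      filter_upwards [hinf.eventually_gt_atTop 0] with N hN
      field_simp
    have := tendsto_sum_div_of_ratio (fun j => by positivity) hne hsum hs hr
    rwa [show c * t ^ (-α) * (1 / (1 - α)) = c / (1 - α) * t ^ (-α) by ring] at this
  · have hα1 : α = 1 := le_antisymm h1 (not_lt.1 hα)
    simp only [hα, if_false]
    subst hα1
    have hs := tendsto_sum_inv_div_log
    have hinf : Tendsto (fun N : ℕ => Real.log N) atTop atTop :=
      Real.tendsto_log_atTop.comp tendsto_natCast_atTop_atTop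
    have hsum : Tendsto (fun N : ℕ => ∑ j ∈ Finset.Icc 1 N, (j : ℝ) ^ (-(1 : ℝ))) atTop atTop := by
      refine (hs.pos_mul_atTop one_pos hinf).congr' ?_
      filter_upwards [hinf.eventually_gt_atTop 0] with N hN
      field_simp
    have := tendsto_sum_div_of_ratio (fun j => by positivity) hne hsum hs hr
    rwa [mul_one] at this

theorem tendsto_cauchy {α β : ℝ} (hβ : 0 < β) :
    Tendsto (fun x : ℝ => x ^ α * (1 / (1 + |x| ^ β) ^ (α / β))) atTop (𝓝 1) := by
  have h1 : Tendsto (fun x : ℝ => (x ^ β)⁻¹) atTop (𝓝 0) :=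
    (tendsto_rpow_atTop hβ).inv_tendsto_atTop
  have h2 : Tendsto (fun x : ℝ => (1 / ((x ^ β)⁻¹ + 1)) ^ (α / β)) atTop (𝓝 1) := by
    have := ((tendsto_const_nhds (x := (1 : ℝ))).div (h1.add_const 1) (by norm_num)).rpow_const (p := α / β) (by norm_num)
    simpa using this
  refine h2.congr' ?_
  filter_upwards [eventually_gt_atTop 0] with x hx
  rw [abs_of_pos hx]
  have e : x ^ α = (x ^ β) ^ (α / β) := by
    rw [← Real.rpow_mul hx.le]; congr 1; field_simp
  have hxb : 0 < x ^ β := by positivity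
  rw [e, mul_one_div, ← Real.div_rpow hxb.le (by positivity)]
  congr 1
  field_simp

theorem tendsto_normalizedSum_svf {L ρ : ℝ → ℝ} {α : ℝ} (hL : IsSlowlyVarying L)
    (h0 : 0 < α) (h1 : α < 1) (hρ : ∀ᶠ x in atTop, ρ x = L x / x ^ α) {t : ℝ} (ht : 0 < t) :
    Tendsto (normalizedSum ρ (fun N : ℕ => L N * (N : ℝ) ^ (1 - α)) t) atTop
      (𝓝 (1 / (1 - α) * t ^ (-α))) := by
  have hs := hL.tendsto_sum_div h0 h1
  have hinf := hL.tendsto_mul_rpow_atTop (γ := 1 - α) (by linarith)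
  have hLpos : ∀ᶠ j : ℕ in atTop, 0 < L j := tendsto_natCast_atTop_atTop.eventually hL.2.1
  -- The reference weights carry |L j| because L is positive only eventually, while the comparison
  -- of sums requires nonnegative weights throughout.
  have hr : Tendsto (fun j : ℕ => ρ (j * t) / (|L j| * (j : ℝ) ^ (-α))) atTop (𝓝 (t ^ (-α))) := by
    have h := ((hL.2.2 t ht).comp tendsto_natCast_atTop_atTop).mul_const (t ^ (-α))
    rw [one_mul] at h
    refine h.congr' ?_
    filter_upwards [eventually_gt_atTop 0, hLpos,
      (tendsto_natCast_atTop_atTop.atTop_mul_const ht).eventually hρ] with j hj hLj hρj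
    have hj0 : (0 : ℝ) < j := by exact_mod_cast hj
    simp only [Function.comp]
    rw [hρj, Real.mul_rpow hj0.le ht.le, Real.rpow_neg ht.le, Real.rpow_neg hj0.le,
      abs_of_pos hLj, mul_comm t]
    field_simp
  have hne : ∀ᶠ j : ℕ in atTop, |L j| * (j : ℝ) ^ (-α) ≠ 0 := by
    filter_upwards [eventually_gt_atTop 0, hLpos] with j hj hLj
    have hj0 : (0 : ℝ) < j := by exact_mod_cast hj
    positivity
  have hsum : Tendsto (fun N : ℕ => ∑ j ∈ Finset.Icc 1 N, |L j| * (j : ℝ) ^ (-α)) atTop atTop := by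
    refine (hs.pos_mul_atTop (one_div_pos.2 (by linarith)) hinf).congr' ?_
    filter_upwards [hinf.eventually_gt_atTop 0] with N hN
    exact div_mul_cancel₀ _ hN.ne'
  have := tendsto_sum_div_of_ratio (fun j => by positivity) hne hsum hs hr
  rwa [mul_comm] at this

/-! ### The family of slowly varying functions with exponent one -/

/-- A discrete differential inequality: log S grows at least k/4 times as fast as log log N, so S
grows at least like (log N)^(k/4). -/
theorem log_growth {S : ℕ → ℝ} {k : ℝ} (hk : 0 < k) {N₀ : ℕ} (hN₀ : 3 ≤ N₀)
    (hS : ∀ N, N₀ ≤ N → 0 < S N)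
    (hS' : ∀ N, N₀ ≤ N → k * S (N + 1) / ((N + 1 : ℕ) * Real.log (N + 1 : ℕ)) ≤ S (N + 1) - S N)
    (N : ℕ) (hN : N₀ ≤ N) :
    k / 4 * (Real.log (Real.log N) - Real.log (Real.log N₀)) ≤ Real.log (S N) - Real.log (S N₀) := by
  induction N, hN using Nat.le_induction with
  | base => simp
  | succ N hN ih =>
    have p0 := hS N hN
    have p1 := hS (N + 1) (by omega)
    have hN3 : (3 : ℝ) ≤ N := by exact_mod_cast hN₀.trans hN
    have hlog : 0 < Real.log N := Real.log_pos (by linarith)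
    have hlog1 : 0 < Real.log (N + 1 : ℕ) := Real.log_pos (by push_cast; linarith)
    have a1 : k / ((N + 1 : ℕ) * Real.log (N + 1 : ℕ)) ≤ Real.log (S (N + 1)) - Real.log (S N) := by
      have := Real.log_le_sub_one_of_pos (div_pos p0 p1)
      rw [Real.log_div p0.ne' p1.ne'] at this
      have h2 := (div_le_div_iff_of_pos_right p1).2 (hS' N hN)
      rw [sub_div, div_self p1.ne', div_right_comm, mul_div_assoc, div_self p1.ne', mul_one] at h2
      linarith
    -- The constant 4 comes from N + 1 ≤ 2N and log (N + 1) ≤ 2 log N, both valid for N ≥ 3.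
    have a2 : Real.log (Real.log (N + 1 : ℕ)) - Real.log (Real.log N)
        ≤ 4 / ((N + 1 : ℕ) * Real.log (N + 1 : ℕ)) := by
      have h1 := Real.log_le_sub_one_of_pos (div_pos hlog1 hlog)
      rw [Real.log_div hlog1.ne' hlog.ne'] at h1
      have h2 := Real.log_le_sub_one_of_pos (x := ((N + 1 : ℕ) : ℝ) / N) (by positivity)
      rw [Real.log_div (by positivity) (by positivity)] at h2
      have h3 : Real.log (N + 1 : ℕ) ≤ 2 * Real.log N := by
        rw [← Real.log_rpow (by linarith), Real.rpow_two]
        exact Real.log_le_log (by positivity) (by push_cast; nlinarith)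
      have h4 : ((N + 1 : ℕ) : ℝ) ≤ 2 * N := by push_cast; linarith
      have h5 : Real.log (N + 1 : ℕ) / Real.log N - 1 ≤ 1 / (N * Real.log N) := by
        have : Real.log (N + 1 : ℕ) - Real.log N ≤ 1 / N := by
          refine h2.trans (le_of_eq ?_); push_cast; field_simp; ring
        rw [div_sub_one hlog.ne', div_le_iff₀ hlog]
        refine this.trans (le_of_eq ?_); field_simp
      refine h1.trans (h5.trans ?_)
      rw [div_le_div_iff₀ (by positivity) (by positivity), one_mul]
      calc ((N + 1 : ℕ) : ℝ) * Real.log (N + 1 : ℕ) ≤ (2 * N) * (2 * Real.log N) := by gcongr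
        _ = _ := by ring
    have a3 := mul_le_mul_of_nonneg_left a2 (by positivity : 0 ≤ k / 4)
    have e : k / 4 * (4 / ((N + 1 : ℕ) * Real.log (N + 1 : ℕ)))
        = k / ((N + 1 : ℕ) * Real.log (N + 1 : ℕ)) := by field_simp
    rw [e] at a3
    linarith

/-- Slow variation alone gives ρ(jt)/ρ(jt₀) → t₀/t, so one limit q₀ at t₀ determines all others,
provided that the sums diverge. Positivity of q₀ is the delicate point: small q₀ would force the
sums to grow like a high power of log N, whereas ρ = O(1/x) keeps them within a multiple of log N.
-/
theorem tendsto_normalizedSum_svf_one {L ρ : ℝ → ℝ} (hL : IsSlowlyVarying L)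
    (hρ : ∀ᶠ x in atTop, ρ x = L x / x) (hO : ρ =O[atTop] fun x => 1 / x)
    (hlim : ∀ t : ℝ, 0 < t → ∃ q : ℝ,
      Tendsto (normalizedSum ρ (fun N : ℕ => L N * Real.log N) t) atTop (𝓝 q)) :
    ∃ c : ℝ, 0 < c ∧ ∀ t : ℝ, 0 < t →
      Tendsto (normalizedSum ρ (fun N : ℕ => L N * Real.log N) t) atTop (𝓝 (c / t)) := by
  obtain ⟨R, hR⟩ := eventually_atTop.1 (hρ.and hL.2.1)
  -- With this step length already the first term ρ(t₀) lies in the range where ρ(x) = L(x)/x > 0.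
  set t₀ := max R 1 with ht₀
  have ht0 : 0 < t₀ := lt_of_lt_of_le one_pos (le_max_right _ _)
  have hcast := tendsto_natCast_atTop_atTop (R := ℝ)
  have hloginf : Tendsto (fun N : ℕ => Real.log N) atTop atTop := Real.tendsto_log_atTop.comp hcast
  have hloglog : Tendsto (fun N : ℕ => Real.log (Real.log N)) atTop atTop :=
    Real.tendsto_log_atTop.comp hloginf
  have hge : ∀ j : ℕ, 1 ≤ j → R ≤ j * t₀ := fun j hj => by
    have : (1 : ℝ) ≤ j := by exact_mod_cast hj
    nlinarith [le_max_left R 1]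
  have hpos : ∀ j : ℕ, 1 ≤ j → 0 < ρ (j * t₀) := fun j hj => by
    obtain ⟨e, p⟩ := hR _ (hge j hj)
    have : (1 : ℝ) ≤ j := by exact_mod_cast hj
    rw [e]; positivity
  set S : ℕ → ℝ := fun N => ∑ j ∈ Finset.Icc 1 N, ρ (j * t₀) with hS
  have hSpos : ∀ N, 1 ≤ N → 0 < S N := fun N hN =>
    Finset.sum_pos (fun j hj => hpos j (Finset.mem_Icc.1 hj).1) ⟨1, by simp [hN]⟩
  have hSsucc : ∀ N, S (N + 1) - S N = ρ ((N + 1 : ℕ) * t₀) := fun N => by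
    rw [hS]; simp only [Finset.sum_Icc_succ_top (show 1 ≤ N + 1 by omega)]; ring
  obtain ⟨q₀, hq₀⟩ := hlim t₀ ht0
  have hLpos : ∀ᶠ j : ℕ in atTop, 0 < L j := hcast.eventually hL.2.1
  have hdpos : ∀ᶠ N : ℕ in atTop, 0 < L N * Real.log N := by
    filter_upwards [hLpos, hloginf.eventually_gt_atTop 0] with N h1 h2 using mul_pos h1 h2
  have hq₀nn : 0 ≤ q₀ := ge_of_tendsto hq₀ (by
    filter_upwards [hdpos, eventually_ge_atTop 1] with N h1 h2
    exact div_nonneg (hSpos N h2).le h1.le)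
  -- Eventually S(N) < ε L(N) log N and L(t₀ N) > L(N)/2, so the increment L((N+1)t₀)/((N+1)t₀)
  -- dominates S(N+1)/(2 t₀ ε (N+1) log (N+1)). Hence k = 1/(2 t₀ ε).
  have hgrow : ∀ ε, q₀ < ε → ∃ C : ℝ, ∀ᶠ N : ℕ in atTop,
      1 / (2 * t₀ * ε) / 4 * Real.log (Real.log N) + C ≤ Real.log (S N) := by
    intro ε hε
    have hε0 : 0 < ε := hq₀nn.trans_lt hε
    have hhalf : ∀ᶠ N : ℕ in atTop, 1 / 2 < L (t₀ * N) / L N :=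
      ((hL.2.2 t₀ ht0).comp hcast).eventually (lt_mem_nhds (by norm_num))
    obtain ⟨N₀, hN₀⟩ := eventually_atTop.1 (((hq₀.eventually (gt_mem_nhds hε)).and hdpos).and
      (hhalf.and hLpos))
    have := log_growth (S := S) (k := 1 / (2 * t₀ * ε)) (by positivity)
      (N₀ := max 3 N₀) (le_max_left _ _) (fun N hN => hSpos N (by omega)) (fun N hN => by
        obtain ⟨⟨g1, g2⟩, g3, g4⟩ := hN₀ (N + 1) (by omega)
        rw [hSsucc]
        have g5 : S (N + 1) < ε * (L (N + 1 : ℕ) * Real.log (N + 1 : ℕ)) := (div_lt_iff₀ g2).1 g1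
        obtain ⟨e, p⟩ := hR _ (hge (N + 1) (by omega))
        rw [lt_div_iff₀ g4, mul_comm t₀] at g3
        have hN1 : (0 : ℝ) < (N + 1 : ℕ) := by positivity
        have hl : 0 < Real.log (N + 1 : ℕ) := by
          exact (pos_iff_pos_of_mul_pos g2).1 g4
        rw [e, div_le_div_iff₀ (by positivity) (by positivity)]
        calc 1 / (2 * t₀ * ε) * S (N + 1) * (((N + 1 : ℕ) : ℝ) * t₀)
            ≤ 1 / (2 * t₀ * ε) * (ε * (L (N + 1 : ℕ) * Real.log (N + 1 : ℕ)))
              * (((N + 1 : ℕ) : ℝ) * t₀) := by gcongr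
          _ = (1 / 2 * L (N + 1 : ℕ)) * (((N + 1 : ℕ) : ℝ) * Real.log (N + 1 : ℕ)) := by field_simp
          _ ≤ _ := by gcongr)
    refine ⟨Real.log (S (max 3 N₀)) -
      1 / (2 * t₀ * ε) / 4 * Real.log (Real.log (max 3 N₀ : ℕ)), ?_⟩
    filter_upwards [eventually_ge_atTop (max 3 N₀)] with N hN
    have := this N hN
    linarith
  have hSinf : Tendsto S atTop atTop := by
    obtain ⟨C, hC⟩ := hgrow (q₀ + 1) (by linarith)
    have h1 : Tendsto (fun N : ℕ => Real.log (S N)) atTop atTop :=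
      tendsto_atTop_mono' _ hC (tendsto_atTop_add_const_right _ C
        (hloglog.const_mul_atTop (by positivity)))
    refine (Real.tendsto_exp_atTop.comp h1).congr' ?_
    filter_upwards [eventually_ge_atTop 1] with N hN
    exact Real.exp_log (hSpos N hN)
  have hq₀pos : 0 < q₀ := by
    refine hq₀nn.lt_of_ne fun h => ?_
    -- If q₀ = 0, this ε gives k/4 = 2, so S would grow at least like (log N)², against S ≤ εM log
    -- N.
    obtain ⟨C, hC⟩ := hgrow (1 / (16 * t₀)) (by rw [← h]; positivity)
    obtain ⟨M, hM⟩ := hO.bound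
    set ε := 1 / (16 * t₀) with hεdef
    have hε0 : 0 < ε := by positivity
    have hM' := hcast.eventually (hM.and hρ)
    have hfin : ∀ᶠ N : ℕ in atTop, Real.log (Real.log N) ≤ Real.log (ε * M) - C := by
      filter_upwards [hC, hM', hLpos, hdpos, hloginf.eventually_gt_atTop 0, eventually_ge_atTop 1,
        hq₀.eventually (gt_mem_nhds (show q₀ < ε by rw [← h]; positivity))]
        with N c1 c2 c3 c4 c5 c6 c7
      have hN0 : (0 : ℝ) < N := by exact_mod_cast c6
      have d1 : L N ≤ M := by
        have := c2.1
        rw [c2.2, Real.norm_of_nonneg (by positivity), Real.norm_of_nonneg (by positivity),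
          mul_one_div] at this
        exact (div_le_div_iff_of_pos_right hN0).1 this
      have hM0 : 0 < M := c3.trans_le d1
      have d2 : S N < ε * (L N * Real.log N) := (div_lt_iff₀ c4).1 c7
      have d3 : S N ≤ (ε * M) * Real.log N := d2.le.trans (by
        rw [mul_assoc]; gcongr)
      have d4 := Real.log_le_log (hSpos N c6) d3
      rw [Real.log_mul (by positivity) c5.ne'] at d4
      have d5 : 1 / (2 * t₀ * ε) / 4 = 2 := by rw [hεdef]; field_simp; norm_num
      rw [d5] at c1
      linarith
    obtain ⟨N, h1, h2⟩ := (hfin.and (hloglog.eventually_gt_atTop (Real.log (ε * M) - C))).exists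
    linarith
  refine ⟨t₀ * q₀, by positivity, fun t ht => ?_⟩
  have hr : Tendsto (fun j : ℕ => ρ (j * t) / |ρ (j * t₀)|) atTop (𝓝 (t₀ / t)) := by
    have h := (((hL.2.2 t ht).comp hcast).div ((hL.2.2 t₀ ht0).comp hcast) one_ne_zero).mul_const
      (t₀ / t)
    rw [div_one, one_mul] at h
    refine h.congr' ?_
    filter_upwards [eventually_gt_atTop 0, hLpos, (hcast.atTop_mul_const ht).eventually hρ]
      with j hj hLj hρj
    have hj0 : (0 : ℝ) < j := by exact_mod_cast hj
    obtain ⟨e, p⟩ := hR _ (hge j hj)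
    have p' : 0 < L (t₀ * j) := by rwa [mul_comm]
    simp only [Pi.div_apply, Function.comp]
    rw [abs_of_pos (hpos j hj), hρj, e, mul_comm (j : ℝ) t, mul_comm (j : ℝ) t₀]
    field_simp
  have habs : ∀ N : ℕ, ∑ j ∈ Finset.Icc 1 N, |ρ (j * t₀)| = S N := fun N =>
    Finset.sum_congr rfl fun j hj => abs_of_pos (hpos j (Finset.mem_Icc.1 hj).1)
  have := tendsto_sum_div_of_ratio (b := fun j => |ρ (j * t₀)|) (r := fun j : ℕ => ρ (j * t))
    (d := fun N : ℕ => L N * Real.log N) (κ := q₀) (fun j => abs_nonneg _)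
    (by filter_upwards [eventually_ge_atTop 1] with j hj using (abs_pos.2 (hpos j hj).ne').ne')
    (by simpa only [habs] using hSinf) (by simp only [habs]; exact hq₀) hr
  rwa [show t₀ / t * q₀ = t₀ * q₀ / t by ring] at this


/-! ### The inverse Laplace transform of a power -/

theorem integrableOn_rpow_mul_exp {z r : ℝ} (hz : 0 < z) (hr : 0 < r) :
    IntegrableOn (fun t : ℝ => t ^ (z - 1) * Real.exp (-(r * t))) (Ioi 0) := by
  refine Integrable.of_integral_ne_zero ?_
  rw [Real.integral_rpow_mul_exp_neg_mul_Ioi hz hr]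
  have := Real.Gamma_pos_of_pos hz
  positivity

/-- The Laplace transform of a power, at complex arguments. -/
theorem integral_rpow_mul_cexp {z : ℝ} (hz : 0 < z) {w : ℂ} (hw : w.re < 0) :
    ∫ t in Ioi (0 : ℝ), ((t ^ (z - 1) : ℝ) : ℂ) * Complex.exp (w * t)
      = (-w) ^ (-(z : ℂ)) * (Real.Gamma z : ℂ) := by
  -- As a complex moment generating function of `id` under κ, the integral is analytic on the
  -- half-plane; it then suffices to compare it with the closed form on the negative real axis.
  set κ : Measure ℝ := (volume.restrict (Ioi (0 : ℝ))).withDensity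
    (fun t => ENNReal.ofReal (t ^ (z - 1))) with hκ
  have hmeas : Measurable fun t : ℝ => ENNReal.ofReal (t ^ (z - 1)) := by fun_prop
  have htop : ∀ᵐ t ∂(volume.restrict (Ioi (0 : ℝ))), ENNReal.ofReal (t ^ (z - 1)) < ⊤ :=
    Eventually.of_forall fun _ => ENNReal.ofReal_lt_top
  have hκint : ∀ w : ℂ, ProbabilityTheory.complexMGF id κ w
      = ∫ t in Ioi (0 : ℝ), ((t ^ (z - 1) : ℝ) : ℂ) * Complex.exp (w * t) := by
    intro w
    rw [ProbabilityTheory.complexMGF, hκ, integral_withDensity_eq_integral_toReal_smul hmeas htop]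
    refine setIntegral_congr_fun measurableSet_Ioi fun t ht => ?_
    simp only [id]
    rw [ENNReal.toReal_ofReal (Real.rpow_nonneg (le_of_lt ht) _), Complex.real_smul]
  have hset : Iio (0 : ℝ) ⊆ interior (ProbabilityTheory.integrableExpSet id κ) := by
    refine interior_maximal (fun y hy => ?_) isOpen_Iio
    rw [ProbabilityTheory.integrableExpSet, mem_ofPred_eq, hκ,
      integrable_withDensity_iff_integrable_smul' hmeas htop]
    refine (integrableOn_rpow_mul_exp hz (neg_pos.2 hy)).congr_fun (fun t ht => ?_)
      measurableSet_Ioi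
    simp only [id, smul_eq_mul]
    rw [ENNReal.toReal_ofReal (Real.rpow_nonneg (le_of_lt ht) _)]
    ring_nf
  have hU : IsOpen {w : ℂ | w.re < 0} := isOpen_lt Complex.continuous_re continuous_const
  have h1 : AnalyticOnNhd ℂ (ProbabilityTheory.complexMGF id κ) {w : ℂ | w.re < 0} :=
    ProbabilityTheory.analyticOnNhd_complexMGF.mono fun w hw => hset hw
  have h2 : AnalyticOnNhd ℂ (fun w : ℂ => (-w) ^ (-(z : ℂ)) * (Real.Gamma z : ℂ))
      {w : ℂ | w.re < 0} := by
    refine DifferentiableOn.analyticOnNhd (fun w hw => ?_) hU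
    refine ((DifferentiableAt.cpow_const (differentiableAt_id.neg) ?_).mul_const
      _).differentiableWithinAt
    left
    simpa using hw
  have hreal : ∀ y : ℝ, y < 0 → ProbabilityTheory.complexMGF id κ y
      = (-(y : ℂ)) ^ (-(z : ℂ)) * (Real.Gamma z : ℂ) := by
    intro y hy
    have h3 := Real.integral_rpow_mul_exp_neg_mul_Ioi hz (neg_pos.2 hy)
    have h4 := congrArg (fun x : ℝ => (x : ℂ)) h3
    simp only [← integral_complex_ofReal] at h4
    rw [hκint, one_div, Real.inv_rpow (by linarith), ← Real.rpow_neg (by linarith)] at *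
    push_cast [Complex.ofReal_cpow (show 0 ≤ -y by linarith)] at h4 ⊢
    rw [← h4]
    refine setIntegral_congr_fun measurableSet_Ioi fun t ht => ?_
    simp
  have key := AnalyticOnNhd.eqOn_of_preconnected_of_frequently_eq h1 h2
    (convex_halfSpace_re_lt 0).isPreconnected (z₀ := ((-1 : ℝ) : ℂ)) (by simp) (by
      have h_real : ∃ᶠ y : ℝ in 𝓝[≠] (-1), ProbabilityTheory.complexMGF id κ y
          = (-(y : ℂ)) ^ (-(z : ℂ)) * (Real.Gamma z : ℂ) := by
        refine Eventually.frequently ?_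
        exact eventually_nhdsWithin_of_eventually_nhds
          ((gt_mem_nhds (by norm_num : (-1 : ℝ) < 0)).mono hreal)
      rw [frequently_iff_seq_forall] at h_real ⊢
      obtain ⟨xs, hx_tendsto, hx_eq⟩ := h_real
      refine ⟨fun n => xs n, ?_, fun n => hx_eq n⟩
      rw [tendsto_nhdsWithin_iff] at hx_tendsto ⊢
      constructor
      · exact (Complex.continuous_ofReal.tendsto _).comp hx_tendsto.1
      · exact hx_tendsto.2.mono fun n hn h => hn (Complex.ofReal_injective h))
  rw [← hκint]
  exact key hw

/-- The vertical line with real part one. -/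
noncomputable def vline (ξ : ℝ) : ℂ := 1 + 2 * Real.pi * ξ * Complex.I

theorem vline_re (ξ : ℝ) : (vline ξ).re = 1 := by simp [vline]

theorem vline_ne_zero (ξ : ℝ) : vline ξ ≠ 0 := fun h => by
  have := vline_re ξ; rw [h] at this; simp at this

theorem vline_mem_slitPlane (ξ : ℝ) : vline ξ ∈ Complex.slitPlane := by
  left; rw [vline_re]; norm_num

theorem continuous_vline : Continuous vline := by unfold vline; fun_prop

theorem continuous_vline_cpow (w : ℂ) : Continuous fun ξ => vline ξ ^ w :=
  continuous_iff_continuousAt.2 fun ξ =>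
    (continuousAt_cpow_const (vline_mem_slitPlane ξ)).comp continuous_vline.continuousAt

theorem one_le_norm_vline (ξ : ℝ) : 1 ≤ ‖vline ξ‖ := by
  have := Complex.abs_re_le_norm (vline ξ); rwa [vline_re, abs_one] at this

theorem norm_vline_cpow (ξ z : ℝ) : ‖vline ξ ^ (z : ℂ)‖ = ‖vline ξ‖ ^ z :=
  Complex.norm_cpow_real _ _

theorem integrable_vline_rpow {z : ℝ} (hz : 1 < z) : Integrable fun ξ => ‖vline ξ‖ ^ (-z) := by
  refine (integrable_rpow_neg_one_add_norm_sq (E := ℝ) (μ := volume) (r := z)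
    (by simpa using hz)).mono' ?_ (Eventually.of_forall fun ξ => ?_)
  · exact (continuous_vline.norm.rpow_const fun ξ =>
      Or.inl (norm_ne_zero_iff.2 (vline_ne_zero ξ))).aestronglyMeasurable
  · rw [Real.norm_of_nonneg (by positivity), show -z / 2 = (1 / 2) * (-z) by ring, Real.rpow_mul
      (by positivity)]
    refine Real.rpow_le_rpow_of_nonpos (by positivity) ?_ (by linarith)
    rw [← Real.sqrt_eq_rpow, Complex.norm_def]
    refine Real.sqrt_le_sqrt ?_
    rw [Complex.normSq_apply, vline_re, Real.norm_eq_abs, sq_abs]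
    have : (vline ξ).im = 2 * Real.pi * ξ := by simp [vline]
    rw [this]
    have hpi : 1 ≤ 2 * Real.pi := by linarith [Real.pi_gt_three]
    nlinarith [sq_nonneg ξ, mul_nonneg (sub_nonneg.2 hpi) (sq_nonneg ξ), mul_le_mul hpi hpi zero_le_one (by linarith)]

theorem integrable_vline_cpow {z : ℝ} (hz : 1 < z) : Integrable fun ξ => vline ξ ^ (-(z : ℂ)) := by
  refine (integrable_vline_rpow hz).mono' (continuous_vline_cpow _).aestronglyMeasurable
    (Eventually.of_forall fun ξ => ?_)
  rw [← Complex.ofReal_neg, norm_vline_cpow]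

theorem norm_cexp_vline (ξ : ℝ) : ‖Complex.exp (vline ξ)‖ = Real.exp 1 := by
  rw [Complex.norm_exp, vline_re]

open FourierTransform in
/-- Laplace's integral for the reciprocal of the Gamma function. -/
theorem one_div_Gamma_eq_integral {z : ℝ} (hz : 1 < z) :
    ((1 / Real.Gamma z : ℝ) : ℂ) = ∫ ξ, Complex.exp (vline ξ) * vline ξ ^ (-(z : ℂ)) := by
  have hz0 : 0 < z := by linarith
  -- The Fourier transform of t^(z-1) exp(-t) is Γ(z) times a power of `vline`, integrable because z
  -- > 1. Fourier inversion at t = 1 is the formula.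
  set f : ℝ → ℂ := (Ioi (0 : ℝ)).indicator
    (fun t => ((t ^ (z - 1) * Real.exp (-t) : ℝ) : ℂ)) with hf
  have hfi : Integrable f := by
    rw [hf, integrable_indicator_iff measurableSet_Ioi]
    have := integrableOn_rpow_mul_exp hz0 one_pos
    simp only [one_mul] at this
    exact this.ofReal
  have hF : 𝓕 f = fun ξ => vline ξ ^ (-(z : ℂ)) * (Real.Gamma z : ℂ) := by
    ext ξ
    have h := integral_rpow_mul_cexp hz0 (w := -vline ξ) (by rw [Complex.neg_re, vline_re]; norm_num)
    rw [neg_neg] at h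
    rw [← h, Real.fourier_real_eq_integral_exp_smul, ← integral_indicator measurableSet_Ioi]
    congr 1
    ext t
    by_cases ht : t ∈ Ioi (0 : ℝ)
    · rw [hf, indicator_of_mem ht, indicator_of_mem ht, smul_eq_mul]
      push_cast
      rw [mul_left_comm, ← Complex.exp_add]
      congr 2
      rw [vline]; ring
    · rw [hf, indicator_of_notMem ht, indicator_of_notMem ht, smul_zero]
  have hFi : Integrable (𝓕 f) := by
    rw [hF]; exact (integrable_vline_cpow hz).mul_const _
  have hcont : ContinuousAt f 1 := by
    have h1 : ContinuousAt (fun t : ℝ => ((t ^ (z - 1) * Real.exp (-t) : ℝ) : ℂ)) 1 := by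
      refine Complex.continuous_ofReal.continuousAt.comp ?_
      exact (Real.continuousAt_rpow_const 1 (z - 1) (Or.inl one_ne_zero)).mul (by fun_prop)
    refine h1.congr ?_
    filter_upwards [Ioi_mem_nhds (zero_lt_one' ℝ)] with t ht
    rw [hf, indicator_of_mem ht]
  have hinv := hfi.fourierInv_fourier_eq hFi hcont
  rw [Real.fourierInv_eq', hF, hf, indicator_of_mem (by simp : (1 : ℝ) ∈ Ioi 0)] at hinv
  have hG : (Real.Gamma z : ℂ) ≠ 0 := by exact_mod_cast (Real.Gamma_pos_of_pos hz0).ne'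
  have e : ∫ ξ, Complex.exp (vline ξ) * vline ξ ^ (-(z : ℂ))
      = Complex.exp 1 / (Real.Gamma z : ℂ) * ∫ v : ℝ, Complex.exp (↑(2 * Real.pi * inner ℝ v 1) *
        Complex.I) • (vline v ^ (-(z : ℂ)) * (Real.Gamma z : ℂ)) := by
    rw [← integral_const_mul]
    congr 1
    ext ξ
    have : Complex.exp (vline ξ) = Complex.exp 1 * Complex.exp (2 * Real.pi * ξ * Complex.I) := by
      rw [← Complex.exp_add, vline]
    rw [this]
    simp
    field_simp
  rw [e, hinv]
  simp
  rw [Complex.exp_neg]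
  field_simp

/-! ### The Mittag-Leffler function on the negative half-line -/

/-- Euler's integral restricted to (R, ∞) already exceeds R^(z-1) exp(-R). The parameter R stays
free so that any geometric rate can be reached. -/
theorem one_div_Gamma_le {z R : ℝ} (hz : 1 ≤ z) (hR : 0 < R) :
    1 / Real.Gamma z ≤ Real.exp R * R ^ (1 - z) := by
  have hz0 : 0 < z := by linarith
  have h1 : R ^ (z - 1) * Real.exp (-R) ≤ Real.Gamma z := by
    rw [Real.Gamma_eq_integral hz0]
    have e : ∫ x in Ioi R, Real.exp (-x) * R ^ (z - 1) = R ^ (z - 1) * Real.exp (-R) := by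
      rw [integral_mul_const, integral_exp_neg_Ioi, mul_comm]
    have hi := Real.GammaIntegral_convergent hz0
    rw [← e]
    refine le_trans (setIntegral_mono_on ?_ (hi.mono_set (Ioi_subset_Ioi hR.le)) measurableSet_Ioi
      fun x hx => ?_) (setIntegral_mono_set hi ?_ (Ioi_subset_Ioi hR.le).eventuallyLE)
    · exact (integrableOn_exp_neg_Ioi R).mul_const _
    · gcongr
      exact le_of_lt hx
    · filter_upwards [ae_restrict_mem measurableSet_Ioi] with x hx
      have : (0 : ℝ) < x := hx
      positivity
  have e2 : Real.exp R * R ^ (1 - z) = 1 / (R ^ (z - 1) * Real.exp (-R)) := by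
    rw [show 1 - z = -(z - 1) by ring, Real.rpow_neg hR.le, Real.exp_neg]
    field_simp
  rw [e2]
  exact one_div_le_one_div_of_le (by positivity) h1

theorem summable_mittagLeffler {ν β : ℝ} (hν : 0 < ν) (hβ : 0 < β) (r : ℝ) :
    Summable fun k : ℕ => (β + ν * k) * (1 / Real.Gamma (ν * k + β + 1)) * |r| ^ k := by
  -- This makes R^ν = 2(|r| + 1), so the series is dominated by a geometric one with ratio |r|/R^ν <
  -- 1.
  set R : ℝ := (2 * (|r| + 1)) ^ (1 / ν) with hR
  have hR0 : 0 < R := by positivity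
  have hRν : R ^ ν = 2 * (|r| + 1) := by
    rw [hR, ← Real.rpow_mul (by positivity)]; field_simp; simp
  have hq : |r| / R ^ ν < 1 := by
    rw [hRν, div_lt_one (by positivity)]; linarith [abs_nonneg r]
  have hq0 : 0 ≤ |r| / R ^ ν := by positivity
  have h1 : Summable fun k : ℕ => (|r| / R ^ ν) ^ k := summable_geometric_of_lt_one hq0 hq
  have h2 : Summable fun k : ℕ => (k : ℝ) * (|r| / R ^ ν) ^ k := by
    have := (hasSum_coe_mul_geometric_of_norm_lt_one
      (show ‖|r| / R ^ ν‖ < 1 by rwa [Real.norm_of_nonneg hq0])).summable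
    exact this
  have h3 : Summable fun k : ℕ => (Real.exp R * R ^ (-β)) * (β * (|r| / R ^ ν) ^ k
      + ν * ((k : ℝ) * (|r| / R ^ ν) ^ k)) :=
    ((h1.mul_left β).add (h2.mul_left ν)).mul_left _
  refine Summable.of_nonneg_of_le (fun k => ?_) (fun k => ?_) h3
  · have := Real.Gamma_pos_of_pos (show 0 < ν * k + β + 1 by positivity)
    positivity
  · have hk := one_div_Gamma_le (z := ν * k + β + 1) (by
      have : 0 ≤ ν * k := by positivity
      linarith) hR0
    have e : R ^ (1 - (ν * k + β + 1)) = R ^ (-β) * ((R ^ ν) ^ k)⁻¹ := by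
      rw [← Real.rpow_natCast, ← Real.rpow_mul hR0.le, ← Real.rpow_neg hR0.le, ← Real.rpow_add hR0]
      ring_nf
    rw [e] at hk
    calc (β + ν * k) * (1 / Real.Gamma (ν * k + β + 1)) * |r| ^ k
        ≤ (β + ν * k) * (Real.exp R * (R ^ (-β) * ((R ^ ν) ^ k)⁻¹)) * |r| ^ k := by gcongr
      _ = _ := by rw [div_pow]; field_simp

/-- The functional equation raises the argument of Γ by one. The Laplace integrals then have
exponent at least β + 1 > 1 and converge absolutely even when β ≤ 1; the price is the factor β + νk.
-/
theorem Gamma_termwise {ν β : ℝ} (hν : 0 < ν) (hβ : 0 < β) (k : ℕ) :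
    (β + ν * k) * (1 / Real.Gamma (ν * k + β + 1)) = 1 / Real.Gamma (ν * k + β) := by
  have h0 : 0 < ν * k + β := by positivity
  rw [Real.Gamma_add_one h0.ne']
  have := (Real.Gamma_pos_of_pos h0).ne'
  field_simp
  ring


/-- The condition ν ≤ 1 keeps the argument of s^ν within (-π/2, π/2). Hence s^ν + x has no zero for
Re x > 0. -/
theorem vline_cpow_re_pos {ν : ℝ} (hν : 0 < ν) (hν1 : ν ≤ 1) (ξ : ℝ) :
    0 < (vline ξ ^ (ν : ℂ)).re := by
  rw [Complex.cpow_ofReal_re]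
  have h1 : |(vline ξ).arg| < Real.pi / 2 :=
    Complex.abs_arg_lt_pi_div_two_iff.2 (Or.inl (by rw [vline_re]; norm_num))
  have h2 : |(vline ξ).arg * ν| < Real.pi / 2 := by
    rw [abs_mul, abs_of_pos hν]
    exact lt_of_le_of_lt (mul_le_of_le_one_right (abs_nonneg _) hν1) h1
  rw [abs_lt] at h2
  have h3 := Real.cos_pos_of_mem_Ioo ⟨by linarith, h2.2⟩
  have h4 := one_le_norm_vline ξ
  positivity

/-- The sum of `∑ (β + ν k) (-x / u) ^ k`. -/
noncomputable def mlKernel (ν β : ℝ) (x u : ℂ) : ℂ :=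
  β * (u / (u + x)) - ν * (x / (u + x) * (u / (u + x)))

theorem hasSum_mlKernel (ν β : ℝ) {x u : ℂ} (hu : 1 ≤ ‖u‖) (hx : ‖x‖ < 1) :
    HasSum (fun k : ℕ => ((β : ℂ) + ν * k) * (-x / u) ^ k) (mlKernel ν β x u) := by
  have hu0 : u ≠ 0 := fun h => by rw [h, norm_zero] at hu; linarith
  have hq : ‖-x / u‖ < 1 := by
    rw [norm_div, norm_neg, div_lt_one (by linarith)]; linarith
  have hux : u + x ≠ 0 := fun h => by
    have : u = -x := eq_neg_of_add_eq_zero_left h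
    rw [this, norm_neg] at hu; linarith
  have h1 := (hasSum_geometric_of_norm_lt_one hq).mul_left (β : ℂ)
  have h2 := (hasSum_coe_mul_geometric_of_norm_lt_one hq).mul_left (ν : ℂ)
  have e : 1 - -x / u = (u + x) / u := by field_simp; ring
  have e2 : mlKernel ν β x u
      = (β : ℂ) * (1 - -x / u)⁻¹ + (ν : ℂ) * (-x / u / (1 - -x / u) ^ 2) := by
    rw [e, mlKernel]
    field_simp
    ring
  have e3 : (fun k : ℕ => ((β : ℂ) + ν * k) * (-x / u) ^ k)
      = fun k : ℕ => (β : ℂ) * (-x / u) ^ k + (ν : ℂ) * ((k : ℂ) * (-x / u) ^ k) :=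
    funext fun k => by ring
  rw [e2, e3]
  exact h1.add h2

/-- The integrand in Laplace's representation of the Mittag-Leffler function. -/
noncomputable def mlIntegrand (ν β : ℝ) (x : ℂ) (ξ : ℝ) : ℂ :=
  Complex.exp (vline ξ) * vline ξ ^ (-((β + 1 : ℝ) : ℂ)) * mlKernel ν β x (vline ξ ^ (ν : ℂ))

theorem one_le_norm_vline_cpow {ν : ℝ} (hν : 0 < ν) (ξ : ℝ) : 1 ≤ ‖vline ξ ^ (ν : ℂ)‖ := by
  rw [norm_vline_cpow]; exact Real.one_le_rpow (one_le_norm_vline ξ) hν.le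

theorem norm_vline_factor (β ξ : ℝ) :
    ‖Complex.exp (vline ξ) * vline ξ ^ (-((β + 1 : ℝ) : ℂ))‖
      = Real.exp 1 * ‖vline ξ‖ ^ (-(β + 1)) := by
  rw [norm_mul, norm_cexp_vline, ← Complex.ofReal_neg, norm_vline_cpow]

theorem integrable_vline_factor {β : ℝ} (hβ : 0 < β) (C : ℝ) :
    Integrable fun ξ => Real.exp 1 * ‖vline ξ‖ ^ (-(β + 1)) * C :=
  ((integrable_vline_rpow (by linarith)).const_mul _).mul_const _

theorem continuous_vline_factor (β : ℝ) :
    Continuous fun ξ => Complex.exp (vline ξ) * vline ξ ^ (-((β + 1 : ℝ) : ℂ)) :=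
  (Complex.continuous_exp.comp continuous_vline).mul (continuous_vline_cpow _)

/-- Since |s^ν| ≥ 1 on the line, the geometric series in -x/s^ν converges uniformly for |x| < 1 and
may be integrated termwise. -/
theorem tsum_eq_integral_of_norm_lt_one {ν β : ℝ} (hν : 0 < ν) (hβ : 0 < β) {x : ℂ}
    (hx : ‖x‖ < 1) :
    ∑' k : ℕ, (((β + ν * k) * (1 / Real.Gamma (ν * k + β + 1)) : ℝ) : ℂ) * (-x) ^ k
      = ∫ ξ, mlIntegrand ν β x ξ := by
  set F : ℕ → ℝ → ℂ := fun k ξ => Complex.exp (vline ξ) * vline ξ ^ (-((β + 1 : ℝ) : ℂ)) *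
    (((β : ℂ) + ν * k) * (-x / vline ξ ^ (ν : ℂ)) ^ k) with hF
  have hFnorm : ∀ k ξ, ‖F k ξ‖ ≤ Real.exp 1 * ‖vline ξ‖ ^ (-(β + 1)) * ((β + ν * k) * ‖x‖ ^ k) := by
    intro k ξ
    rw [hF, norm_mul, norm_vline_factor, norm_mul, norm_pow, norm_div, norm_neg]
    have e : ‖(β : ℂ) + ν * k‖ = β + ν * k := by
      rw [← Complex.ofReal_natCast, ← Complex.ofReal_mul, ← Complex.ofReal_add, Complex.norm_real,
        Real.norm_of_nonneg (by positivity)]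
    rw [e]
    gcongr
    exact div_le_self (norm_nonneg _) (one_le_norm_vline_cpow hν ξ)
  have hFi : ∀ k, Integrable (F k) := fun k => by
    refine (integrable_vline_factor hβ _).mono' ?_ (Eventually.of_forall (hFnorm k))
    refine ((continuous_vline_factor β).mul (continuous_const.mul
      ((continuous_const.div (continuous_vline_cpow _) fun ξ => ?_).pow k))).aestronglyMeasurable
    exact norm_pos_iff.1 (lt_of_lt_of_le one_pos (one_le_norm_vline_cpow hν ξ))
  have hsum : Summable fun k => ∫ ξ, ‖F k ξ‖ := by
    have h1 : Summable fun k : ℕ => (β + ν * k) * ‖x‖ ^ k := by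
      have hx' : ‖‖x‖‖ < 1 := by rwa [norm_norm]
      have := ((hasSum_geometric_of_norm_lt_one hx').mul_left β).add
        ((hasSum_coe_mul_geometric_of_norm_lt_one hx').mul_left ν)
      refine this.summable.congr fun k => ?_
      ring
    refine Summable.of_nonneg_of_le (fun k => integral_nonneg fun _ => norm_nonneg _) (fun k => ?_)
      (h1.mul_left (∫ ξ, Real.exp 1 * ‖vline ξ‖ ^ (-(β + 1))))
    rw [← integral_mul_const]
    exact integral_mono (hFi k).norm (integrable_vline_factor hβ _) (hFnorm k)
  have key := hasSum_integral_of_summable_integral_norm hFi hsum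
  have e1 : ∀ k, ∫ ξ, F k ξ
      = (((β + ν * k) * (1 / Real.Gamma (ν * k + β + 1)) : ℝ) : ℂ) * (-x) ^ k := by
    intro k
    rw [Complex.ofReal_mul, one_div_Gamma_eq_integral (z := ν * k + β + 1) (by
      have : 0 ≤ ν * k := by positivity
      linarith), mul_right_comm, ← integral_const_mul]
    congr 1
    ext ξ
    have e2 : vline ξ ^ (-((ν * k + β + 1 : ℝ) : ℂ))
        = vline ξ ^ (-((β + 1 : ℝ) : ℂ)) * ((vline ξ ^ (ν : ℂ)) ^ k)⁻¹ := by
      rw [← Complex.cpow_mul_nat, ← Complex.cpow_neg, ← Complex.cpow_add _ _ (vline_ne_zero ξ)]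
      congr 1
      push_cast
      ring
    rw [e2, hF]
    simp only [div_pow]
    push_cast
    ring
  have e3 : ∫ ξ, ∑' k, F k ξ = ∫ ξ, mlIntegrand ν β x ξ := by
    congr 1
    ext ξ
    rw [mlIntegrand]
    exact ((hasSum_mlKernel ν β (one_le_norm_vline_cpow hν ξ) hx).mul_left _).tsum_eq
  rw [e3] at key
  simp only [e1] at key
  exact key.tsum_eq

theorem differentiable_mittagLeffler {ν β : ℝ} (hν : 0 < ν) (hβ : 0 < β) :
    Differentiable ℂ fun x : ℂ =>
      ∑' k : ℕ, (((β + ν * k) * (1 / Real.Gamma (ν * k + β + 1)) : ℝ) : ℂ) * (-x) ^ k := by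
  intro x
  have hball : Metric.ball (0 : ℂ) (‖x‖ + 1) ∈ 𝓝 x :=
    Metric.isOpen_ball.mem_nhds (by simp)
  refine (Complex.differentiableOn_tsum_of_summable_norm (summable_mittagLeffler hν hβ (‖x‖ + 1))
    (fun k => by fun_prop) Metric.isOpen_ball (fun k w hw => ?_)).differentiableAt hball
  have hG := Real.Gamma_pos_of_pos (show 0 < ν * k + β + 1 by positivity)
  rw [norm_mul, Complex.norm_real, Real.norm_of_nonneg (by positivity), norm_pow, norm_neg]
  have : ‖w‖ ≤ |‖x‖ + 1| := by
    rw [abs_of_nonneg (by positivity)]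
    exact (mem_ball_zero_iff.1 hw).le
  gcongr

/-- Differentiation under the integral. It supplies the holomorphy needed to carry the integral
formula from the unit disc to the right half-plane. -/
theorem differentiableOn_integral_mlIntegrand {ν β : ℝ} (hν : 0 < ν) (hν1 : ν ≤ 1) (hβ : 0 < β) :
    DifferentiableOn ℂ (fun x : ℂ => ∫ ξ, mlIntegrand ν β x ξ) {x | 0 < x.re} := by
  intro x₀ hx₀
  have hx₀' : 0 < x₀.re := hx₀
  set r := x₀.re / 2 with hr
  have hr0 : 0 < r := by positivity
  set R := ‖x₀‖ + r with hR
  have hR0 : 0 ≤ R := by positivity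
  have hre : ∀ x ∈ Metric.ball x₀ r, r < x.re ∧ ‖x‖ ≤ R := by
    intro x hx
    have h1 : ‖x - x₀‖ < r := mem_ball_iff_norm.1 hx
    have h2 := (Complex.abs_re_le_norm (x - x₀)).trans_lt h1
    rw [Complex.sub_re, abs_lt] at h2
    refine ⟨by linarith, ?_⟩
    have := norm_le_norm_add_norm_sub' x x₀
    linarith
  have hure := vline_cpow_re_pos hν hν1
  have hden : ∀ x : ℂ, 0 < x.re → ∀ ξ, vline ξ ^ (ν : ℂ) + x ≠ 0 := fun x hx ξ h => by
    have := congrArg Complex.re h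
    rw [Complex.add_re, Complex.zero_re] at this
    linarith [hure ξ]
  have hnorm : ∀ x ∈ Metric.ball x₀ r, ∀ ξ, r ≤ ‖vline ξ ^ (ν : ℂ) + x‖ := fun x hx ξ => by
    refine le_trans ?_ (Complex.re_le_norm _)
    rw [Complex.add_re]
    linarith [hure ξ, (hre x hx).1]
  have hq : ∀ x ∈ Metric.ball x₀ r, ∀ ξ,
      ‖vline ξ ^ (ν : ℂ) / (vline ξ ^ (ν : ℂ) + x)‖ ≤ 1 + R / r ∧
      ‖x / (vline ξ ^ (ν : ℂ) + x)‖ ≤ R / r ∧ ‖1 / (vline ξ ^ (ν : ℂ) + x)‖ ≤ 1 / r := by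
    intro x hx ξ
    have h0 := hden x (hr0.trans (hre x hx).1) ξ
    have h1 : ‖x / (vline ξ ^ (ν : ℂ) + x)‖ ≤ R / r := by
      rw [norm_div]
      exact div_le_div₀ hR0 (hre x hx).2 hr0 (hnorm x hx ξ)
    refine ⟨?_, h1, ?_⟩
    · have e : vline ξ ^ (ν : ℂ) / (vline ξ ^ (ν : ℂ) + x)
          = 1 - x / (vline ξ ^ (ν : ℂ) + x) := by
        field_simp; ring
      rw [e]
      refine (norm_sub_le _ _).trans ?_
      rw [norm_one]; gcongr
    · rw [norm_div, norm_one]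
      exact div_le_div₀ zero_le_one le_rfl hr0 (hnorm x hx ξ)
  have hcont : ∀ x : ℂ, 0 < x.re →
      Continuous (fun ξ => mlIntegrand ν β x ξ) := by
    intro x hx
    have hu := continuous_vline_cpow (ν : ℂ)
    have h1 : Continuous fun ξ => vline ξ ^ (ν : ℂ) / (vline ξ ^ (ν : ℂ) + x) :=
      hu.div (hu.add continuous_const) (hden x hx)
    have h2 : Continuous fun ξ => x / (vline ξ ^ (ν : ℂ) + x) :=
      continuous_const.div (hu.add continuous_const) (hden x hx)
    exact (continuous_vline_factor β).mul
      ((continuous_const.mul h1).sub (continuous_const.mul (h2.mul h1)))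
  -- The x-derivative of the integrand, arranged in the three quotients bounded in `hq`.
  set D : ℂ → ℝ → ℂ := fun x ξ => Complex.exp (vline ξ) * vline ξ ^ (-((β + 1 : ℝ) : ℂ)) *
    (-(β + ν) * (vline ξ ^ (ν : ℂ) / (vline ξ ^ (ν : ℂ) + x)) * (1 / (vline ξ ^ (ν : ℂ) + x))
      + 2 * ν * (vline ξ ^ (ν : ℂ) / (vline ξ ^ (ν : ℂ) + x)) * (1 / (vline ξ ^ (ν : ℂ) + x))
        * (x / (vline ξ ^ (ν : ℂ) + x))) with hD
  have key := hasDerivAt_integral_of_dominated_loc_of_deriv_le (μ := volume) (𝕜 := ℂ)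
    (F := fun x ξ => mlIntegrand ν β x ξ) (F' := D) (x₀ := x₀) (s := Metric.ball x₀ r)
    (bound := fun ξ => Real.exp 1 * ‖vline ξ‖ ^ (-(β + 1)) *
      ((β + ν) * (1 + R / r) * (1 / r) + 2 * ν * (1 + R / r) * (1 / r) * (R / r)))
    (Metric.ball_mem_nhds x₀ hr0) ?_ ?_ ?_ ?_ (integrable_vline_factor hβ _) ?_
  · exact key.2.differentiableAt.differentiableWithinAt
  · filter_upwards [Metric.ball_mem_nhds x₀ hr0] with x hx
    exact (hcont x (hr0.trans (hre x hx).1)).aestronglyMeasurable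
  · refine (integrable_vline_factor hβ (β * (1 + R / r) + ν * ((R / r) * (1 + R / r)))).mono'
      (hcont x₀ hx₀').aestronglyMeasurable (Eventually.of_forall fun ξ => ?_)
    obtain ⟨q1, q2, q3⟩ := hq x₀ (Metric.mem_ball_self hr0) ξ
    rw [mlIntegrand, norm_mul, norm_vline_factor, mlKernel]
    gcongr
    refine (norm_sub_le _ _).trans ?_
    rw [norm_mul, norm_mul, norm_mul (x₀ / _), Complex.norm_real, Complex.norm_real,
      Real.norm_of_nonneg hβ.le, Real.norm_of_nonneg hν.le]
    gcongr
  · have hu := continuous_vline_cpow (ν : ℂ)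
    have h1 : Continuous fun ξ => vline ξ ^ (ν : ℂ) / (vline ξ ^ (ν : ℂ) + x₀) :=
      hu.div (hu.add continuous_const) (hden x₀ hx₀')
    have h2 : Continuous fun ξ => x₀ / (vline ξ ^ (ν : ℂ) + x₀) :=
      continuous_const.div (hu.add continuous_const) (hden x₀ hx₀')
    have h3 : Continuous fun ξ => 1 / (vline ξ ^ (ν : ℂ) + x₀) :=
      continuous_const.div (hu.add continuous_const) (hden x₀ hx₀')
    exact ((continuous_vline_factor β).mul (((continuous_const.mul h1).mul h3).add
      (((continuous_const.mul h1).mul h3).mul h2))).aestronglyMeasurable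
  · refine Eventually.of_forall fun ξ x hx => ?_
    obtain ⟨q1, q2, q3⟩ := hq x hx ξ
    rw [hD, norm_mul, norm_vline_factor]
    gcongr
    refine (norm_add_le _ _).trans ?_
    rw [norm_mul, norm_mul, norm_mul, norm_mul, norm_mul, norm_mul, norm_neg,
      ← Complex.ofReal_add, Complex.norm_real, Complex.norm_real,
      Real.norm_of_nonneg (by positivity), Real.norm_of_nonneg hν.le, Complex.norm_ofNat]
    gcongr
  · refine Eventually.of_forall fun ξ x hx => ?_
    have h0 := hden x (hr0.trans (hre x hx).1) ξ
    set u := vline ξ ^ (ν : ℂ) with hu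
    have d0 : HasDerivAt (fun x : ℂ => u + x) 1 x := by
      simpa using (hasDerivAt_id x).const_add u
    have d1 : HasDerivAt (fun x : ℂ => u / (u + x)) (-(u / (u + x) ^ 2)) x := by
      exact ((hasDerivAt_const x u).div d0 h0).congr_deriv (by ring)
    have d2 : HasDerivAt (fun x : ℂ => x / (u + x)) (u / (u + x) ^ 2) x := by
      exact ((hasDerivAt_id x).div d0 h0).congr_deriv (by simp)
    have := (((d1.const_mul (β : ℂ)).sub ((d2.mul d1).const_mul (ν : ℂ)))).const_mul
      (Complex.exp (vline ξ) * vline ξ ^ (-((β + 1 : ℝ) : ℂ)))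
    refine this.congr_deriv ?_
    simp only [hD, ← hu]
    congr 1
    field_simp
    ring

theorem norm_le_norm_add_of_re_nonneg {u : ℂ} (hu : 0 ≤ u.re) {x : ℝ} (hx : 0 ≤ x) :
    ‖u‖ ≤ ‖u + x‖ ∧ x ≤ ‖u + x‖ := by
  constructor
  · rw [Complex.norm_def, Complex.norm_def]
    refine Real.sqrt_le_sqrt ?_
    rw [Complex.normSq_apply, Complex.normSq_apply]
    simp
    nlinarith
  · refine le_trans ?_ (Complex.re_le_norm _)
    simp
    exact hu

/-- For x ≥ 0 both u/(u+x) and x/(u+x) have modulus at most 1, and the first tends to 0. Every term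
of the kernel contains it, so dominated convergence applies. -/
theorem tendsto_integral_mlIntegrand {ν β : ℝ} (hν : 0 < ν) (hν1 : ν ≤ 1) (hβ : 0 < β) :
    Tendsto (fun x : ℝ => ∫ ξ, mlIntegrand ν β x ξ) atTop (𝓝 0) := by
  have hu := continuous_vline_cpow (ν : ℂ)
  have hre := vline_cpow_re_pos hν hν1
  have hden : ∀ x : ℝ, 0 ≤ x → ∀ ξ, vline ξ ^ (ν : ℂ) + x ≠ 0 := fun x hx ξ h => by
    have := congrArg Complex.re h
    rw [Complex.add_re, Complex.zero_re, Complex.ofReal_re] at this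
    linarith [hre ξ]
  rw [show (0 : ℂ) = ∫ _ : ℝ, (0 : ℂ) by simp]
  refine tendsto_integral_filter_of_dominated_convergence
    (fun ξ => Real.exp 1 * ‖vline ξ‖ ^ (-(β + 1)) * (β + ν)) ?_ ?_
    (integrable_vline_factor hβ _) (Eventually.of_forall fun ξ => ?_)
  · filter_upwards [eventually_ge_atTop 0] with x hx
    have h1 : Continuous fun ξ => vline ξ ^ (ν : ℂ) / (vline ξ ^ (ν : ℂ) + x) :=
      hu.div (hu.add continuous_const) (hden x hx)
    have h2 : Continuous fun ξ => (x : ℂ) / (vline ξ ^ (ν : ℂ) + x) :=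
      continuous_const.div (hu.add continuous_const) (hden x hx)
    exact ((continuous_vline_factor β).mul
      ((continuous_const.mul h1).sub (continuous_const.mul (h2.mul h1)))).aestronglyMeasurable
  · filter_upwards [eventually_ge_atTop 0] with x hx
    refine Eventually.of_forall fun ξ => ?_
    obtain ⟨n1, n2⟩ := norm_le_norm_add_of_re_nonneg (hre ξ).le hx
    rw [mlIntegrand, norm_mul, norm_vline_factor, mlKernel]
    gcongr
    have q1 : ‖vline ξ ^ (ν : ℂ) / (vline ξ ^ (ν : ℂ) + x)‖ ≤ 1 := by
      rw [norm_div]; exact div_le_one_of_le₀ n1 (norm_nonneg _)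
    have q2 : ‖(x : ℂ) / (vline ξ ^ (ν : ℂ) + x)‖ ≤ 1 := by
      rw [norm_div, Complex.norm_real, Real.norm_of_nonneg hx]
      exact div_le_one_of_le₀ n2 (norm_nonneg _)
    refine (norm_sub_le _ _).trans ?_
    rw [norm_mul, norm_mul, norm_mul ((x : ℂ) / _), Complex.norm_real, Complex.norm_real,
      Real.norm_of_nonneg hβ.le, Real.norm_of_nonneg hν.le]
    have := mul_le_mul q2 q1 (norm_nonneg _) zero_le_one
    nlinarith
  · have h1 : Tendsto (fun x : ℝ => vline ξ ^ (ν : ℂ) / (vline ξ ^ (ν : ℂ) + x)) atTop (𝓝 0) := by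
      refine squeeze_zero_norm' ?_
        (tendsto_const_nhds.div_atTop tendsto_id : Tendsto (fun x : ℝ => ‖vline ξ ^ (ν : ℂ)‖ / x) _ _)
      filter_upwards [eventually_gt_atTop 0] with x hx
      rw [norm_div]
      exact div_le_div_of_nonneg_left (norm_nonneg _) hx
        (norm_le_norm_add_of_re_nonneg (hre ξ).le hx.le).2
    have h2 : Tendsto (fun x : ℝ => (x : ℂ) / (vline ξ ^ (ν : ℂ) + x)) atTop (𝓝 1) := by
      have := h1.const_sub 1
      rw [sub_zero] at this
      refine this.congr' ?_
      filter_upwards [eventually_ge_atTop 0] with x hx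
      have := hden x hx ξ
      field_simp
      ring
    have h3 := ((h1.const_mul (β : ℂ)).sub ((h2.mul h1).const_mul (ν : ℂ))).const_mul
      (Complex.exp (vline ξ) * vline ξ ^ (-((β + 1 : ℝ) : ℂ)))
    simpa [mlIntegrand, mlKernel] using h3

/-- The entire series and the integral agree near x = 1/2, hence on the whole right half-plane by
the identity theorem; the limit is then read off the integral. -/
theorem tendsto_mittagLeffler_zero {ν β : ℝ} (hν : 0 < ν) (hν1 : ν ≤ 1) (hβ : 0 < β) :
    Tendsto (fun x : ℝ => ∑' k : ℕ, (-x) ^ k / Real.Gamma (ν * k + β)) atTop (𝓝 0) := by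
  have hU : IsOpen {x : ℂ | 0 < x.re} := isOpen_lt continuous_const Complex.continuous_re
  have key := AnalyticOnNhd.eqOn_of_preconnected_of_eventuallyEq
    ((differentiable_mittagLeffler hν hβ).differentiableOn.analyticOnNhd hU)
    ((differentiableOn_integral_mlIntegrand hν hν1 hβ).analyticOnNhd hU)
    (convex_halfSpace_re_gt 0).isPreconnected (z₀ := (1 / 2 : ℂ)) (by simp) (by
      filter_upwards [Metric.isOpen_ball.mem_nhds (show (1 / 2 : ℂ) ∈ Metric.ball (0 : ℂ) 1 by
        rw [mem_ball_zero_iff]; norm_num)] with x hx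
      exact tsum_eq_integral_of_norm_lt_one hν hβ (mem_ball_zero_iff.1 hx))
  have h := tendsto_integral_mlIntegrand hν hν1 hβ
  have h2 := (Complex.continuous_re.tendsto _).comp h
  rw [Complex.zero_re] at h2
  refine h2.congr' ?_
  filter_upwards [eventually_gt_atTop 0] with x hx
  have := key (show (x : ℂ) ∈ {x : ℂ | 0 < x.re} by simpa using hx)
  simp only at this
  rw [Function.comp, ← this]
  have e : ∀ k : ℕ, (((β + ν * k) * (1 / Real.Gamma (ν * k + β + 1)) : ℝ) : ℂ) * (-(x : ℂ)) ^ k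
      = (((-x) ^ k / Real.Gamma (ν * k + β) : ℝ) : ℂ) := fun k => by
    rw [Gamma_termwise hν hβ]
    push_cast
    ring
  simp only [e]
  rw [← Complex.ofReal_tsum, Complex.ofReal_re]

theorem summable_mittagLeffler_series {ν β : ℝ} (hν : 0 < ν) (hβ : 0 < β) (x : ℝ) :
    Summable fun k : ℕ => x ^ k / Real.Gamma (ν * k + β) := by
  refine Summable.of_norm ((summable_mittagLeffler hν hβ x).congr fun k => ?_)
  rw [Gamma_termwise hν hβ]
  have := Real.Gamma_pos_of_pos (show 0 < ν * k + β by positivity)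
  rw [norm_div, norm_pow, Real.norm_eq_abs, Real.norm_of_nonneg this.le]
  ring

/-- The Mittag-Leffler function decays like `1 / x` on the negative half-line. -/
theorem tendsto_mul_mittagLefflerE {ν β : ℝ} (hν : 0 < ν) (hν1 : ν ≤ 1) (hβ : ν < β) :
    Tendsto (fun x : ℝ => x * mittagLefflerE ν β (-x)) atTop
      (𝓝 (Real.Gamma β / Real.Gamma (β - ν))) := by
  -- With second parameter β - ν, splitting off the zeroth term 1/Γ(β-ν) leaves -x times the series
  -- with parameter β. That the total tends to 0 is the claim.
  have h0 := tendsto_mittagLeffler_zero hν hν1 (sub_pos.2 hβ)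
  have h1 := (h0.const_sub (1 / Real.Gamma (β - ν))).const_mul (Real.Gamma β)
  rw [sub_zero, mul_one_div] at h1
  refine h1.congr fun x => ?_
  rw [(summable_mittagLeffler_series hν (sub_pos.2 hβ) (-x)).tsum_eq_zero_add, mittagLefflerE]
  have e : ∀ k : ℕ, (-x) ^ (k + 1) / Real.Gamma (ν * (k + 1 : ℕ) + (β - ν))
      = -x * ((-x) ^ k / Real.Gamma (ν * k + β)) := fun k => by
    rw [show ν * (k + 1 : ℕ) + (β - ν) = ν * k + β by push_cast; ring]
    ring
  simp only [e]
  rw [tsum_mul_left]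
  simp
  ring


/-! ### The limit function of each family -/

/-- The normalized sums converge to a multiple of `t ^ (-α)`; the constant is `c / (1 - α)` or `c`. -/
theorem CorrFamily.exists_tendsto {F : CorrFamily} {α : ℝ} {ρ : ℝ → ℝ} (h0 : 0 < α) (h1 : α ≤ 1)
    (hρ : F.Describes α ρ)
    (hlim : ∀ L : ℝ → ℝ, F = CorrFamily.svf L → α = 1 → ∀ t : ℝ, 0 < t → ∃ q : ℝ,
      Tendsto (normalizedSum ρ (F.normalizer α) t) atTop (𝓝 q)) :
    0 < F.const α ρ ∧ ∀ t : ℝ, 0 < t → Tendsto (normalizedSum ρ (F.normalizer α) t) atTop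
      (𝓝 ((if α < 1 then F.const α ρ / (1 - α) else F.const α ρ) * t ^ (-α))) := by
  match F, hρ, hlim with
  | .cauchy β, hρ, _ =>
    obtain ⟨hβ, hρ⟩ := hρ
    refine ⟨one_pos, fun t ht => ?_⟩
    refine tendsto_normalizedSum_of_rpow (c := 1) h0 h1 ?_ ht
    simp only [hρ]
    exact tendsto_cauchy hβ
  | .mittagLeffler ν β, hρ, _ =>
    obtain ⟨hν, hν1, hβ, hρ⟩ := hρ
    refine ⟨div_pos (Real.Gamma_pos_of_pos (by linarith)) (Real.Gamma_pos_of_pos (by linarith)),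
      fun t ht => ?_⟩
    refine tendsto_normalizedSum_of_rpow (c := Real.Gamma β / Real.Gamma (β - ν)) h0 h1 ?_ ht
    simp only [hρ]
    refine ((tendsto_mul_mittagLefflerE hν hν1 hβ).comp (tendsto_rpow_atTop h0)).congr' ?_
    filter_upwards [eventually_gt_atTop 0] with x hx
    simp only [Function.comp, abs_of_pos hx]
  | .svf L, hρ, hlim =>
    obtain ⟨hL, hρ, hO⟩ := hρ
    have hat : (atTop : Filter ℝ) ≤ cobounded ℝ := IsOrderBornology.atTop_le_cobounded
    have hρ' : ∀ᶠ x in atTop, ρ x = L x / x ^ α := by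
      filter_upwards [hat hρ, eventually_gt_atTop 0] with x hx hx0
      rw [hx, abs_of_pos hx0]
    by_cases hα : α < 1
    · have hc : (CorrFamily.svf L).const α ρ = 1 := if_pos hα
      rw [hc, if_pos hα]
      refine ⟨one_pos, fun t ht => ?_⟩
      have hn : (CorrFamily.svf L).normalizer α = fun N : ℕ => L N * (N : ℝ) ^ (1 - α) := by
        ext N; simp [CorrFamily.normalizer, hα]
      rw [hn]
      exact tendsto_normalizedSum_svf hL h0 hα hρ' ht
    · have hα1 : α = 1 := le_antisymm h1 (not_lt.1 hα)
      subst hα1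
      have hn : (CorrFamily.svf L).normalizer 1 = fun N : ℕ => L N * Real.log N := by
        ext N; simp [CorrFamily.normalizer]
      have hl := hlim L rfl rfl
      rw [hn] at hl ⊢
      obtain ⟨c, hc, hct⟩ := tendsto_normalizedSum_svf_one hL (by simpa using hρ') (by
        refine (hO.mono hat).congr' EventuallyEq.rfl ?_
        filter_upwards [eventually_gt_atTop 0] with x hx
        rw [abs_of_pos hx, Real.rpow_one]) hl
      have hcc : (CorrFamily.svf L).const 1 ρ = c := by
        simp only [CorrFamily.const, lt_irrefl, if_false, CorrFamily.Q, limitQ, hn]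
        rw [(hct 1 one_pos).limUnder_eq, div_one]
      rw [hcc, if_neg (lt_irrefl _)]
      refine ⟨hc, fun t ht => ?_⟩
      rw [Real.rpow_neg_one]
      exact hct t ht


/-! ### The quantile function of a design -/

section Quantile

variable {T : ℝ} {ξ : Measure ℝ}

theorem IsDesign.ae_mem (hξ : IsDesign T ξ) : ∀ᵐ x ∂ξ, x ∈ Icc (-T) T := by
  have := hξ.1
  exact mem_ae_iff_prob_eq_one measurableSet_Icc |>.2 hξ.2

theorem IsDesign.real_Iic_of_le (hξ : IsDesign T ξ) {x : ℝ} (hx : T ≤ x) :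
    ξ.real (Iic x) = 1 := by
  have := hξ.1
  have h : ξ (Iic x) = 1 := le_antisymm prob_le_one
    (hξ.2 ▸ measure_mono fun y hy => hy.2.trans hx)
  rw [measureReal_def, h, ENNReal.toReal_one]

theorem IsDesign.real_Iic_of_lt (hξ : IsDesign T ξ) {x : ℝ} (hx : x < -T) :
    ξ.real (Iic x) = 0 := by
  have := hξ.1
  rw [measureReal_def, measure_mono_null (t := (Icc (-T) T)ᶜ) (fun y hy h => ?_) hξ.ae_mem]
  · simp
  · exact absurd h.1 (not_le.2 (lt_of_le_of_lt hy hx))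

/-- The infimum is attained by right continuity of the distribution function. This Galois connection
yields monotonicity and the law of the quantile function. -/
theorem IsDesign.quantile_le_iff (hξ : IsDesign T ξ) {u : ℝ} (hu : u ∈ Ioo (0 : ℝ) 1) (x : ℝ) :
    quantile ξ u ≤ x ↔ u ≤ ξ.real (Iic x) := by
  have := hξ.1
  have hbdd : BddBelow {x : ℝ | u ≤ ξ.real (Iic x)} := ⟨-T, fun y hy => by
    by_contra h
    have hy' : u ≤ ξ.real (Iic y) := hy
    rw [hξ.real_Iic_of_lt (not_le.1 h)] at hy'
    exact absurd hu.1 (not_lt.2 hy')⟩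
  have hne : {x : ℝ | u ≤ ξ.real (Iic x)}.Nonempty := ⟨T, by
    change u ≤ ξ.real (Iic T)
    rw [hξ.real_Iic_of_le le_rfl]; exact hu.2.le⟩
  refine ⟨fun h => ?_, fun h => csInf_le hbdd h⟩
  have hmono : ∀ y, quantile ξ u < y → u ≤ ξ.real (Iic y) := fun y hy => by
    obtain ⟨z, hz, hzy⟩ := exists_lt_of_csInf_lt hne hy
    exact le_trans hz (measureReal_mono (Iic_subset_Iic.2 hzy.le))
  have hright : Tendsto (fun y => ξ.real (Iic y)) (𝓝[>] quantile ξ u)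
      (𝓝 (ξ.real (Iic (quantile ξ u)))) := by
    have h1 := (ProbabilityTheory.cdf ξ).right_continuous (quantile ξ u)
    simp only [ContinuousWithinAt, ProbabilityTheory.cdf_eq_real] at h1
    exact (h1.mono_left (nhdsWithin_mono _ Ioi_subset_Ici_self)).congr fun y =>
      ProbabilityTheory.cdf_eq_real ξ y
  have hq : u ≤ ξ.real (Iic (quantile ξ u)) :=
    ge_of_tendsto hright (eventually_nhdsWithin_of_forall hmono)
  exact hq.trans (measureReal_mono (Iic_subset_Iic.2 h))

theorem IsDesign.quantile_mem (hξ : IsDesign T ξ) {u : ℝ} (hu : u ∈ Ioo (0 : ℝ) 1) :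
    quantile ξ u ∈ Icc (-T) T := by
  constructor
  · by_contra h
    have := (hξ.quantile_le_iff hu _).1 le_rfl
    rw [hξ.real_Iic_of_lt (not_le.1 h)] at this
    exact absurd hu.1 (not_lt.2 this)
  · rw [hξ.quantile_le_iff hu, hξ.real_Iic_of_le le_rfl]; exact hu.2.le

theorem IsDesign.monotoneOn_quantile (hξ : IsDesign T ξ) :
    MonotoneOn (quantile ξ) (Ioo (0 : ℝ) 1) := fun u hu v hv huv => by
  rw [hξ.quantile_le_iff hu]
  exact huv.trans ((hξ.quantile_le_iff hv _).1 le_rfl)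

theorem IsDesign.aemeasurable_quantile (hξ : IsDesign T ξ) :
    AEMeasurable (quantile ξ) (volume.restrict (Ioo (0 : ℝ) 1)) :=
  aemeasurable_restrict_of_monotoneOn measurableSet_Ioo hξ.monotoneOn_quantile

/-- The quantile function carries the uniform law on (0, 1) to ξ, so integrals in u become integrals
against ξ. -/
theorem IsDesign.map_quantile (hξ : IsDesign T ξ) :
    (volume.restrict (Ioo (0 : ℝ) 1)).map (quantile ξ) = ξ := by
  have := hξ.1
  have hfin : IsFiniteMeasure ((volume.restrict (Ioo (0 : ℝ) 1)).map (quantile ξ)) := by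
    infer_instance
  refine Measure.ext_of_Iic _ _ fun x => ?_
  rw [Measure.map_apply_of_aemeasurable hξ.aemeasurable_quantile measurableSet_Iic]
  have hF1 : ξ.real (Iic x) ≤ 1 := measureReal_le_one
  have hset : volume.restrict (Ioo (0 : ℝ) 1) (quantile ξ ⁻¹' Iic x)
      = volume.restrict (Ioo (0 : ℝ) 1) (Iic (ξ.real (Iic x))) := by
    refine measure_congr ?_
    filter_upwards [ae_restrict_mem measurableSet_Ioo] with u hu
    exact propext (hξ.quantile_le_iff hu x)
  rw [hset, Measure.restrict_apply measurableSet_Iic]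
  have hint : volume (Iic (ξ.real (Iic x)) ∩ Ioo (0 : ℝ) 1)
      = volume (Ioc (0 : ℝ) (ξ.real (Iic x))) := by
    refine measure_congr ?_
    have h1 : ∀ᵐ u : ℝ, u ≠ 1 := Measure.ae_ne volume 1
    filter_upwards [h1] with u hu1
    refine propext ⟨fun h => ⟨h.2.1, h.1⟩, fun h => ⟨h.2, h.1, lt_of_le_of_ne (h.2.trans hF1) hu1⟩⟩
  rw [hint, Real.volume_Ioc, sub_zero, ofReal_measureReal]

theorem IsDesign.lintegral_quantile (hξ : IsDesign T ξ) {h : ℝ → ℝ≥0∞} (hh : AEMeasurable h ξ) :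
    ∫⁻ u in Ioo (0 : ℝ) 1, h (quantile ξ u) = ∫⁻ x, h x ∂ξ := by
  conv_rhs => rw [← hξ.map_quantile]
  rw [lintegral_map' (by rwa [hξ.map_quantile]) hξ.aemeasurable_quantile]

theorem IsDesign.ae_quantile (hξ : IsDesign T ξ) {p : ℝ → Prop} (hp : ∀ᵐ x ∂ξ, p x) :
    ∀ᵐ u ∂(volume.restrict (Ioo (0 : ℝ) 1)), p (quantile ξ u) := by
  rw [← hξ.map_quantile] at hp
  exact ae_of_ae_map hξ.aemeasurable_quantile hp

theorem IsDesign.ae_differentiableAt_quantile (hξ : IsDesign T ξ) :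
    ∀ᵐ u ∂(volume.restrict (Ioo (0 : ℝ) 1)), DifferentiableAt ℝ (quantile ξ) u := by
  filter_upwards [hξ.monotoneOn_quantile.ae_differentiableWithinAt measurableSet_Ioo,
    ae_restrict_mem measurableSet_Ioo] with u hu hmem
  exact hu.differentiableAt (isOpen_Ioo.mem_nhds hmem)

end Quantile

/-! ### Absolutely continuous designs -/

section Density

variable {T : ℝ} {p : ℝ → ℝ}

theorem isDesign_designOf (hp : Integrable p) (h0 : ∀ x, 0 ≤ p x)
    (hI : ∀ x, x ∉ Icc (-T) T → p x = 0) (h1 : ∫ x, p x = 1) : IsDesign T (designOf p) := by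
  have huniv : designOf p univ = 1 := by
    rw [designOf, withDensity_apply _ MeasurableSet.univ, Measure.restrict_univ,
      ← ofReal_integral_eq_lintegral_ofReal hp (Eventually.of_forall h0), h1, ENNReal.ofReal_one]
  refine ⟨⟨huniv⟩, ?_⟩
  rw [← huniv, designOf, withDensity_apply _ MeasurableSet.univ, Measure.restrict_univ,
    withDensity_apply _ measurableSet_Icc]
  rw [← lintegral_indicator measurableSet_Icc]
  congr 1
  ext x
  by_cases hx : x ∈ Icc (-T) T
  · rw [indicator_of_mem hx]
  · rw [indicator_of_notMem hx, hI x hx, ENNReal.ofReal_zero]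

theorem designOf_absolutelyContinuous (p : ℝ → ℝ) : designOf p ≪ volume :=
  withDensity_absolutelyContinuous _ _

theorem real_Iic_designOf (hp : Integrable p) (h0 : ∀ x, 0 ≤ p x) (x : ℝ) :
    (designOf p).real (Iic x) = ∫ t in Iic x, p t := by
  rw [measureReal_def, designOf, withDensity_apply _ measurableSet_Iic,
    integral_eq_lintegral_of_nonneg_ae (Eventually.of_forall h0) hp.aestronglyMeasurable.restrict]

/-- The derivative of the quantile function is the reciprocal of the density. -/
theorem ae_deriv_quantile_designOf (hp : Integrable p) (h0 : ∀ x, 0 ≤ p x)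
    (hd : IsDesign T (designOf p)) :
    ∀ᵐ u ∂(volume.restrict (Ioo (0 : ℝ) 1)), 0 < p (quantile (designOf p) u) ∧
      deriv (quantile (designOf p)) u = 1 / p (quantile (designOf p) u) := by
  set F : ℝ → ℝ := fun x => (designOf p).real (Iic x) with hF
  have hFeq : F = fun x => (∫ t in (0 : ℝ)..x, p t) + ∫ t in Iic 0, p t := by
    ext x
    simp only [hF]
    rw [real_Iic_designOf hp h0, ← intervalIntegral.integral_Iic_sub_Iic hp.integrableOn
      hp.integrableOn]
    ring
  have hFc : Continuous F := by
    rw [hFeq]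
    exact (intervalIntegral.continuous_primitive (fun a b => hp.intervalIntegrable) 0).add
      continuous_const
  -- Lebesgue differentiation holds almost everywhere for Lebesgue measure. Absolute continuity
  -- transfers it to the design, and the quantile function to almost every u.
  have hFd : ∀ᵐ x ∂(designOf p), HasDerivAt F (p x) x := by
    refine (designOf_absolutelyContinuous p).ae_le ?_
    filter_upwards [LocallyIntegrable.ae_hasDerivAt_integral hp.locallyIntegrable] with x hx
    rw [hFeq]
    exact (hx 0).add_const _
  have hpos : ∀ᵐ x ∂(designOf p), 0 < p x := by
    rw [designOf, ae_withDensity_iff' hp.aestronglyMeasurable.aemeasurable.ennreal_ofReal]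
    refine Eventually.of_forall fun x hx => ?_
    exact ENNReal.ofReal_pos.1 (pos_iff_ne_zero.2 hx)
  -- Continuity of F, the absence of atoms, makes the quantile function an exact right inverse; the
  -- chain rule then gives p(a(u)) a'(u) = 1.
  have hFa : ∀ u ∈ Ioo (0 : ℝ) 1, F (quantile (designOf p) u) = u := by
    intro u hu
    refine le_antisymm ?_ ((hd.quantile_le_iff hu _).1 le_rfl)
    have : Tendsto F (𝓝[<] quantile (designOf p) u) (𝓝 (F (quantile (designOf p) u))) :=
      (hFc.tendsto _).mono_left nhdsWithin_le_nhds
    refine le_of_tendsto this (eventually_nhdsWithin_of_forall fun x hx => ?_)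
    by_contra h
    exact absurd ((hd.quantile_le_iff hu x).2 (not_le.1 h).le) (not_le.2 hx)
  filter_upwards [hd.ae_quantile hFd, hd.ae_quantile hpos, hd.ae_differentiableAt_quantile,
    ae_restrict_mem measurableSet_Ioo] with u h1 h2 h3 hu
  refine ⟨h2, ?_⟩
  have hc := h1.comp u h3.hasDerivAt
  have hid : HasDerivAt (F ∘ quantile (designOf p)) 1 u := by
    refine (hasDerivAt_id u).congr_of_eventuallyEq ?_
    filter_upwards [isOpen_Ioo.mem_nhds hu] with v hv
    exact hFa v hv
  have := hc.unique hid
  rw [eq_div_iff h2.ne', mul_comm]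
  exact this

end Density


/-! ### The extremal densities -/

open Classical in
/-- The density `(1 - σ / g)₊ ^ (1 / α)`, zero where `g` vanishes. -/
noncomputable def levelDensity (g : ℝ → ℝ) (α σ : ℝ) (t : ℝ) : ℝ :=
  if g t = 0 then 0 else (max 0 (1 - σ / g t)) ^ (1 / α)

section LevelDensity

variable {g : ℝ → ℝ} {α σ : ℝ}

theorem levelDensity_nonneg (t : ℝ) : 0 ≤ levelDensity g α σ t := by
  rw [levelDensity]; split_ifs
  · exact le_rfl
  · positivity

theorem levelDensity_le_one (hg : ∀ t, 0 ≤ g t) (hα : 0 < α) (hσ : 0 ≤ σ) (t : ℝ) :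
    levelDensity g α σ t ≤ 1 := by
  rw [levelDensity]; split_ifs
  · exact zero_le_one
  · refine Real.rpow_le_one (by positivity) (max_le zero_le_one ?_) (by positivity)
    linarith [div_nonneg hσ (hg t)]

theorem measurable_levelDensity (hg : Continuous g) : Measurable (levelDensity g α σ) := by
  have hgm := hg.measurable
  refine Measurable.ite (hgm (measurableSet_singleton 0)) measurable_const ?_
  fun_prop

theorem levelDensity_eq_zero {t : ℝ} (h : g t = 0) : levelDensity g α σ t = 0 := by
  rw [levelDensity, if_pos h]

theorem levelDensity_rpow (hα : 0 < α) {t : ℝ} (h : g t ≠ 0) :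
    levelDensity g α σ t ^ α = max 0 (1 - σ / g t) := by
  rw [levelDensity, if_neg h, ← Real.rpow_mul (by positivity), one_div_mul_cancel hα.ne',
    Real.rpow_one]

/-- The Euler–Lagrange relation of q_σ. Integrated, it gives A(σ) = ∫ g q_σ - σ ∫ q_σ. -/
theorem mul_levelDensity_rpow (hα : 0 < α) (t : ℝ) :
    g t * levelDensity g α σ t ^ (1 + α) = (g t - σ) * levelDensity g α σ t := by
  by_cases h : g t = 0
  · rw [levelDensity_eq_zero h, Real.zero_rpow (by positivity)]; ring
  · rcases (levelDensity_nonneg (g := g) (α := α) (σ := σ) t).eq_or_lt with h0 | h0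
    · rw [← h0, Real.zero_rpow (by positivity)]; ring
    · rw [Real.rpow_add h0, Real.rpow_one, levelDensity_rpow hα h]
      have h1 : 0 < levelDensity g α σ t ^ α := by positivity
      rw [levelDensity_rpow hα h] at h1
      rw [max_eq_right (by
        by_contra hc
        rw [max_eq_left (not_le.1 hc).le] at h1
        exact lt_irrefl _ h1)]
      field_simp

/-- Strict convexity of x^(1+α): after division by y^(1+α) this is Bernoulli's inequality at x/y -
1. -/
theorem rpow_tangent (hα : 0 < α) {x y : ℝ} (hx : 0 ≤ x) (hy : 0 ≤ y) :
    0 ≤ x ^ (1 + α) - (1 + α) * y ^ α * x + α * y ^ (1 + α) ∧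
      (x ^ (1 + α) - (1 + α) * y ^ α * x + α * y ^ (1 + α) = 0 → x = y) := by
  rcases hy.eq_or_lt with rfl | hy
  · rw [Real.zero_rpow hα.ne', Real.zero_rpow (by positivity)]
    refine ⟨by simpa using Real.rpow_nonneg hx _, fun h => ?_⟩
    simp only [mul_zero, zero_mul, sub_zero, add_zero] at h
    exact ((Real.rpow_eq_zero hx (by positivity)).1 h)
  · have e : x ^ (1 + α) - (1 + α) * y ^ α * x + α * y ^ (1 + α)
        = y ^ (1 + α) * ((1 + (x / y - 1)) ^ (1 + α) - (1 + (1 + α) * (x / y - 1))) := by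
      rw [add_sub_cancel, Real.div_rpow hx hy.le, Real.rpow_add hy, Real.rpow_one]
      have : 0 < y ^ α := by positivity
      field_simp
      ring
    have hs : -1 ≤ x / y - 1 := by linarith [div_nonneg hx hy.le]
    have hyp : 0 < y ^ (1 + α) := by positivity
    rw [e]
    refine ⟨mul_nonneg hyp.le (sub_nonneg.2
      (one_add_mul_self_le_rpow_one_add hs (by linarith))), fun h => ?_⟩
    by_contra hne
    have hs' : x / y - 1 ≠ 0 := fun h0 => hne (by
      rw [sub_eq_zero, div_eq_one_iff_eq hy.ne'] at h0; exact h0)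
    have := one_add_mul_self_lt_rpow_one_add hs hs' (show 1 < 1 + α by linarith)
    rcases mul_eq_zero.1 h with h1 | h1
    · exact hyp.ne' h1
    · linarith

/-- The extremal density minimizes the Lagrange function pointwise. -/
theorem levelDensity_tangent (hg : ∀ t, 0 ≤ g t) (hα : 0 < α) (hσ : 0 ≤ σ) (t : ℝ) {x : ℝ}
    (hx : 0 ≤ x) :
    0 ≤ g t * x ^ (1 + α) - (1 + α) * (g t - σ) * x + α * (g t * levelDensity g α σ t ^ (1 + α)) := by
  by_cases h : g t = 0
  · rw [h]
    have : 0 ≤ (1 + α) * σ * x := by positivity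
    linarith
  · have h1 := (rpow_tangent hα hx (levelDensity_nonneg (g := g) (α := α) (σ := σ) t)).1
    rw [levelDensity_rpow hα h] at h1
    have h2 := mul_nonneg (hg t) h1
    have h3 : g t - σ ≤ g t * max 0 (1 - σ / g t) := by
      calc g t - σ = g t * (1 - σ / g t) := by field_simp
        _ ≤ _ := mul_le_mul_of_nonneg_left (le_max_right _ _) (hg t)
    have h4 := mul_le_mul_of_nonneg_left h3 (show 0 ≤ (1 + α) * x by positivity)
    nlinarith

/-- Where g vanishes, the term (1+α)σx makes equality impossible; this is where σ > 0 enters.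
Elsewhere the tangent inequality is strict unless x = q_σ. -/
theorem eq_levelDensity_of_tangent (hg : ∀ t, 0 ≤ g t) (hα : 0 < α) (hσ : 0 < σ) {t : ℝ} {x : ℝ}
    (hx : 0 < x) (h0 : g t * x ^ (1 + α) - (1 + α) * (g t - σ) * x
      + α * (g t * levelDensity g α σ t ^ (1 + α)) = 0) : x = levelDensity g α σ t := by
  by_cases h : g t = 0
  · rw [h] at h0
    have : 0 < (1 + α) * σ * x := by positivity
    linarith
  · have hgt : 0 < g t := lt_of_le_of_ne (hg t) (Ne.symm h)
    have hl := rpow_tangent hα hx.le (levelDensity_nonneg (g := g) (α := α) (σ := σ) t)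
    refine hl.2 (le_antisymm ?_ hl.1)
    rw [levelDensity_rpow hα h]
    have h3 : g t - σ ≤ g t * max 0 (1 - σ / g t) := by
      calc g t - σ = g t * (1 - σ / g t) := by field_simp
        _ ≤ _ := mul_le_mul_of_nonneg_left (le_max_right _ _) (hg t)
    have h4 := mul_le_mul_of_nonneg_left h3 (show 0 ≤ (1 + α) * x by positivity)
    by_contra hc
    have := mul_pos hgt (not_le.1 hc)
    nlinarith

variable {T : ℝ}

theorem integrableOn_levelDensity (hgc : Continuous g) (hg : ∀ t, 0 ≤ g t) (hα : 0 < α)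
    (hσ : 0 ≤ σ) : IntegrableOn (levelDensity g α σ) (Icc (-T) T) := by
  refine Measure.integrableOn_of_bounded (M := 1) measure_Icc_lt_top.ne
    (measurable_levelDensity hgc).aestronglyMeasurable (Eventually.of_forall fun t => ?_)
  rw [Real.norm_of_nonneg (levelDensity_nonneg t)]
  exact levelDensity_le_one hg hα hσ t

theorem integrableOn_mul_of_le_one (hgc : Continuous g) {q : ℝ → ℝ} (hq : Measurable q)
    (hq0 : ∀ t, 0 ≤ q t) (hq1 : ∀ t, q t ≤ 1) :
    IntegrableOn (fun t => g t * q t) (Icc (-T) T) := by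
  have h1 : IntegrableOn g (Icc (-T) T) := hgc.integrableOn_Icc
  refine Integrable.mono' h1.norm (hgc.measurable.mul hq).aestronglyMeasurable
    (Eventually.of_forall fun t => ?_)
  rw [norm_mul, Real.norm_of_nonneg (hq0 t)]
  exact mul_le_of_le_one_right (norm_nonneg _) (hq1 t)

theorem integrableOn_mul_levelDensity (hgc : Continuous g) (hg : ∀ t, 0 ≤ g t) (hα : 0 < α)
    (hσ : 0 ≤ σ) : IntegrableOn (fun t => g t * levelDensity g α σ t) (Icc (-T) T) :=
  integrableOn_mul_of_le_one hgc (measurable_levelDensity hgc) levelDensity_nonneg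
    (levelDensity_le_one hg hα hσ)

theorem integrableOn_mul_levelDensity_rpow (hgc : Continuous g) (hg : ∀ t, 0 ≤ g t) (hα : 0 < α)
    (hσ : 0 ≤ σ) :
    IntegrableOn (fun t => g t * levelDensity g α σ t ^ (1 + α)) (Icc (-T) T) :=
  integrableOn_mul_of_le_one hgc ((measurable_levelDensity hgc).pow_const _)
    (fun t => Real.rpow_nonneg (levelDensity_nonneg t) _)
    (fun t => Real.rpow_le_one (levelDensity_nonneg t) (levelDensity_le_one hg hα hσ t)
      (by positivity))

end LevelDensity

/-- The integral `∫ g q ^ (1 + α)` of the extremal density `q`. -/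
noncomputable def levelEnergy (g : ℝ → ℝ) (α T σ : ℝ) : ℝ :=
  ∫ t in Icc (-T) T, g t * levelDensity g α σ t ^ (1 + α)

/-! ### Lower bound for the variance at a fixed value of W -/

section Bound

variable {g : ℝ → ℝ} {α T : ℝ}

theorem levelEnergy_eq (hgc : Continuous g) (hg : ∀ t, 0 ≤ g t) (hα : 0 < α) {σ : ℝ}
    (hσ : 0 ≤ σ) : levelEnergy g α T σ = (∫ t in Icc (-T) T, g t * levelDensity g α σ t)
      - σ * ∫ t in Icc (-T) T, levelDensity g α σ t := by
  rw [levelEnergy, ← integral_const_mul, ← integral_sub (integrableOn_mul_levelDensity hgc hg hα hσ)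
    ((integrableOn_levelDensity hgc hg hα hσ).const_mul σ)]
  refine integral_congr_ae (Eventually.of_forall fun t => ?_)
  simp only [mul_levelDensity_rpow hα]
  ring

theorem extendQ_eq {Q : ℝ → ℝ} {K : ℝ} (hQ : ∀ t, 0 < t → Q t = K * t ^ (-α)) :
    extendQ Q = fun s => if 0 < s then ENNReal.ofReal (K * s ^ (-α)) else ⊤ := by
  ext s
  rw [extendQ]
  split_ifs with h
  · rw [hQ s h]
  · rfl

/-- The lower bound for the variance of a design, and the case of equality. -/
theorem IsDesign.lower_bound {ξ : Measure ℝ} (hξ : IsDesign T ξ) (hgc : Continuous g)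
    (hg : ∀ t, 0 ≤ g t) (hα : 0 < α) (hα1 : α ≤ 1) {Q : ℝ → ℝ} {K : ℝ} (hK : 0 < K)
    (hQ : ∀ t, 0 < t → Q t = K * t ^ (-α)) {W : ℝ} (hW : 0 < W)
    (hWeq : W = ∫ u in Ioo (0 : ℝ) 1, g (quantile ξ u))
    (hR : ∫⁻ u in Ioo (0 : ℝ) 1, ENNReal.ofReal (g (quantile ξ u)) *
      extendQ Q (deriv (quantile ξ) u) ≠ ⊤) :
    ∃ r s : ℝ, 0 < r ∧ 0 < s ∧ ∫⁻ u in Ioo (0 : ℝ) 1, ENNReal.ofReal (g (quantile ξ u)) *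
        extendQ Q (deriv (quantile ξ) u) = ENNReal.ofReal (K * r) ∧
      s ^ α * r = (1 + α) * W / 2 ∧
      s * ((1 + α) * W / 2) ≤ levelEnergy g α T ((1 - α) * W / 2) ∧
      (α < 1 → s * ((1 + α) * W / 2) = levelEnergy g α T ((1 - α) * W / 2) →
        ξ = designOf ((Icc (-T) T).indicator
          fun t => levelDensity g α ((1 - α) * W / 2) t / s)) := by
  set a := quantile ξ with ha
  set U : Set ℝ := Ioo 0 1 with hU
  -- Off P the factor `extendQ` is infinite, so finite variance forces g(a) = 0 almost everywhere
  -- there. Jumps and singular growth of a need no separate treatment: only the image of P enters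
  -- the change of variables.
  set P : Set ℝ := U ∩ {u | 0 < deriv a u} with hP
  set σ := (1 - α) * W / 2 with hσdef
  have hσ : 0 ≤ σ := by have : 0 ≤ 1 - α := by linarith
                        positivity
  have hPm : MeasurableSet P :=
    measurableSet_Ioo.inter (measurableSet_lt measurable_const (measurable_deriv a))
  have hPU : P ⊆ U := inter_subset_left
  have haU : AEMeasurable a (volume.restrict U) := hξ.aemeasurable_quantile
  have hga : AEMeasurable (fun u => g (a u)) (volume.restrict U) :=
    hgc.measurable.comp_aemeasurable haU
  have hgaP : AEMeasurable (fun u => g (a u)) (volume.restrict P) :=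
    hga.mono_measure (Measure.restrict_mono hPU le_rfl)
  have hdm : Measurable (deriv a) := measurable_deriv a
  have hder : ∀ u ∈ P, HasDerivAt a (deriv a u) u := fun u hu =>
    (differentiableAt_of_deriv_ne_zero (ne_of_gt hu.2)).hasDerivAt
  have hmono : MonotoneOn a P := hξ.monotoneOn_quantile.mono hPU
  have haP : a '' P ⊆ Icc (-T) T := by
    rintro _ ⟨u, hu, rfl⟩; exact hξ.quantile_mem (hPU hu)
  have haPm : MeasurableSet (a '' P) := hPm.image_of_monotoneOn hmono
  rw [extendQ_eq hQ] at hR ⊢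
  -- the integrand vanishes outside `P`
  have hzero : ∀ᵐ u, u ∈ U \ P → g (a u) = 0 := by
    have hmeas : AEMeasurable (fun u => ENNReal.ofReal (g (a u)) *
        (if 0 < deriv a u then ENNReal.ofReal (K * deriv a u ^ (-α)) else ⊤))
        (volume.restrict U) := by
      refine hga.ennreal_ofReal.mul (Measurable.aemeasurable ?_)
      exact Measurable.ite (measurableSet_lt measurable_const hdm) (by fun_prop) measurable_const
    have h1 := (ae_restrict_iff' measurableSet_Ioo).1 (ae_lt_top' hmeas hR)
    filter_upwards [h1] with u hu hmem
    have hd : ¬ 0 < deriv a u := fun h => hmem.2 ⟨hmem.1, h⟩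
    have h2 := hu hmem.1
    rw [if_neg hd] at h2
    by_contra hne
    rw [ENNReal.mul_top (by
      simpa using lt_of_le_of_ne (hg (a u)) (Ne.symm hne))] at h2
    exact lt_irrefl _ h2
  have hRP : ∫⁻ u in U, ENNReal.ofReal (g (a u)) *
      (if 0 < deriv a u then ENNReal.ofReal (K * deriv a u ^ (-α)) else ⊤)
      = ∫⁻ u in P, ENNReal.ofReal (K * (g (a u) * deriv a u ^ (-α))) := by
    rw [← inter_union_sdiff U P, inter_eq_self_of_subset_right hPU,
      lintegral_union (measurableSet_Ioo.diff hPm) disjoint_sdiff_right]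
    have h1 : ∫⁻ u in U \ P, ENNReal.ofReal (g (a u)) *
        (if 0 < deriv a u then ENNReal.ofReal (K * deriv a u ^ (-α)) else ⊤) = 0 := by
      rw [setLIntegral_congr_fun_ae (g := fun _ => 0) (measurableSet_Ioo.diff hPm) ?_]
      · simp
      · filter_upwards [hzero] with u hu hmem
        rw [hu hmem]; simp
    rw [h1, add_zero]
    refine setLIntegral_congr_fun hPm fun u hu => ?_
    have hd : 0 < deriv a u := hu.2
    rw [if_pos hd, ← ENNReal.ofReal_mul (hg _)]
    congr 1
    ring
  have hnn : ∀ u ∈ P, 0 ≤ g (a u) * deriv a u ^ (-α) := fun u hu =>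
    mul_nonneg (hg _) (Real.rpow_nonneg (le_of_lt hu.2) _)
  have hrm : AEStronglyMeasurable (fun u => g (a u) * deriv a u ^ (-α)) (volume.restrict P) :=
    (hgaP.mul (hdm.pow_const _).aemeasurable).aestronglyMeasurable
  have hri : IntegrableOn (fun u => g (a u) * deriv a u ^ (-α)) P := by
    have h1 : IntegrableOn (fun u => K * (g (a u) * deriv a u ^ (-α))) P := by
      refine ⟨hrm.const_mul K, ?_⟩
      rw [hasFiniteIntegral_iff_ofReal]
      · rw [← hRP]; exact hR.lt_top
      · filter_upwards [ae_restrict_mem hPm] with u hu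
        exact mul_nonneg hK.le (hnn u hu)
    have := h1.const_mul K⁻¹
    refine this.congr (Eventually.of_forall fun u => ?_)
    simp only
    field_simp
  set r := ∫ u in P, g (a u) * deriv a u ^ (-α) with hr
  have hRr : ∫⁻ u in P, ENNReal.ofReal (K * (g (a u) * deriv a u ^ (-α)))
      = ENNReal.ofReal (K * r) := by
    rw [hr, ← integral_const_mul, ofReal_integral_eq_lintegral_ofReal (hri.const_mul K)]
    filter_upwards [ae_restrict_mem hPm] with u hu
    exact mul_nonneg hK.le (hnn u hu)
  have hWP : W = ∫ u in P, g (a u) := by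
    rw [hWeq]
    exact setIntegral_eq_of_subset_of_ae_sdiff_eq_zero measurableSet_Ioo.nullMeasurableSet hPU hzero
  have hgi : IntegrableOn (fun u => g (a u)) P :=
    Integrable.of_integral_ne_zero (by rw [← hWP]; exact hW.ne')
  have hr0 : 0 < r := by
    refine lt_of_le_of_ne (setIntegral_nonneg hPm hnn) fun h => hW.ne' ?_
    have h1 := (setIntegral_eq_zero_iff_of_nonneg_ae
      (by filter_upwards [ae_restrict_mem hPm] with u hu using hnn u hu) hri).1 h.symm
    rw [hWP]
    refine (setIntegral_eq_zero_iff_of_nonneg_ae (Eventually.of_forall fun u => hg _) hgi).2 ?_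
    filter_upwards [h1, ae_restrict_mem hPm] with u hu hmem
    have : 0 < deriv a u ^ (-α) := Real.rpow_pos_of_pos hmem.2 _
    exact (mul_eq_zero.1 hu).resolve_right this.ne'
  -- The density at a(u) is compared with q_σ through s/a'(u). This s minimizes s^(1+α) r - (1+α) s
  -- (1+α)W/2, so it extracts the best bound from the family of tangent inequalities.
  set s := ((1 + α) * W / (2 * r)) ^ (1 / α) with hs
  have hs0 : 0 < s := by positivity
  have hsα : s ^ α * r = (1 + α) * W / 2 := by
    rw [hs, ← Real.rpow_mul (by positivity), one_div_mul_cancel hα.ne', Real.rpow_one]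
    field_simp
  have hs1 : s ^ (1 + α) * r = s * ((1 + α) * W / 2) := by
    rw [Real.rpow_add hs0, Real.rpow_one, mul_assoc, hsα]
  -- the change of variables
  have hGi := integrableOn_mul_levelDensity_rpow (T := T) hgc hg hα hσ
  have hGiP := (integrableOn_image_iff_integrableOn_deriv_smul_of_monotoneOn hPm
    (fun u hu => (hder u hu).hasDerivWithinAt) hmono _).1 (hGi.mono_set haP)
  have hGP := integral_image_eq_integral_deriv_smul_of_monotoneOn hPm
    (fun u hu => (hder u hu).hasDerivWithinAt) hmono
    (fun t => g t * levelDensity g α σ t ^ (1 + α))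
  simp only [smul_eq_mul] at hGiP hGP
  have hGnn : ∀ t, 0 ≤ g t * levelDensity g α σ t ^ (1 + α) := fun t =>
    mul_nonneg (hg t) (Real.rpow_nonneg (levelDensity_nonneg t) _)
  have hGle : ∫ t in a '' P, g t * levelDensity g α σ t ^ (1 + α) ≤ levelEnergy g α T σ :=
    setIntegral_mono_set hGi (Eventually.of_forall hGnn) haP.eventuallyLE
  -- the pointwise inequality
  set J : ℝ → ℝ := fun u => s ^ (1 + α) * (g (a u) * deriv a u ^ (-α))
    - (1 + α) * s * (g (a u) - σ)
    + α * (deriv a u * (g (a u) * levelDensity g α σ (a u) ^ (1 + α))) with hJ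
  have hJeq : ∀ u ∈ P, J u = deriv a u * (g (a u) * (s / deriv a u) ^ (1 + α)
      - (1 + α) * (g (a u) - σ) * (s / deriv a u)
      + α * (g (a u) * levelDensity g α σ (a u) ^ (1 + α))) := fun u hu => by
    have hd : 0 < deriv a u := hu.2
    have hdα : 0 < deriv a u ^ α := by positivity
    rw [Real.div_rpow hs0.le hd.le, Real.rpow_add hd, Real.rpow_one, hJ]
    simp only
    rw [Real.rpow_neg hd.le]
    field_simp
  have hJnn : ∀ u ∈ P, 0 ≤ J u := fun u hu => by
    have hd : 0 < deriv a u := hu.2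
    rw [hJeq u hu]
    exact mul_nonneg hd.le (levelDensity_tangent hg hα hσ (a u) (by positivity))
  have hPfin : volume P ≠ ⊤ :=
    ne_top_of_le_ne_top (by simp [hU]) (measure_mono hPU)
  have hconst : IntegrableOn (fun _ : ℝ => σ) P := integrableOn_const hPfin
  have hi1 : IntegrableOn (fun u => s ^ (1 + α) * (g (a u) * deriv a u ^ (-α))) P :=
    hri.const_mul _
  have hi2 : IntegrableOn (fun u => (1 + α) * s * (g (a u) - σ)) P :=
    (hgi.sub hconst).const_mul _
  have hi12 : IntegrableOn (fun u => s ^ (1 + α) * (g (a u) * deriv a u ^ (-α))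
      - (1 + α) * s * (g (a u) - σ)) P := hi1.sub hi2
  have hi3 : IntegrableOn (fun u => α * (deriv a u *
      (g (a u) * levelDensity g α σ (a u) ^ (1 + α)))) P := hGiP.const_mul α
  have hJi : IntegrableOn J P := hi12.add hi3
  have hJint : ∫ u in P, J u = s * ((1 + α) * W / 2) - (1 + α) * s * (W - σ * volume.real P)
      + α * ∫ t in a '' P, g t * levelDensity g α σ t ^ (1 + α) := by
    rw [hJ, integral_add hi12 hi3, integral_sub hi1 hi2, integral_const_mul,
      integral_const_mul, integral_const_mul, integral_sub hgi hconst, ← hWP, ← hr, hs1, hGP,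
      setIntegral_const, smul_eq_mul, mul_comm (volume.real P)]
  have hm1 : volume.real P ≤ 1 := by
    have h1 : volume.real P ≤ volume.real U := measureReal_mono hPU (by simp [hU])
    simpa [hU] using h1
  have hJ0 : 0 ≤ ∫ u in P, J u := setIntegral_nonneg hPm hJnn
  -- The choice σ = (1-α)W/2 makes W - σ equal to s^α r. The integral of J then collapses to α times
  -- the desired difference minus a slack that measures the complement of P.
  have hWσ : W - σ = (1 + α) * W / 2 := by rw [hσdef]; ring
  have hslack : 0 ≤ (1 + α) * s * σ * (1 - volume.real P) := by
    have : 0 ≤ 1 - volume.real P := by linarith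
    positivity
  have hJint2 : ∫ u in P, J u = α * ((∫ t in a '' P, g t * levelDensity g α σ t ^ (1 + α))
      - s * ((1 + α) * W / 2)) - (1 + α) * s * σ * (1 - volume.real P) := by
    rw [hJint]
    have : W - σ * volume.real P = (1 + α) * W / 2 + σ * (1 - volume.real P) := by
      rw [← hWσ]; ring
    rw [this]; ring
  have hineq : s * ((1 + α) * W / 2) ≤ ∫ t in a '' P, g t * levelDensity g α σ t ^ (1 + α) := by
    by_contra hc
    have := mul_neg_of_pos_of_neg hα (sub_neg.2 (not_le.1 hc))
    linarith
  refine ⟨r, s, hr0, hs0, by rw [hRP, hRr], hsα, hineq.trans hGle, fun hαlt heq => ?_⟩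
  -- the case of equality
  have hσ0 : 0 < σ := by
    have : 0 < 1 - α := by linarith
    positivity
  have hGeq : ∫ t in a '' P, g t * levelDensity g α σ t ^ (1 + α) = levelEnergy g α T σ :=
    le_antisymm hGle (heq ▸ hineq)
  have hJz : ∫ u in P, J u = 0 := by
    refine le_antisymm ?_ hJ0
    rw [hJint2, hGeq, heq]; linarith
  -- Equality leaves only the slack, whose factor σ is positive for α < 1, so P has full measure.
  have hm : volume.real P = 1 := by
    rw [hJint2, hGeq, heq] at hJz
    have h1 : (1 + α) * s * σ * (1 - volume.real P) = 0 := by linarith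
    have h2 : (1 + α) * s * σ ≠ 0 := by positivity
    have := (mul_eq_zero.1 h1).resolve_left h2
    linarith
  have hPU' : P =ᵐ[volume] U := by
    refine ae_eq_of_subset_of_measure_ge hPU ?_ hPm.nullMeasurableSet (by simp [hU])
    have h1 : volume U = 1 := by simp [hU]
    have h2 : volume P = 1 := by
      rw [← ENNReal.toReal_eq_one_iff]; exact hm
    rw [h1, h2]
  have hd : ∀ᵐ u ∂(volume.restrict P), deriv a u * (levelDensity g α σ (a u) / s) = 1 := by
    have h1 := (setIntegral_eq_zero_iff_of_nonneg_ae
      (by filter_upwards [ae_restrict_mem hPm] with u hu using hJnn u hu) hJi).1 hJz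
    filter_upwards [h1, ae_restrict_mem hPm] with u hu hmem
    have hdpos : 0 < deriv a u := hmem.2
    rw [hJeq u hmem] at hu
    have h2 := eq_levelDensity_of_tangent hg hα hσ0 (div_pos hs0 hdpos)
      ((mul_eq_zero.1 hu).resolve_left hdpos.ne')
    rw [← h2]
    field_simp
  -- Equality of the energies over a(P) and over the interval means that q_σ charges nothing outside
  -- a(P), so the density found on a(P) is the whole density.
  have hout : ∀ᵐ t, t ∈ Icc (-T) T \ a '' P → levelDensity g α σ t = 0 := by
    have h1 : ∫ t in Icc (-T) T \ a '' P, g t * levelDensity g α σ t ^ (1 + α) = 0 := by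
      rw [setIntegral_sdiff haPm hGi haP, hGeq, levelEnergy, sub_self]
    have h2 := (setIntegral_eq_zero_iff_of_nonneg_ae (Eventually.of_forall hGnn)
      (hGi.mono_set sdiff_subset)).1 h1
    filter_upwards [(ae_restrict_iff' (measurableSet_Icc.diff haPm)).1 h2] with t ht hmem
    rcases mul_eq_zero.1 (ht hmem) with h3 | h3
    · exact levelDensity_eq_zero h3
    · exact (Real.rpow_eq_zero (levelDensity_nonneg t) (by positivity)).1 h3
  ext E hE
  have hξE : ξ E = ∫⁻ u in P, E.indicator 1 (a u) := by
    rw [Measure.restrict_congr_set hPU',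
      hξ.lintegral_quantile (measurable_one.indicator hE).aemeasurable, lintegral_indicator_one hE]
  rw [hξE, designOf, withDensity_apply _ hE]
  have h1 : ∫⁻ u in P, E.indicator 1 (a u)
      = ∫⁻ u in P, ENNReal.ofReal (deriv a u) *
        (E.indicator (fun t => ENNReal.ofReal (levelDensity g α σ t / s)) (a u)) := by
    refine lintegral_congr_ae ?_
    filter_upwards [hd, ae_restrict_mem hPm] with u hu hmem
    by_cases hE' : a u ∈ E
    · rw [indicator_of_mem hE', indicator_of_mem hE', ← ENNReal.ofReal_mul (le_of_lt hmem.2), hu,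
        ENNReal.ofReal_one, Pi.one_apply]
    · rw [indicator_of_notMem hE', indicator_of_notMem hE', mul_zero]
  rw [h1, ← lintegral_image_eq_lintegral_deriv_mul_of_monotoneOn hPm
    (fun u hu => (hder u hu).hasDerivWithinAt) hmono, ← lintegral_indicator haPm,
    ← lintegral_indicator hE]
  refine lintegral_congr_ae ?_
  filter_upwards [hout] with t ht
  by_cases hE' : t ∈ E
  · by_cases hP' : t ∈ a '' P
    · simp only [indicator_of_mem hP', indicator_of_mem hE', indicator_of_mem (haP hP')]
    · rw [indicator_of_notMem hP', indicator_of_mem hE']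
      by_cases hI : t ∈ Icc (-T) T
      · rw [indicator_of_mem hI, ht ⟨hI, hP'⟩]; simp
      · rw [indicator_of_notMem hI]; simp
  · rw [indicator_of_notMem hE']
    by_cases hP' : t ∈ a '' P
    · rw [indicator_of_mem hP', indicator_of_notMem hE']
    · rw [indicator_of_notMem hP']

end Bound


/-! ### Optimization over the level -/

section OptimalLevel

variable {g : ℝ → ℝ} {α T : ℝ}

/-- The point t₀ may be an endpoint, so it is approached from the open interval. -/
theorem volume_superlevel_pos (hgc : Continuous g) (hT : 0 < T) {t₀ c : ℝ}
    (ht₀ : t₀ ∈ Icc (-T) T) (hc : c < g t₀) : 0 < volume (Icc (-T) T ∩ {t | c < g t}) := by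
  have ho : IsOpen {t | c < g t} := isOpen_lt continuous_const hgc
  have hcl : t₀ ∈ closure (Ioo (-T) T) := by
    rwa [closure_Ioo (by linarith : -T < T).ne]
  have hne : ({t | c < g t} ∩ Ioo (-T) T).Nonempty := mem_closure_iff.1 hcl _ ho hc
  refine ((ho.inter isOpen_Ioo).measure_pos volume hne).trans_le (measure_mono ?_)
  exact fun x hx => ⟨Ioo_subset_Icc_self hx.2, hx.1⟩

theorem levelEnergy_nonneg (hg : ∀ t, 0 ≤ g t) (σ : ℝ) : 0 ≤ levelEnergy g α T σ :=
  integral_nonneg fun t => mul_nonneg (hg t) (Real.rpow_nonneg (levelDensity_nonneg t) _)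

theorem levelEnergy_pos (hgc : Continuous g) (hg : ∀ t, 0 ≤ g t) (hα : 0 < α) (hT : 0 < T)
    {t₀ σ : ℝ} (ht₀ : t₀ ∈ Icc (-T) T) (hσ : 0 ≤ σ) (hσt : σ < g t₀) :
    0 < levelEnergy g α T σ := by
  refine (setIntegral_pos_iff_support_of_nonneg_ae (Eventually.of_forall fun t =>
    mul_nonneg (hg t) (Real.rpow_nonneg (levelDensity_nonneg t) _))
    (integrableOn_mul_levelDensity_rpow hgc hg hα hσ)).2 ?_
  refine (volume_superlevel_pos hgc hT ht₀ hσt).trans_le (measure_mono ?_)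
  rintro t ⟨ht, h⟩
  have h : σ < g t := h
  have hgt : 0 < g t := hσ.trans_lt h
  refine ⟨?_, ht⟩
  have : σ / g t < 1 := (div_lt_one hgt).2 h
  have h1 : 0 < levelDensity g α σ t := by
    rw [levelDensity, if_neg hgt.ne']
    exact Real.rpow_pos_of_pos (lt_max_of_lt_right (by linarith)) _
  exact (mul_pos hgt (Real.rpow_pos_of_pos h1 _)).ne'

theorem levelEnergy_eq_zero (hg : ∀ t, 0 ≤ g t) (hα : 0 < α) {σ : ℝ}
    (hσ : ∀ t ∈ Icc (-T) T, g t ≤ σ) : levelEnergy g α T σ = 0 := by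
  refine setIntegral_eq_zero_of_forall_eq_zero fun t ht => ?_
  by_cases h : g t = 0
  · rw [h, zero_mul]
  · have hgt : 0 < g t := lt_of_le_of_ne (hg t) (Ne.symm h)
    have : 1 ≤ σ / g t := (one_le_div hgt).2 (hσ t ht)
    rw [levelDensity, if_neg h, max_eq_left (by linarith), Real.zero_rpow (by positivity),
      Real.zero_rpow (by positivity), mul_zero]

theorem continuousOn_levelEnergy (hgc : Continuous g) (hg : ∀ t, 0 ≤ g t) (hα : 0 < α) :
    ContinuousOn (levelEnergy g α T) (Ici 0) := by
  refine continuousOn_of_dominated (bound := g)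
    (fun σ hσ => (integrableOn_mul_levelDensity_rpow hgc hg hα hσ).aestronglyMeasurable)
    (fun σ hσ => Eventually.of_forall fun t => ?_) hgc.integrableOn_Icc
    (Eventually.of_forall fun t => Continuous.continuousOn ?_)
  · rw [Real.norm_of_nonneg (mul_nonneg (hg t) (Real.rpow_nonneg (levelDensity_nonneg t) _))]
    exact mul_le_of_le_one_right (hg t) (Real.rpow_le_one (levelDensity_nonneg t)
      (levelDensity_le_one hg hα hσ t) (by positivity))
  · by_cases h : g t = 0
    · simp only [h, zero_mul]; exact continuous_const
    · simp only [levelDensity, if_neg h]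
      refine continuous_const.mul (Continuous.rpow_const (Continuous.rpow_const ?_
        fun _ => Or.inr (by positivity)) fun _ => Or.inr (by positivity))
      fun_prop

/-- A supporting line of A at σ, with slope -(1+α)/α ∫ q_σ: the pointwise inequality at level σ' is
tested with x = q_σ and integrated. -/
theorem levelEnergy_tangent (hgc : Continuous g) (hg : ∀ t, 0 ≤ g t) (hα : 0 < α) {σ σ' : ℝ}
    (hσ : 0 ≤ σ) (hσ' : 0 ≤ σ') :
    levelEnergy g α T σ + (1 + α) / α * (σ - σ') * (∫ t in Icc (-T) T, levelDensity g α σ t)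
      ≤ levelEnergy g α T σ' := by
  have i1 := integrableOn_mul_levelDensity_rpow (T := T) hgc hg hα hσ
  have i2 := integrableOn_mul_levelDensity (T := T) hgc hg hα hσ
  have i3 := integrableOn_levelDensity (T := T) hgc hg hα hσ
  have i4 := integrableOn_mul_levelDensity_rpow (T := T) hgc hg hα hσ'
  have h : 0 ≤ ∫ t in Icc (-T) T, (g t * levelDensity g α σ t ^ (1 + α)
      - ((1 + α) * (g t * levelDensity g α σ t) - (1 + α) * σ' * levelDensity g α σ t)
      + α * (g t * levelDensity g α σ' t ^ (1 + α))) := by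
    refine integral_nonneg fun t => (levelDensity_tangent hg hα hσ' t
      (levelDensity_nonneg (g := g) (α := α) (σ := σ) t)).trans (le_of_eq ?_)
    ring
  have j2 := i2.const_mul (1 + α)
  have j3 := i3.const_mul ((1 + α) * σ')
  rw [integral_add (by exact i1.sub (j2.sub j3)) (by exact i4.const_mul α),
    integral_sub (by exact i1) (by exact j2.sub j3), integral_sub (by exact j2) (by exact j3),
    integral_const_mul, integral_const_mul, integral_const_mul] at h
  have e := levelEnergy_eq (T := T) hgc hg hα hσ
  have e1 : levelEnergy g α T σ = ∫ t in Icc (-T) T, g t * levelDensity g α σ t ^ (1 + α) := rfl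
  have e2 : levelEnergy g α T σ' = ∫ t in Icc (-T) T, g t * levelDensity g α σ' t ^ (1 + α) := rfl
  rw [← e1, ← e2] at h
  have e3 : (∫ t in Icc (-T) T, g t * levelDensity g α σ t) = levelEnergy g α T σ
    + σ * ∫ t in Icc (-T) T, levelDensity g α σ t := by linarith
  rw [e3] at h
  have : (1 + α) / α * (σ - σ') * (∫ t in Icc (-T) T, levelDensity g α σ t)
    = ((1 + α) * (σ - σ') * (∫ t in Icc (-T) T, levelDensity g α σ t)) / α := by ring
  rw [this, ← le_sub_iff_add_le', div_le_iff₀ hα]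
  linarith

/-- Differentiability of A is avoided: its supporting line lies below A and touches it at σ, so
replacing A by the line keeps the local maximum. The logarithm of that explicit function has zero
derivative there. -/
theorem levelEnergy_stationary (hgc : Continuous g) (hg : ∀ t, 0 ≤ g t) (hα : 0 < α)
    {σ : ℝ} (hσ : 0 < σ) (hA : 0 < levelEnergy g α T σ)
    (hmax : ∀ᶠ x in 𝓝 σ, x ^ (1 - α) * levelEnergy g α T x ^ α
      ≤ σ ^ (1 - α) * levelEnergy g α T σ ^ α) :
    (1 - α) * levelEnergy g α T σ
      = (1 + α) * σ * ∫ t in Icc (-T) T, levelDensity g α σ t := by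
  set A := levelEnergy g α T σ with hAdef
  set B := ∫ t in Icc (-T) T, levelDensity g α σ t with hB
  set k : ℝ := (1 + α) / α * B with hk
  have hd : HasDerivAt (fun x => (1 - α) * Real.log x + α * Real.log (A + k * (σ - x)))
      ((1 - α) * σ⁻¹ + α * ((k * (-1)) / A)) σ := by
    have h1 : HasDerivAt (fun x => A + k * (σ - x)) (k * (-1)) σ :=
      (((hasDerivAt_id σ).const_sub σ).const_mul k).const_add A
    have h2 := h1.log (by simpa using hA.ne')
    simp only [sub_self, mul_zero, add_zero] at h2
    exact ((Real.hasDerivAt_log hσ.ne').const_mul _).add (h2.const_mul _)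
  have hl : IsLocalMax (fun x => (1 - α) * Real.log x + α * Real.log (A + k * (σ - x))) σ := by
    have hc : ∀ᶠ x in 𝓝 σ, 0 < A + k * (σ - x) := by
      have : ContinuousAt (fun x => A + k * (σ - x)) σ := by fun_prop
      exact this.eventually_const_lt (by simpa using hA)
    filter_upwards [hmax, hc, eventually_gt_nhds hσ] with x h1 h2 h3
    have h4 : A + k * (σ - x) ≤ levelEnergy g α T x := by
      refine le_trans (le_of_eq ?_) (levelEnergy_tangent hgc hg hα hσ.le h3.le)
      rw [← hAdef, ← hB, hk]; ring
    have h5 : x ^ (1 - α) * (A + k * (σ - x)) ^ α ≤ σ ^ (1 - α) * A ^ α :=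
      le_trans (by gcongr) h1
    have h6 := Real.log_le_log (by positivity) h5
    rw [Real.log_mul (by positivity) (by positivity), Real.log_mul (by positivity) (by positivity),
      Real.log_rpow h3, Real.log_rpow h2, Real.log_rpow hσ, Real.log_rpow hA] at h6
    simpa using h6
  have h0 := hl.hasDerivAt_eq_zero hd
  rw [hk] at h0
  field_simp at h0
  linarith

/-- Combined with A = ∫ g q_σ - σ ∫ q_σ, stationarity becomes ∫ g q_σ = W ∫ q_σ for W = 2σ/(1-α),
the consistency condition on W. The range W' ≤ G suffices because the mean of g under a design
cannot exceed G. -/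
theorem exists_optimal_level (hgc : Continuous g) (hg : ∀ t, 0 ≤ g t) (hα : 0 < α)
    (hα1 : α ≤ 1) (hT : 0 < T) {t₀ : ℝ} (ht₀ : t₀ ∈ Icc (-T) T) (hgt : 0 < g t₀) {G : ℝ}
    (hG : ∀ t ∈ Icc (-T) T, g t ≤ G) :
    ∃ W : ℝ, 0 < W ∧ 0 < ∫ t in Icc (-T) T, levelDensity g α ((1 - α) * W / 2) t ∧
      (∫ t in Icc (-T) T, g t * levelDensity g α ((1 - α) * W / 2) t)
        = W * ∫ t in Icc (-T) T, levelDensity g α ((1 - α) * W / 2) t ∧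
      ∀ W', 0 < W' → W' ≤ G → W' ^ (1 - α) * levelEnergy g α T ((1 - α) * W' / 2) ^ α
        ≤ W ^ (1 - α) * levelEnergy g α T ((1 - α) * W / 2) ^ α := by
  have hG0 : 0 < G := hgt.trans_le (hG t₀ ht₀)
  -- For α = 1 the level is zero and the objective does not depend on W, so W is simply read off
  -- from the consistency condition.
  rcases hα1.eq_or_lt with rfl | hα1
  · set C := ∫ t in Icc (-T) T, g t * levelDensity g 1 0 t with hC
    set B := ∫ t in Icc (-T) T, levelDensity g 1 0 t with hB
    have hA := levelEnergy_pos hgc hg one_pos hT ht₀ le_rfl hgt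
    rw [levelEnergy_eq hgc hg one_pos le_rfl, zero_mul, sub_zero, ← hC] at hA
    have hCB : C ≤ G * B := by
      rw [hC, hB, ← integral_const_mul]
      refine setIntegral_mono_on (integrableOn_mul_levelDensity hgc hg one_pos le_rfl)
        ((integrableOn_levelDensity hgc hg one_pos le_rfl).const_mul G) measurableSet_Icc
        fun t ht => ?_
      exact mul_le_mul_of_nonneg_right (hG t ht) (levelDensity_nonneg t)
    have hB0 : 0 < B := by
      by_contra hc
      have := mul_nonpos_of_nonneg_of_nonpos hG0.le (not_lt.1 hc)
      linarith
    refine ⟨C / B, by positivity, ?_⟩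
    simp only [sub_self, zero_mul, zero_div, ← hB, ← hC, Real.rpow_zero, Real.rpow_one]
    refine ⟨hB0, by field_simp, fun _ _ _ => le_rfl⟩
  · have h1α : 0 < 1 - α := by linarith
    -- The variable is σ rather than W. The objective vanishes at σ = 0 and at σ = G, where A(G) =
    -- 0, so its maximum is interior; the interval contains every (1-α)W'/2 with 0 < W' ≤ G.
    set Φ : ℝ → ℝ := fun x => x ^ (1 - α) * levelEnergy g α T x ^ α with hΦ
    have hcont : ContinuousOn Φ (Icc 0 G) := by
      refine ContinuousOn.mul (continuousOn_id.rpow_const fun _ _ => Or.inr h1α.le) ?_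
      exact ((continuousOn_levelEnergy hgc hg hα).mono Icc_subset_Ici_self).rpow_const
        fun _ _ => Or.inr hα.le
    obtain ⟨σ, hσ, hmax⟩ := isCompact_Icc.exists_isMaxOn ⟨0, left_mem_Icc.2 hG0.le⟩ hcont
    have hpos : 0 < Φ (g t₀ / 2) := mul_pos (by positivity)
      (Real.rpow_pos_of_pos (levelEnergy_pos hgc hg hα hT ht₀ (by positivity)
        (half_lt_self hgt)) _)
    have hle : Φ (g t₀ / 2) ≤ Φ σ := hmax ⟨by positivity, by linarith [hG t₀ ht₀]⟩
    have hΦσ : 0 < Φ σ := hpos.trans_le hle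
    have hσ0 : 0 < σ := by
      refine lt_of_le_of_ne hσ.1 fun h => ?_
      rw [← h] at hΦσ
      simp [hΦ, Real.zero_rpow h1α.ne'] at hΦσ
    have hA : 0 < levelEnergy g α T σ := by
      refine lt_of_le_of_ne (levelEnergy_nonneg hg σ) fun h => ?_
      simp [hΦ, ← h, Real.zero_rpow hα.ne'] at hΦσ
    have hσG : σ < G := by
      refine lt_of_le_of_ne hσ.2 fun h => ?_
      rw [h, levelEnergy_eq_zero hg hα hG] at hA
      exact hA.false
    have hst := levelEnergy_stationary hgc hg hα hσ0 hA (by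
      filter_upwards [Icc_mem_nhds hσ0 hσG] with x hx using hmax hx)
    have hW : (1 - α) * (2 * σ / (1 - α)) / 2 = σ := by field_simp
    have hB : 0 < ∫ t in Icc (-T) T, levelDensity g α σ t := by
      have : 0 < (1 + α) * σ * ∫ t in Icc (-T) T, levelDensity g α σ t := by
        rw [← hst]; positivity
      exact pos_of_mul_pos_right this (by positivity)
    refine ⟨2 * σ / (1 - α), by positivity, ?_⟩
    rw [hW]
    refine ⟨hB, ?_, fun W' h0 h1 => ?_⟩
    · have e := levelEnergy_eq (T := T) hgc hg hα hσ0.le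
      field_simp
      linear_combination hst - (1 - α) * e
    · have h2 : Φ ((1 - α) * W' / 2) ≤ Φ σ := by
        refine hmax ⟨by positivity, ?_⟩
        nlinarith
      simp only [hΦ] at h2
      have e1 : ∀ x : ℝ, 0 < x → x ^ (1 - α) = ((1 - α) / 2) ^ (1 - α) * (2 * x / (1 - α)) ^ (1 - α) := by
        intro x hx
        rw [← Real.mul_rpow (by positivity) (by positivity)]
        congr 1
        field_simp
      rw [e1 _ hσ0, e1 _ (by positivity), show 2 * ((1 - α) * W' / 2) / (1 - α) = W' by field_simp,
        mul_assoc, mul_assoc] at h2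
      exact le_of_mul_le_mul_left h2 (by positivity)

end OptimalLevel


/-! ### The criterion for densities as a variance -/

section Criterion

variable {f g Q : ℝ → ℝ} {α K T : ℝ}

theorem IsDesign.designW_eq {ξ : Measure ℝ} (hξ : IsDesign T ξ)
    (hgf : ∀ t ∈ Icc (-T) T, g t = f t ^ 2) :
    designW f (quantile ξ) = ∫⁻ u in Ioo (0 : ℝ) 1, ENNReal.ofReal (g (quantile ξ u)) :=
  setLIntegral_congr_fun measurableSet_Ioo fun u hu => by
    simp only [hgf _ (hξ.quantile_mem hu)]

theorem IsDesign.designR_eq {ξ : Measure ℝ} (hξ : IsDesign T ξ)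
    (hgf : ∀ t ∈ Icc (-T) T, g t = f t ^ 2) :
    designR f Q (quantile ξ) = ∫⁻ u in Ioo (0 : ℝ) 1, ENNReal.ofReal (g (quantile ξ u)) *
      extendQ Q (deriv (quantile ξ) u) :=
  setLIntegral_congr_fun measurableSet_Ioo fun u hu => by
    simp only [hgf _ (hξ.quantile_mem hu)]

theorem IsAdmissible.integral_pos {p : ℝ → ℝ} (hp : IsAdmissible f T p) :
    0 < ∫ t in Icc (-T) T, p t := by
  have h0 : 0 ≤ᵐ[volume.restrict (Icc (-T) T)] p := by
    filter_upwards [ae_restrict_mem measurableSet_Icc] with t ht using hp.1 t ht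
  refine lt_of_le_of_ne (integral_nonneg_of_ae h0) fun h => ?_
  have h1 := (integral_eq_zero_iff_of_nonneg_ae h0 hp.2.1).1 h.symm
  have h2 : ∫ t in Icc (-T) T, f t ^ 2 * p t = 0 := by
    refine integral_eq_zero_of_ae ?_
    filter_upwards [h1] with t ht
    simp only [Pi.zero_apply] at ht ⊢
    rw [ht, mul_zero]
  exact hp.2.2.ne' h2

theorem lintegral_designOf {q : ℝ → ℝ} (hq : AEMeasurable q) (h : ℝ → ℝ≥0∞) :
    ∫⁻ t, h t ∂(designOf q) = ∫⁻ t, ENNReal.ofReal (q t) * h t :=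
  lintegral_withDensity_eq_lintegral_mul_non_measurable₀ _ hq.ennreal_ofReal
    (Eventually.of_forall fun _ => ENNReal.ofReal_lt_top) _

/-- The criterion for densities is the asymptotic variance of the normalized density. -/
theorem IsAdmissible.asympVariance_designOf (hgc : Continuous g) (hg : ∀ t, 0 ≤ g t)
    (hgf : ∀ t ∈ Icc (-T) T, g t = f t ^ 2) (hQ : ∀ t, 0 < t → Q t = K * t ^ (-α))
    {p : ℝ → ℝ} (hp : IsAdmissible f T p) :
    IsDesign T (designOf ((Icc (-T) T).indicator fun t => p t / ∫ s in Icc (-T) T, p s)) ∧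
      asympVariance f Q
        (designOf ((Icc (-T) T).indicator fun t => p t / ∫ s in Icc (-T) T, p s))
        = densityCriterion f Q T p := by
  have hB := hp.integral_pos
  obtain ⟨hp0, hpi, hM⟩ := hp
  rw [densityCriterion]
  set B := ∫ s in Icc (-T) T, p s with hBdef
  set M := ∫ t in Icc (-T) T, f t ^ 2 * p t with hMdef
  set q : ℝ → ℝ := (Icc (-T) T).indicator fun t => p t / B with hq
  have hqi : Integrable q := (integrable_indicator_iff measurableSet_Icc).2 (hpi.div_const B)
  have hq0 : ∀ x, 0 ≤ q x := fun x => indicator_nonneg (fun t ht => div_nonneg (hp0 t ht) hB.le) x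
  have hq1 : ∫ x, q x = 1 := by
    rw [hq, integral_indicator measurableSet_Icc, integral_div, ← hBdef, div_self hB.ne']
  have hd : IsDesign T (designOf q) :=
    isDesign_designOf hqi hq0 (fun x hx => indicator_of_notMem hx _) hq1
  refine ⟨hd, ?_⟩
  have hqm : AEMeasurable q := hqi.aestronglyMeasurable.aemeasurable
  have hgm : Measurable fun t => ENNReal.ofReal (g t) := hgc.measurable.ennreal_ofReal
  -- A non-integrable function has Bochner integral 0, so M > 0 already gives integrability.
  have hfp : IntegrableOn (fun t => f t ^ 2 * p t) (Icc (-T) T) := by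
    by_contra h
    rw [hMdef, integral_undef h] at hM
    exact hM.false
  have hW : designW f (quantile (designOf q)) = ENNReal.ofReal M * (ENNReal.ofReal B)⁻¹ := by
    rw [hd.designW_eq hgf, hd.lintegral_quantile hgm.aemeasurable, lintegral_designOf hqm,
      ← ENNReal.ofReal_inv_of_pos hB, ← ENNReal.ofReal_mul hM.le, ← div_eq_mul_inv, hMdef,
      ← integral_div, ofReal_integral_eq_lintegral_ofReal (hfp.div_const B),
      ← lintegral_indicator measurableSet_Icc]
    · refine lintegral_congr fun t => ?_
      by_cases ht : t ∈ Icc (-T) T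
      · simp only [hq, indicator_of_mem ht]
        rw [← ENNReal.ofReal_mul (div_nonneg (hp0 t ht) hB.le), hgf t ht]
        congr 1; ring
      · simp only [hq, indicator_of_notMem ht]; simp
    · filter_upwards [ae_restrict_mem measurableSet_Icc] with t ht
      exact div_nonneg (mul_nonneg (sq_nonneg _) (hp0 t ht)) hB.le
  have hR : designR f Q (quantile (designOf q)) = (∫⁻ t in Icc (-T) T,
      ENNReal.ofReal (f t ^ 2 * Q (B / p t) * p t)) * (ENNReal.ofReal B)⁻¹ := by
    have e1 : designR f Q (quantile (designOf q)) = ∫⁻ u in Ioo (0 : ℝ) 1,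
        (fun t => ENNReal.ofReal (g t) * ENNReal.ofReal (K * q t ^ α))
          (quantile (designOf q) u) := by
      rw [hd.designR_eq hgf]
      refine lintegral_congr_ae ?_
      filter_upwards [ae_deriv_quantile_designOf hqi hq0 hd] with u hu
      have hu' : 0 < deriv (quantile (designOf q)) u := by
        rw [hu.2]; exact one_div_pos.2 hu.1
      simp only [extendQ, if_pos hu']
      rw [hQ _ hu', hu.2, one_div, Real.rpow_neg (by positivity [hu.1]), Real.inv_rpow hu.1.le,
        inv_inv]
    have hm : AEMeasurable (fun t => ENNReal.ofReal (g t) * ENNReal.ofReal (K * q t ^ α))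
        (designOf q) := by
      refine AEMeasurable.mono_ac ?_ (designOf_absolutelyContinuous q)
      exact hgm.aemeasurable.mul ((hqm.pow_const α).const_mul K).ennreal_ofReal
    rw [e1, hd.lintegral_quantile hm, lintegral_designOf hqm,
      ← lintegral_mul_const' _ _ (ENNReal.inv_ne_top.2 (ENNReal.ofReal_pos.2 hB).ne'),
      ← lintegral_indicator measurableSet_Icc]
    refine lintegral_congr fun t => ?_
    by_cases ht : t ∈ Icc (-T) T
    · simp only [hq, indicator_of_mem ht]
      have hpt := hp0 t ht
      rw [← ENNReal.ofReal_inv_of_pos hB, ← ENNReal.ofReal_mul (hg t),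
        ← ENNReal.ofReal_mul (div_nonneg hpt hB.le), ← ENNReal.ofReal_mul' (by positivity),
        hgf t ht]
      congr 1
      -- Where p = 0 the value Q(B/0) is meaningless, but the factor p removes it; the other side
      -- vanishes with q.
      rcases hpt.eq_or_lt with h | h
      · rw [← h]; simp
      · rw [hQ _ (by positivity), Real.rpow_neg (by positivity), ← Real.inv_rpow (by positivity),
          inv_div]
        ring
    · simp only [hq, indicator_of_notMem ht]; simp
  have hMp := (ENNReal.ofReal_pos.2 hM).ne'
  have hBp := (ENNReal.ofReal_pos.2 hB).ne'
  have hBt : ENNReal.ofReal B ≠ ⊤ := ENNReal.ofReal_ne_top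
  rw [asympVariance, if_neg, hW, hR]
  · rw [mul_pow, div_eq_mul_inv, div_eq_mul_inv, ENNReal.mul_inv (Or.inl (pow_ne_zero 2 hMp))
      (Or.inl (ENNReal.pow_ne_top ENNReal.ofReal_ne_top)), ENNReal.inv_pow (a := (ENNReal.ofReal B)⁻¹),
      inv_inv, sq (ENNReal.ofReal B)]
    calc _ = (∫⁻ t in Icc (-T) T, ENNReal.ofReal (f t ^ 2 * Q (B / p t) * p t)) *
          ((ENNReal.ofReal B)⁻¹ * ENNReal.ofReal B) * ENNReal.ofReal B *
            (ENNReal.ofReal M ^ 2)⁻¹ := by ring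
      _ = _ := by rw [ENNReal.inv_mul_cancel hBp hBt, mul_one]
  · rw [hW]
    exact mul_ne_zero hMp (ENNReal.inv_ne_zero.2 hBt)

end Criterion

/-! ### The explicit form and the multiplier equations -/

section Multipliers

variable {f g Q : ℝ → ℝ} {α c K T : ℝ}

theorem deriv_eq_of_rpow (hQ : ∀ t, 0 < t → Q t = K * t ^ (-α)) {t : ℝ} (ht : 0 < t) :
    deriv Q t = -α * K * t ^ (-α - 1) := by
  have h1 : Q =ᶠ[𝓝 t] fun s => K * s ^ (-α) := by
    filter_upwards [eventually_gt_nhds ht] with s hs using hQ s hs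
  rw [h1.deriv_eq, ((Real.hasDerivAt_rpow_const (Or.inl ht.ne')).const_mul K).deriv]
  ring

theorem measurableSet_posSet {p : ℝ → ℝ} (hp : Measurable p) : MeasurableSet (posSet T p) :=
  measurableSet_Icc.inter (measurableSet_lt measurable_const hp)

/-- The normalized extremal density at a stationary level has the form of the theorem, with
multipliers that satisfy the two equations. -/
theorem exists_multipliers (hgc : Continuous g) (hg : ∀ t, 0 ≤ g t)
    (hgf : ∀ t ∈ Icc (-T) T, g t = f t ^ 2) (hα : 0 < α) (hα1 : α ≤ 1) (hc : 0 < c)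
    (hK : K = if α < 1 then c / (1 - α) else c) (hQ : ∀ t, 0 < t → Q t = K * t ^ (-α))
    {W B : ℝ} (hW : 0 < W)
    (hB : B = ∫ t in Icc (-T) T, levelDensity g α ((1 - α) * W / 2) t) (hB0 : 0 < B)
    (hC : (∫ t in Icc (-T) T, g t * levelDensity g α ((1 - α) * W / 2) t) = W * B)
    {p : ℝ → ℝ}
    (hp : p = (Icc (-T) T).indicator fun t => levelDensity g α ((1 - α) * W / 2) t / B) :
    ∃ μ τ : ℝ, p = optDensity f α c T μ τ ∧ MultiplierEquations f Q T p μ τ := by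
  have h1α : 0 ≤ 1 - α := by linarith
  have hK0 : 0 < K := by
    rw [hK]; split_ifs with h
    · exact div_pos hc (by linarith)
    · exact hc
  have hfac : (if α < 1 then (1 - α) / (c * (1 + α)) else 1 / (2 * c)) = 1 / (K * (1 + α)) := by
    rw [hK]; split_ifs with h
    · have : 0 < 1 - α := by linarith
      field_simp
    · rw [show α = 1 by linarith]; ring
  set σ := (1 - α) * W / 2 with hσ
  have hσ0 : 0 ≤ σ := by positivity
  have hA := levelEnergy_eq (T := T) hgc hg hα hσ0
  rw [hC, ← hB] at hA
  have hA' : levelEnergy g α T σ = (1 + α) * W * B / 2 := by rw [hA, hσ]; ring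
  have hpI : ∀ t ∈ Icc (-T) T, p t = levelDensity g α σ t / B := fun t ht => by
    rw [hp, indicator_of_mem ht]
  have hpm : Measurable p := by
    rw [hp]; exact ((measurable_levelDensity hgc).div_const B).indicator measurableSet_Icc
  set b := B ^ (-α) with hb
  have hb0 : 0 < b := by positivity
  have hpow : ∀ t, levelDensity g α σ t ^ (1 + α) * (b / B) = (levelDensity g α σ t / B) ^ (1 + α) := by
    intro t
    rw [Real.div_rpow (levelDensity_nonneg t) hB0.le, Real.rpow_add hB0, Real.rpow_one, hb,
      Real.rpow_neg hB0.le]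
    field_simp
  have hsub : posSet T p ⊆ Icc (-T) T := fun t ht => ht.1
  have hms := measurableSet_posSet (T := T) hpm
  have hint : IntegrableOn (fun t => g t * levelDensity g α σ t ^ (1 + α)) (posSet T p) :=
    (integrableOn_mul_levelDensity_rpow hgc hg hα hσ0).mono_set hsub
  have hval : ∫ t in posSet T p, g t * levelDensity g α σ t ^ (1 + α) = (1 + α) * W * B / 2 := by
    rw [← hA', levelEnergy]
    symm
    refine setIntegral_eq_of_subset_of_forall_sdiff_eq_zero measurableSet_Icc hsub fun t ht => ?_
    have h0 : levelDensity g α σ t = 0 := by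
      by_contra hne
      refine ht.2 ⟨ht.1, ?_⟩
      rw [hpI t ht.1]
      exact div_pos (lt_of_le_of_ne (levelDensity_nonneg t) (Ne.symm hne)) hB0
    rw [h0, Real.zero_rpow (by positivity), mul_zero]
  have e1 : EqOn (fun t => (K * (b / B)) * (g t * levelDensity g α σ t ^ (1 + α)))
      (fun t => f t ^ 2 * Q (1 / p t) * p t) (posSet T p) := by
    intro t ht
    have hp0 : 0 < p t := ht.2
    have : K * (b / B) * (g t * levelDensity g α σ t ^ (1 + α))
      = K * (g t * (levelDensity g α σ t ^ (1 + α) * (b / B))) := by ring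
    simp only [this]
    rw [hpow, ← hpI t ht.1, hQ _ (by positivity), one_div, Real.inv_rpow hp0.le,
      Real.rpow_neg hp0.le, inv_inv, hgf t ht.1, Real.rpow_add hp0, Real.rpow_one]
    ring
  have e2 : EqOn (fun t => (-α * K * (b / B)) * (g t * levelDensity g α σ t ^ (1 + α)))
      (fun t => f t ^ 2 * deriv Q (1 / p t)) (posSet T p) := by
    intro t ht
    have hp0 : 0 < p t := ht.2
    have : -α * K * (b / B) * (g t * levelDensity g α σ t ^ (1 + α))
      = -α * K * (g t * (levelDensity g α σ t ^ (1 + α) * (b / B))) := by ring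
    simp only [this]
    rw [hpow, ← hpI t ht.1, deriv_eq_of_rpow hQ (by positivity), one_div, Real.inv_rpow hp0.le,
      show -α - 1 = -(1 + α) by ring, Real.rpow_neg hp0.le, inv_inv, hgf t ht.1]
    ring
  have v1 : ∫ t in posSet T p, f t ^ 2 * Q (1 / p t) * p t = K * b * (1 + α) * W / 2 := by
    rw [← setIntegral_congr_fun hms e1, integral_const_mul, hval]
    field_simp
  have v2 : ∫ t in posSet T p, f t ^ 2 * deriv Q (1 / p t) = -α * (K * b * (1 + α) * W / 2) := by
    rw [← setIntegral_congr_fun hms e2, integral_const_mul, hval]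
    field_simp
  have v3 : ∫ t in Icc (-T) T, f t ^ 2 * p t = W := by
    rw [setIntegral_congr_fun (g := fun t => g t * levelDensity g α σ t / B) measurableSet_Icc
      fun t ht => by simp only [hpI t ht, hgf t ht]; ring, integral_div, hC]
    field_simp
  -- Since p^α = b (1 - σ/g)₊ with b = B^(-α), and the prefactor of the formula is 1/(K(1+α)), the
  -- multipliers must be μ = K b (1+α) and τ = μσ.
  refine ⟨K * b * (1 + α), K * b * (1 + α) * σ, ?_,
    (integrableOn_congr_fun e1 hms).1 (hint.const_mul _),
    (integrableOn_congr_fun e2 hms).1 (hint.const_mul _), ?_, ?_⟩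
  · rw [hp, optDensity, hfac]
    refine indicator_congr fun t ht => ?_
    rw [levelDensity]
    have hg0 : g t = 0 ↔ f t = 0 := by rw [hgf t ht]; simp
    by_cases h : f t = 0
    · rw [if_pos (hg0.2 h), if_pos h, zero_div]
    · rw [if_neg (hg0.not.2 h), if_neg h, hgf t ht]
      have e3 : 1 / (K * (1 + α)) * (K * b * (1 + α) - K * b * (1 + α) * σ / f t ^ 2)
          = b * (1 - σ / f t ^ 2) := by
        field_simp
      have e4 : max 0 (b * (1 - σ / f t ^ 2)) = b * max 0 (1 - σ / f t ^ 2) := by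
        rw [mul_max_of_nonneg _ _ hb0.le, mul_zero]
      rw [e3, e4, Real.mul_rpow hb0.le (le_max_left _ _), hb, ← Real.rpow_mul hB0.le,
        show -α * (1 / α) = -1 by field_simp, Real.rpow_neg_one]
      ring
  · rw [v1, v3]; field_simp
  · rw [v1, v2, hσ]; ring

end Multipliers


/-! ### Sharp bound and its attainment -/

section Optimality

variable {f g Q : ℝ → ℝ} {α K T : ℝ}

/-- Eliminating r through s^α r = (1+α)W/2 writes r/W² exactly as ((1+α)/2)^(1+α) over W^(1-α)
(s(1+α)W/2)^α. The only loss is in h2 and h3, so attaining the bound forces equality in h2. -/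
theorem div_sq_lower_bound {W s r A Φ : ℝ} (hα : 0 < α) (hW : 0 < W) (hs : 0 < s)
    (h1 : s ^ α * r = (1 + α) * W / 2) (h2 : s * ((1 + α) * W / 2) ≤ A)
    (h3 : W ^ (1 - α) * A ^ α ≤ Φ) :
    ((1 + α) / 2) ^ (1 + α) / Φ ≤ r / W ^ 2 ∧
      (r / W ^ 2 ≤ ((1 + α) / 2) ^ (1 + α) / Φ → s * ((1 + α) * W / 2) = A) := by
  set κ := ((1 + α) / 2) ^ (1 + α) with hκ
  have hκ0 : 0 < κ := by positivity
  set w := (1 + α) * W / 2 with hw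
  have hw0 : 0 < w := by positivity
  set Ψ := W ^ (1 - α) * (s * w) ^ α with hΨ
  have hΨ0 : 0 < Ψ := by positivity
  have hsα : 0 < s ^ α := by positivity
  have e : r / W ^ 2 = κ / Ψ := by
    have hr : r = w / s ^ α := by rw [eq_div_iff hsα.ne', mul_comm]; exact h1
    have e1 : W ^ (1 - α) * W ^ α = W := by
      rw [← Real.rpow_add hW, sub_add_cancel, Real.rpow_one]
    have e2 : Ψ = W * ((1 + α) / 2) ^ α * s ^ α := by
      rw [hΨ, Real.mul_rpow hs.le hw0.le, hw, show (1 + α) * W / 2 = (1 + α) / 2 * W by ring,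
        Real.mul_rpow (by positivity) hW.le]
      linear_combination (((1 + α) / 2) ^ α * s ^ α) * e1
    have e3 : κ = ((1 + α) / 2) * ((1 + α) / 2) ^ α := by
      rw [hκ, Real.rpow_add (by positivity), Real.rpow_one]
    have : 0 < ((1 + α) / 2) ^ α := by positivity
    rw [hr, e2, e3, hw]
    field_simp
  have hle : Ψ ≤ Φ := by
    refine le_trans ?_ h3
    rw [hΨ]; gcongr
  rw [e]
  refine ⟨div_le_div_of_nonneg_left hκ0.le hΨ0 hle, fun h => ?_⟩
  by_contra hne
  have hlt : Ψ < Φ := by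
    refine lt_of_lt_of_le ?_ h3
    rw [hΨ]
    have := lt_of_le_of_ne h2 hne
    gcongr
  exact absurd h (not_le.2 (div_lt_div_of_pos_left hκ0 hΨ0 hlt))

theorem integral_designOf {q : ℝ → ℝ} (hq : Measurable q) (hq0 : ∀ t, 0 ≤ q t) (h : ℝ → ℝ) :
    ∫ t, h t ∂(designOf q) = ∫ t, q t * h t := by
  rw [designOf, integral_withDensity_eq_integral_toReal_smul hq.ennreal_ofReal
    (Eventually.of_forall fun _ => ENNReal.ofReal_lt_top)]
  simp only [ENNReal.toReal_ofReal (hq0 _), smul_eq_mul]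

/-- Lower bound for the asymptotic variance, with the structure of designs that attain it. -/
theorem IsDesign.asympVariance_bound {ξ : Measure ℝ} (hξ : IsDesign T ξ) (hgc : Continuous g)
    (hg : ∀ t, 0 ≤ g t) (hgf : ∀ t ∈ Icc (-T) T, g t = f t ^ 2) (hα : 0 < α) (hα1 : α ≤ 1)
    (hK : 0 < K) (hQ : ∀ t, 0 < t → Q t = K * t ^ (-α)) {G : ℝ}
    (hG : ∀ t ∈ Icc (-T) T, g t ≤ G) {Φ : ℝ} (hΦ : 0 < Φ)
    (hmax : ∀ W', 0 < W' → W' ≤ G →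
      W' ^ (1 - α) * levelEnergy g α T ((1 - α) * W' / 2) ^ α ≤ Φ) :
    ENNReal.ofReal (K * (((1 + α) / 2) ^ (1 + α) / Φ)) ≤ asympVariance f Q ξ ∧
      (α < 1 → asympVariance f Q ξ ≤ ENNReal.ofReal (K * (((1 + α) / 2) ^ (1 + α) / Φ)) →
        ∃ W s : ℝ, 0 < W ∧ 0 < s ∧ W = ∫ t, g t ∂ξ ∧ ξ = designOf ((Icc (-T) T).indicator
          fun t => levelDensity g α ((1 - α) * W / 2) t / s)) := by
  have := hξ.1
  have hgm : Measurable fun t => ENNReal.ofReal (g t) := hgc.measurable.ennreal_ofReal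
  set W := ∫ t, g t ∂ξ with hWdef
  have hgi : Integrable g ξ := by
    refine Integrable.of_bound hgc.aestronglyMeasurable G ?_
    filter_upwards [hξ.ae_mem] with t ht
    rw [Real.norm_of_nonneg (hg t)]
    exact hG t ht
  have hWG : W ≤ G := by
    calc W ≤ ∫ _, G ∂ξ := integral_mono_ae hgi (integrable_const G) (by
            filter_upwards [hξ.ae_mem] with t ht using hG t ht)
      _ = G := by simp
  have hDW : designW f (quantile ξ) = ENNReal.ofReal W := by
    rw [hξ.designW_eq hgf, hξ.lintegral_quantile hgm.aemeasurable, hWdef,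
      ofReal_integral_eq_lintegral_ofReal hgi (Eventually.of_forall hg)]
  have hDR := hξ.designR_eq (Q := Q) hgf
  rw [asympVariance]
  split_ifs with h0
  · exact ⟨le_top, fun _ h => absurd (top_le_iff.1 h) ENNReal.ofReal_ne_top⟩
  have hW0 : 0 < W := by
    rw [hDW] at h0
    exact ENNReal.ofReal_pos.1 (pos_iff_ne_zero.2 h0)
  by_cases hR : designR f Q (quantile ξ) = ⊤
  · rw [hR, hDW, ENNReal.top_div_of_ne_top (ENNReal.pow_ne_top ENNReal.ofReal_ne_top)]
    exact ⟨le_top, fun _ h => absurd (top_le_iff.1 h) ENNReal.ofReal_ne_top⟩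
  have hWq : W = ∫ u in Ioo (0 : ℝ) 1, g (quantile ξ u) := by
    rw [hWdef]
    conv_lhs => rw [← hξ.map_quantile]
    exact integral_map hξ.aemeasurable_quantile hgc.aestronglyMeasurable
  obtain ⟨r, s, hr, hs, hRr, h1, h2, h3⟩ :=
    hξ.lower_bound hgc hg hα hα1 hK hQ hW0 hWq (hDR ▸ hR)
  obtain ⟨h4, h5⟩ := div_sq_lower_bound hα hW0 hs h1 h2 (hmax W hW0 hWG)
  rw [hDR, hRr, hDW, ← ENNReal.ofReal_pow hW0.le, ← ENNReal.ofReal_div_of_pos (by positivity),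
    mul_div_assoc]
  refine ⟨ENNReal.ofReal_le_ofReal (mul_le_mul_of_nonneg_left h4 hK.le), fun hα1 h => ?_⟩
  have h6 := le_of_mul_le_mul_left ((ENNReal.ofReal_le_ofReal_iff (by positivity)).1 h) hK
  exact ⟨W, s, hW0, hs, rfl, h3 hα1 (h5 h6)⟩

/-- The value of the criterion at the normalized extremal density at a stationary level. -/
theorem densityCriterion_levelDensity (hgc : Continuous g) (hg : ∀ t, 0 ≤ g t)
    (hgf : ∀ t ∈ Icc (-T) T, g t = f t ^ 2) (hα : 0 < α) (hα1 : α ≤ 1)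
    (hK : 0 < K) (hQ : ∀ t, 0 < t → Q t = K * t ^ (-α)) {W B : ℝ} (hW : 0 < W)
    (hB : B = ∫ t in Icc (-T) T, levelDensity g α ((1 - α) * W / 2) t) (hB0 : 0 < B)
    (hC : (∫ t in Icc (-T) T, g t * levelDensity g α ((1 - α) * W / 2) t) = W * B)
    {p : ℝ → ℝ}
    (hp : p = (Icc (-T) T).indicator fun t => levelDensity g α ((1 - α) * W / 2) t / B) :
    0 < levelEnergy g α T ((1 - α) * W / 2) ∧ IsAdmissible f T p ∧
      ∫ t in Icc (-T) T, p t = 1 ∧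
      densityCriterion f Q T p = ENNReal.ofReal (K * (((1 + α) / 2) ^ (1 + α) /
        (W ^ (1 - α) * levelEnergy g α T ((1 - α) * W / 2) ^ α))) := by
  have h1α : 0 ≤ 1 - α := by linarith
  set σ := (1 - α) * W / 2 with hσ
  have hσ0 : 0 ≤ σ := by positivity
  have hA := levelEnergy_eq (T := T) hgc hg hα hσ0
  rw [hC, ← hB] at hA
  have hA' : levelEnergy g α T σ = (1 + α) / 2 * W * B := by rw [hA, hσ]; ring
  have hpI : ∀ t ∈ Icc (-T) T, p t = levelDensity g α σ t / B := fun t ht => by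
    rw [hp, indicator_of_mem ht]
  have v3 : ∫ t in Icc (-T) T, f t ^ 2 * p t = W := by
    rw [setIntegral_congr_fun (g := fun t => g t * levelDensity g α σ t / B) measurableSet_Icc
      fun t ht => by simp only [hpI t ht, hgf t ht]; ring, integral_div, hC]
    field_simp
  have v1 : ∫ t in Icc (-T) T, p t = 1 := by
    rw [setIntegral_congr_fun measurableSet_Icc hpI, integral_div, ← hB, div_self hB0.ne']
  have hadm : IsAdmissible f T p := by
    refine ⟨fun t ht => ?_, ?_, v3 ▸ hW⟩
    · rw [hpI t ht]; exact div_nonneg (levelDensity_nonneg t) hB0.le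
    · exact (integrableOn_congr_fun hpI measurableSet_Icc).2
        ((integrableOn_levelDensity hgc hg hα hσ0).div_const B)
  refine ⟨hA' ▸ by positivity, hadm, v1, ?_⟩
  have v2 : ∫⁻ t in Icc (-T) T, ENNReal.ofReal (f t ^ 2 * Q (1 / p t) * p t)
      = ENNReal.ofReal (K * (B ^ (1 + α))⁻¹ * levelEnergy g α T σ) := by
    rw [levelEnergy, ← integral_const_mul, ofReal_integral_eq_lintegral_ofReal
      ((integrableOn_mul_levelDensity_rpow hgc hg hα hσ0).const_mul _)
      (Eventually.of_forall fun t => mul_nonneg (by positivity)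
        (mul_nonneg (hg t) (Real.rpow_nonneg (levelDensity_nonneg t) _)))]
    refine setLIntegral_congr_fun measurableSet_Icc fun t ht => ?_
    congr 1
    rw [hpI t ht]
    rcases (levelDensity_nonneg (g := g) (α := α) (σ := σ) t).eq_or_lt with h | h
    · rw [← h, Real.zero_rpow (by positivity)]; simp
    · rw [hQ _ (by positivity), one_div_div, Real.div_rpow hB0.le h.le, Real.rpow_neg hB0.le,
        Real.rpow_neg h.le, Real.rpow_add h, Real.rpow_add hB0, Real.rpow_one, Real.rpow_one,
        hgf t ht]
      field_simp
  rw [densityCriterion, v1, v2, v3, ENNReal.ofReal_one, mul_one, ← ENNReal.ofReal_pow hW.le,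
    ← ENNReal.ofReal_div_of_pos (by positivity), hA']
  congr 1
  have e1 : W = W ^ (1 - α) * W ^ α := by
    rw [← Real.rpow_add hW, sub_add_cancel, Real.rpow_one]
  have e2 : W ^ (1 - α) * ((1 + α) / 2 * W * B) ^ α = W * ((1 + α) / 2) ^ α * B ^ α := by
    rw [Real.mul_rpow (by positivity) hB0.le, Real.mul_rpow (by positivity) hW.le]
    linear_combination -(((1 + α) / 2) ^ α * B ^ α) * e1
  have : 0 < ((1 + α) / 2) ^ α := by positivity
  have : 0 < B ^ α := by positivity
  rw [e2, Real.rpow_add hB0, Real.rpow_one, Real.rpow_add (by positivity), Real.rpow_one]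
  field_simp

end Optimality

end LongRangeDesign

/-! ### The main theorem -/

open LongRangeDesign in
theorem theorem2
    (T : ℝ) (hT : 0 < T) (f : ℝ → ℝ)
    (hf : ∃ M : ℝ≥0, LipschitzOnWith M f (Set.Icc (-T) T))
    (hf0 : ∃ t ∈ Set.Icc (-T) T, f t ≠ 0)
    (α : ℝ) (hα0 : 0 < α) (hα1 : α ≤ 1)
    (F : LongRangeDesign.CorrFamily) (ρ : ℝ → ℝ) (hρ : F.Describes α ρ)
    (hlim : ∀ L : ℝ → ℝ, F = LongRangeDesign.CorrFamily.svf L → α = 1 →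
      ∀ t : ℝ, 0 < t → ∃ q : ℝ,
        Tendsto (LongRangeDesign.normalizedSum ρ (F.normalizer α) t) atTop (𝓝 q)) :
    (∀ t : ℝ, 0 < t →
      Tendsto (LongRangeDesign.normalizedSum ρ (F.normalizer α) t) atTop (𝓝 (F.Q α ρ t))) ∧
    (∃ (μ τ : ℝ) (p : ℝ → ℝ), p = LongRangeDesign.optDensity f α (F.const α ρ) T μ τ ∧
      LongRangeDesign.MultiplierEquations f (F.Q α ρ) T p μ τ ∧
      LongRangeDesign.IsOptimalDesign f (F.Q α ρ) T (LongRangeDesign.designOf p) ∧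
      LongRangeDesign.designOf p ≪ volume ∧
      LongRangeDesign.IsAdmissible f T p ∧
      ∀ g : ℝ → ℝ, LongRangeDesign.IsAdmissible f T g →
        LongRangeDesign.densityCriterion f (F.Q α ρ) T p ≤
          LongRangeDesign.densityCriterion f (F.Q α ρ) T g) ∧
    (α < 1 → ∀ ξ : Measure ℝ, LongRangeDesign.IsOptimalDesign f (F.Q α ρ) T ξ →
      ξ ≪ volume ∧
      ∃ (μ τ : ℝ) (p : ℝ → ℝ), p = LongRangeDesign.optDensity f α (F.const α ρ) T μ τ ∧
        LongRangeDesign.MultiplierEquations f (F.Q α ρ) T p μ τ ∧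
        ξ = LongRangeDesign.designOf p) := by
  obtain ⟨hc, hlimit⟩ := CorrFamily.exists_tendsto hα0 hα1 hρ hlim
  set c := F.const α ρ with hcdef
  set K := if α < 1 then c / (1 - α) else c with hKdef
  have hK0 : 0 < K := by
    rw [hKdef]; split_ifs with h
    · exact div_pos hc (by linarith)
    · exact hc
  set Q := F.Q α ρ with hQdef
  have hQ : ∀ t, 0 < t → Q t = K * t ^ (-α) := fun t ht => (hlimit t ht).limUnder_eq
  refine ⟨fun t ht => by rw [hQ t ht]; exact hlimit t ht, ?_⟩
  have hTT : -T ≤ T := by linarith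
  obtain ⟨M, hM⟩ := hf
  -- f is controlled only on [-T, T]; extending it by its endpoint values makes g continuous on the
  -- whole line without changing it on the interval.
  set g : ℝ → ℝ := fun t => IccExtend hTT ((Icc (-T) T).domRestrict f) t ^ 2 with hgdef
  have hgc : Continuous g :=
    (continuousOn_iff_continuous_domRestrict.1 hM.continuousOn).Icc_extend'.pow 2
  have hg : ∀ t, 0 ≤ g t := fun t => sq_nonneg _
  have hgf : ∀ t ∈ Icc (-T) T, g t = f t ^ 2 := fun t ht => by
    simp only [hgdef, IccExtend_of_mem hTT _ ht, domRestrict_apply]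
  obtain ⟨t₀, ht₀, hft₀⟩ := hf0
  have hgt₀ : 0 < g t₀ := by rw [hgf t₀ ht₀]; positivity
  obtain ⟨t₁, -, hG⟩ := isCompact_Icc.exists_isMaxOn ⟨t₀, ht₀⟩ hgc.continuousOn
  have hG : ∀ t ∈ Icc (-T) T, g t ≤ g t₁ := fun t ht => hG ht
  obtain ⟨W, hW, hB, hC, hmax⟩ := exists_optimal_level hgc hg hα0 hα1 hT ht₀ hgt₀ hG
  set p : ℝ → ℝ := (Icc (-T) T).indicator fun t => levelDensity g α ((1 - α) * W / 2) t /
    ∫ t in Icc (-T) T, levelDensity g α ((1 - α) * W / 2) t with hp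
  obtain ⟨hA, hadm, hp1, hval⟩ :=
    densityCriterion_levelDensity hgc hg hgf hα0 hα1 hK0 hQ hW rfl hB hC hp
  have hΦ := mul_pos (Real.rpow_pos_of_pos hW (1 - α)) (Real.rpow_pos_of_pos hA α)
  obtain ⟨hd, hvar⟩ := hadm.asympVariance_designOf hgc hg hgf hQ
  -- p already has mass one and vanishes off the interval, so its normalization is p itself.
  have hpp : ((Icc (-T) T).indicator fun t => p t / ∫ s in Icc (-T) T, p s) = p := by
    rw [hp1]
    simp only [div_one]
    exact indicator_eq_self.2 (by rw [hp]; exact support_indicator_subset)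
  rw [hpp] at hd hvar
  refine ⟨?_, fun hα1' ξ hξ => ?_⟩
  · obtain ⟨μ, τ, hμ⟩ := exists_multipliers hgc hg hgf hα0 hα1 hc hKdef hQ hW rfl hB hC hp
    refine ⟨μ, τ, p, hμ.1, hμ.2, ⟨hd, fun η hη => ?_⟩, designOf_absolutelyContinuous p, hadm,
      fun q hq => ?_⟩
    · rw [hvar, hval]
      exact (hη.asympVariance_bound hgc hg hgf hα0 hα1 hK0 hQ hG hΦ hmax).1
    · obtain ⟨hdq, hvq⟩ := hq.asympVariance_designOf hgc hg hgf hQ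
      rw [hval, ← hvq]
      exact (hdq.asympVariance_bound hgc hg hgf hα0 hα1 hK0 hQ hG hΦ hmax).1
  -- The mean V of g under ξ need not be the W chosen above. Its own total mass identifies s as ∫
  -- q_σ, and its own mean gives the consistency condition at V, so the multiplier computation
  -- applies to ξ directly.
  · obtain ⟨V, s, hV, hs, hVeq, hξeq⟩ :=
      (hξ.1.asympVariance_bound hgc hg hgf hα0 hα1 hK0 hQ hG hΦ hmax).2 hα1'
        ((hξ.2 _ hd).trans (by rw [hvar, hval]))
    have h1α : 0 < 1 - α := by linarith
    have hσ : 0 ≤ (1 - α) * V / 2 := by positivity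
    set q : ℝ → ℝ := (Icc (-T) T).indicator fun t => levelDensity g α ((1 - α) * V / 2) t / s
      with hq
    have hq0 : ∀ t, 0 ≤ q t := fun t =>
      indicator_nonneg (fun t _ => div_nonneg (levelDensity_nonneg t) hs.le) t
    have hqm : Measurable q :=
      ((measurable_levelDensity hgc).div_const s).indicator measurableSet_Icc
    have hmass : (∫ t in Icc (-T) T, levelDensity g α ((1 - α) * V / 2) t) = s := by
      have h1 : ∫ _, (1 : ℝ) ∂ξ = 1 := by
        have := hξ.1.1
        simp
      rw [hξeq, integral_designOf hqm hq0] at h1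
      simp only [mul_one] at h1
      rw [hq, integral_indicator measurableSet_Icc, integral_div] at h1
      field_simp at h1
      exact h1
    have hCV : (∫ t in Icc (-T) T, g t * levelDensity g α ((1 - α) * V / 2) t) = V * s := by
      have h1 := hVeq
      rw [hξeq, integral_designOf hqm hq0] at h1
      have h2 : (fun t => q t * g t) = (Icc (-T) T).indicator
          fun t => g t * levelDensity g α ((1 - α) * V / 2) t / s := by
        rw [hq]
        ext t
        by_cases ht : t ∈ Icc (-T) T
        · simp only [indicator_of_mem ht]; ring
        · simp only [indicator_of_notMem ht, zero_mul]
      rw [h2, integral_indicator measurableSet_Icc, integral_div] at h1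
      exact ((eq_div_iff hs.ne').1 h1).symm
    obtain ⟨μ, τ, hμ⟩ :=
      exists_multipliers hgc hg hgf hα0 hα1 hc hKdef hQ hV hmass.symm hs hCV hq
    exact ⟨hξeq ▸ designOf_absolutelyContinuous q, μ, τ, q, hμ.1, hμ.2, hξeq⟩
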